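/- Let $\mathbb{S}$ be a commutative semiring in which every nonzero element has a multiplicative inverse, $0\neq 1$, and $n\cdot 1\neq 0$ for every integer $n\ge 1$ (for instance $\mathbb{Q}^+$). **Terms.** Algebraic $\lambda$-terms are generated by $M,N ::= x \mid c_0 \mid \lambda x.M \mid (M)N \mid \alpha M \mid M+N \mid \mathbf{0}$ with $\alpha\in\mathbb{S}$ and a constant $c_0$. They are taken up to $\alpha$-conversion and modulo the least congruence that makes them a left $\mathbb{S}$-module, makes $\lambda x.M$ linear in $M$ and $(M)N$ linear in $M$. Simple resource terms are generated by $t ::= x \mid c_0 \mid \lambda x.t \mid \langle t\rangle T$ with $T$ a finite multiset of simple resource terms, up to $\alpha$-conversion. Multisets are written multiplicatively; $T(s)$ is the multiplicity of $s$ in $T$. **Resource reduction.** For $T=t_1\cdots t_n$, let $\partial_x(s,T)=\sum_{f\in\mathfrak{S}_n}\hat s[t_{f(1)}/x_1,\dots,t_{f(n)}/x_n]$ if $x$ has exactly $n$ free occurrences in $s$, where $\hat s$ is $s$ with these occurrences renamed $x_1,\dots,x_n$, and $\partial_x(s,T)=0$ otherwise. The rule $\langle\lambda x.s\rangle T\to\partial_x(s,T)$,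 applied to a redex anywhere in one occurrence of one summand (with the constructors of terms extended linearly to sums), is a reduction on finite $\mathbb{N}$-linear combinations of simple resource terms. $\mathrm{NF}(t)$ is the normal form of $t$, and $\mathrm{NF}(t)_{c_0}\in\mathbb{N}$ is the coefficient of $c_0$ in it. **Taylor coefficients.** Let $m(x)=m(c_0)=1$, $m(\lambda x.t)=m(t)$ and $m(\langle t\rangle T)=m(t)\prod_{s\in\mathrm{supp}(T)}T(s)!\,m(s)^{T(s)}$. Let $w(x,x)=w(c_0,c_0)=1$, $w(\lambda x.t,\lambda x.M)=w(t,M)$, $w(\langle t\rangle T,(M)N)=w(t,M)\prod_{s\in\mathrm{supp}(T)}w(s,N)^{T(s)}$, $w(t,\alpha M)=\alpha\,w(t,M)$, $w(t,M+N)=w(t,M)+w(t,N)$, and $w=0$ in all other cases. The coefficient of $t$ in the Taylor expansion of $M$ is $M^*_t=w(t,M)/m(t)$. **The quantitative Krivine machine.** An algebraic closure is a pair $(M,E)$ of an algebraic term and an environment $E$, a finite partial map from variables to algebraic closures. A resource closure is a pair $(T,e)$ of a finite multiset of simple resource terms and an environment $e$, a finitely supported map from variables to resource closures; $1=(1,e_0)$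 is the empty closure, $e_0$ maps every variable to $1$, and closures and environments are multiplied by $(T',e')(T'',e'')=(T'T'',e'e'')$ and $(e'e'')(x)=e'(x)e''(x)$. For stacks $\Pi$, $\pi$ of algebraic and of resource closures, the coefficient $K(M,E,\Pi)_{(t,e,\pi)}\in\mathbb{S}$ is defined by - $K(c_0,E,\emptyset)_{(c_0,e_0,\emptyset)}=1$; - $K(x,E,\Pi)_{(x,e,\pi)}=K(N,E',\Pi)_{(s,f,\pi)}$ if $E(x)=(N,E')$, $e(x)=(s,f)$ with a single term $s$, and $e(y)=1$ for all $y\neq x$; - $K(\lambda x.M,E,\Gamma::\Pi)_{(\lambda x.u,e,c::\pi)}=K(M,E_{x\mapsto\Gamma},\Pi)_{(u,e_{x\mapsto c},\pi)}$, with $x$ fresh; - $K((M)N,E,\Pi)_{(\langle t\rangle T,e,\pi)}=\sum_{e'e''=e}K(M,E,(N,E)::\Pi)_{(t,e',(T,e'')::\pi)}$; - $K(\alpha M,E,\Pi)_{(t,e,\pi)}=\alpha K(M,E,\Pi)_{(t,e,\pi)}$ and $K(M+N,E,\Pi)_{(t,e,\pi)}=K(M,E,\Pi)_{(t,e,\pi)}+K(N,E,\Pi)_{(t,e,\pi)}$;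 - $K(M,E,\Pi)_{(t,e,\pi)}=0$ in all other cases. Let $\hat K(M)_t=K(M,\emptyset,\emptyset)_{(t,e_0,\emptyset)}$. **Theorem.** For every algebraic $\lambda$-term $M$ and every simple resource term $t$, $$\hat K(M)_t = M^*_t\cdot \mathrm{NF}(t)_{c_0}.$$ -/

import Mathlib

/-! # Algebraic λ-terms

Terms are written with de Bruijn indices, so that terms are taken up to α-conversion. -/

/-- Syntax of the algebraic λ-calculus over `S`, enriched with the constant `c₀` (`const`). -/
inductive ATerm (S : Type*) where
  | var (n : ℕ) : ATerm S
  | const : ATerm S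
  | lam (M : ATerm S) : ATerm S
  | app (M N : ATerm S) : ATerm S
  | smul (a : S) (M : ATerm S) : ATerm S
  | add (M N : ATerm S) : ATerm S
  | zero : ATerm S

/-- Algebraic equality: the least congruence making terms a left `S`-module, with abstraction
linear and application linear in its function. -/
inductive AlgEq {S : Type*} [Semiring S] : ATerm S → ATerm S → Prop
  | refl (M) : AlgEq M M
  | symm {M N} : AlgEq M N → AlgEq N M
  | trans {M N P} : AlgEq M N → AlgEq N P → AlgEq M P
  | congr_lam {M M'} : AlgEq M M' → AlgEq (.lam M) (.lam M')
  | congr_app {M M' N N'} : AlgEq M M' → AlgEq N N' → AlgEq (.app M N) (.app M' N')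
  | congr_smul (a) {M M'} : AlgEq M M' → AlgEq (.smul a M) (.smul a M')
  | congr_add {M M' N N'} : AlgEq M M' → AlgEq N N' → AlgEq (.add M N) (.add M' N')
  | add_zero (M) : AlgEq (.add M .zero) M
  | add_assoc (M N P) : AlgEq (.add (.add M N) P) (.add M (.add N P))
  | add_comm (M N) : AlgEq (.add M N) (.add N M)
  | smul_add (a M N) : AlgEq (.smul a (.add M N)) (.add (.smul a M) (.smul a N))
  | add_smul (a b M) : AlgEq (.add (.smul a M) (.smul b M)) (.smul (a + b) M)
  | smul_smul (a b M) : AlgEq (.smul a (.smul b M)) (.smul (a * b) M)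
  | one_smul (M) : AlgEq (.smul 1 M) M
  | zero_smul (M) : AlgEq (.smul 0 M) .zero
  | smul_zero (a) : AlgEq (.smul a .zero) .zero
  | lam_add (M N) : AlgEq (.lam (.add M N)) (.add (.lam M) (.lam N))
  | lam_smul (a M) : AlgEq (.lam (.smul a M)) (.smul a (.lam M))
  | lam_zero : AlgEq (.lam .zero) .zero
  | zero_app (M) : AlgEq (.app .zero M) .zero
  | smul_app (a M N) : AlgEq (.app (.smul a M) N) (.smul a (.app M N))
  | add_app (M N P) : AlgEq (.app (.add M N) P) (.add (.app M P) (.app N P))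

instance ATerm.setoid (S : Type*) [Semiring S] : Setoid (ATerm S) :=
  ⟨AlgEq, AlgEq.refl, AlgEq.symm, AlgEq.trans⟩

/-- Algebraic terms: syntactic terms modulo algebraic equality. -/
abbrev AlgTerm (S : Type*) [Semiring S] : Type _ := Quotient (ATerm.setoid S)

/-- Algebraic closures `(M, E)`. An environment `E` is the list of the closures bound to the
variables `0, 1, 2, …`; its domain is `{0, …, E.length - 1}`. -/
inductive AClo (S : Type*) [Semiring S] where
  | mk (M : AlgTerm S) (E : List (AClo S)) : AClo S

/-! # Resource terms -/

/-- One layer of the syntax of simple resource terms: a variable, the constant `c₀`, an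
abstraction, or the application of a term to a finite multiset of terms. -/
inductive RShape (α : Type) : Type where
  | var (n : ℕ)
  | const
  | lam (t : α)
  | app (t : α) (T : Multiset α)

namespace RShape

/-- The action of a function on the subterms. -/
def map {α β : Type} (f : α → β) : RShape α → RShape β
  | var n => var n
  | const => const
  | lam t => lam (f t)
  | app t T => app (f t) (T.map f)

/-- Shapes with ordered argument lists, as a polynomial functor. -/
def poly : PFunctor where
  A := RShape Unit
  B := fun
    | var _ => Empty
    | const => Empty
    | lam _ => Unit
    | app _ T => Option (Fin T.card)

/-- Forget the order of the arguments. -/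
def ofPoly {α : Type} : poly α → RShape α
  | ⟨var n, _⟩ => var n
  | ⟨const, _⟩ => const
  | ⟨lam _, f⟩ => lam (f ())
  | ⟨app _ T, f⟩ => app (f none) (Multiset.ofList (List.ofFn fun i : Fin T.card => f (some i)))

/-- Choose an order of the arguments. -/
noncomputable def toPoly {α : Type} : RShape α → poly α
  | var n => ⟨var n, Empty.elim⟩
  | const => ⟨const, Empty.elim⟩
  | lam t => ⟨lam (), fun _ => t⟩
  | app t T => ⟨app () (T.map fun _ => ()), fun
      | none => t
      | some i => T.toList.get (i.cast (by simp))⟩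

theorem ofPoly_toPoly {α : Type} (x : RShape α) : ofPoly (toPoly x) = x := by
  cases x with
  | var n => rfl
  | const => rfl
  | lam t => rfl
  | app t T =>
    simp only [toPoly, ofPoly]
    congr 1
    conv_rhs => rw [← Multiset.coe_toList T]
    congr 1
    apply List.ext_get
    · simp
    · intro n h1 h2
      simp

noncomputable instance : QPF RShape where
  map := map
  P := poly
  abs := ofPoly
  repr := toPoly
  abs_repr := ofPoly_toPoly
  abs_map := by
    rintro α β f ⟨a, g⟩
    cases a with
    | var n => rfl
    | const => rfl
    | lam t => rfl
    | app t T =>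
      simp only [PFunctor.map, ofPoly, map]
      congr 1
      simp [List.map_ofFn, Function.comp_def]

end RShape

/-- Simple resource terms `t ::= x | c₀ | λx.t | ⟨t⟩T`, with `T` a finite multiset of simple
terms: the least fixed point of `RShape`. -/
abbrev RTerm : Type := QPF.Fix RShape

namespace RTerm

/-- The variable with de Bruijn index `n`. -/
noncomputable def var (n : ℕ) : RTerm := QPF.Fix.mk (.var n)
/-- The constant `c₀`. -/
noncomputable def const : RTerm := QPF.Fix.mk .const
/-- Abstraction `λx.t`. -/
noncomputable def lam (t : RTerm) : RTerm := QPF.Fix.mk (.lam t)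
/-- Application `⟨t⟩T`. -/
noncomputable def app (t : RTerm) (T : Multiset RTerm) : RTerm := QPF.Fix.mk (.app t T)

/-- The outermost layer of a term. -/
noncomputable def shape (t : RTerm) : RShape RTerm := QPF.Fix.dest t

theorem shape_var (n : ℕ) : (var n).shape = .var n := QPF.Fix.dest_mk _
theorem shape_const : const.shape = .const := QPF.Fix.dest_mk _
theorem shape_lam (t : RTerm) : (lam t).shape = .lam t := QPF.Fix.dest_mk _
theorem shape_app (t : RTerm) (T : Multiset RTerm) : (app t T).shape = .app t T :=
  QPF.Fix.dest_mk _

theorem eq_of_shape_var {t : RTerm} {n : ℕ} (h : t.shape = .var n) : t = var n := by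
  rw [var, ← h]; exact (QPF.Fix.mk_dest t).symm
theorem eq_of_shape_const {t : RTerm} (h : t.shape = .const) : t = const := by
  rw [const, ← h]; exact (QPF.Fix.mk_dest t).symm
theorem eq_of_shape_lam {t u : RTerm} (h : t.shape = .lam u) : t = lam u := by
  rw [lam, ← h]; exact (QPF.Fix.mk_dest t).symm
theorem eq_of_shape_app {t u : RTerm} {T : Multiset RTerm} (h : t.shape = .app u T) :
    t = app u T := by
  rw [app, ← h]; exact (QPF.Fix.mk_dest t).symm

/-- Structural recursion on simple terms. -/
noncomputable def fold {α : Type} (v : ℕ → α) (c : α) (l : α → α) (a : α → Multiset α → α) :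
    RTerm → α :=
  QPF.Fix.rec fun
    | .var n => v n
    | .const => c
    | .lam t => l t
    | .app t T => a t T

section fold
variable {α : Type} (v : ℕ → α) (c : α) (l : α → α) (a : α → Multiset α → α)

theorem fold_var (n : ℕ) : fold v c l a (var n) = v n := QPF.Fix.rec_eq _ _
theorem fold_const : fold v c l a const = c := QPF.Fix.rec_eq _ _
theorem fold_lam (t : RTerm) : fold v c l a (lam t) = l (fold v c l a t) := QPF.Fix.rec_eq _ _
theorem fold_app (t : RTerm) (T : Multiset RTerm) :
    fold v c l a (app t T) = a (fold v c l a t) (T.map (fold v c l a)) := QPF.Fix.rec_eq _ _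

end fold

/-- The number of symbols of a term. -/
noncomputable def size : RTerm → ℕ := fold (fun _ => 1) 1 (fun n => n + 1) (fun n T => n + T.sum + 1)

theorem size_lam (t : RTerm) : (lam t).size = t.size + 1 := fold_lam _ _ _ _ _
theorem size_app (t : RTerm) (T : Multiset RTerm) :
    (app t T).size = t.size + (T.map size).sum + 1 := fold_app _ _ _ _ _ _

theorem size_var (n : ℕ) : (var n).size = 1 := fold_var _ _ _ _ _

theorem size_le_of_mem {s : RTerm} {T : Multiset RTerm} (h : s ∈ T) :
    s.size ≤ (T.map size).sum :=
  Multiset.single_le_sum (fun _ _ => Nat.zero_le _) _ (Multiset.mem_map_of_mem _ h)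

/-- `deg t d` is the number of occurrences in `t` of the variable that has index `d` at the
root of `t`. -/
noncomputable def deg : RTerm → ℕ → ℕ :=
  fold (α := ℕ → ℕ) (fun n d => if n = d then 1 else 0) (fun _ => 0) (fun t d => t (d + 1))
    (fun t T d => t d + (T.map fun s => s d).sum)

/-- `shift t k d` adds `k` to the variables of `t` whose index is at least `d`. -/
noncomputable def shift (t : RTerm) (k : ℕ) : ℕ → RTerm :=
  fold (α := ℕ → RTerm) (fun n d => if n < d then var n else var (n + k)) (fun _ => const)
    (fun t d => lam (t (d + 1))) (fun t T d => app (t d) (T.map fun s => s d)) t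

/-- Run a list of list-consuming functions one after the other. -/
def thread {α β : Type} : List (List β → α × List β) → List β → List α × List β
  | [], l => ([], l)
  | f :: fs, l => ((f l).1 :: (thread fs (f l).2).1, (thread fs (f l).2).2)

/-- `fill t d [u₁, u₂, …]` enumerates the occurrences in `t` of the variable with index `d` (in
some order of the arguments in each multiset), replaces the `i`-th of them by `uᵢ`, and removes
this variable from the context. It returns the resulting term with the unused part of the list.
It is only used with as many terms `uᵢ` as there are occurrences. -/
noncomputable def fill : RTerm → ℕ → List RTerm → RTerm × List RTerm :=
  fold (α := ℕ → List RTerm → RTerm × List RTerm)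
    (fun n d us =>
      if n < d then (var n, us)
      else if n = d then
        match us with
        | [] => (var n, [])
        | u :: us => (u.shift d 0, us)
      else (var (n - 1), us))
    (fun _ us => (const, us))
    (fun t d us => (lam (t (d + 1) us).1, (t (d + 1) us).2))
    (fun t T d us =>
      (app (t d us).1 (Multiset.ofList (thread (T.toList.map fun s => s d) (t d us).2).1),
        (thread (T.toList.map fun s => s d) (t d us).2).2))

/-- Linear substitution `∂ₓ(s, T)` for the variable `x` of index `0`: the sum, over the
permutations `f` of the `n` elements `t₁ … tₙ` of `T`, of the terms obtained by replacing the `n`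
occurrences of `x` in `s` by `t_{f(1)}, …, t_{f(n)}`, and `0` if `x` does not have exactly `n`
occurrences. -/
noncomputable def linSubst (s : RTerm) (T : Multiset RTerm) : RTerm →₀ ℕ :=
  if s.deg 0 = T.card then
    ∑ f : Equiv.Perm (Fin T.toList.length),
      Finsupp.single (s.fill 0 (List.ofFn fun i => T.toList.get (f i))).1 1
  else 0

/-- Reduction `s → 𝒮` of one redex in a simple term `s`; the result is a linear combination
of simple terms, and the constructors of terms are extended to combinations by linearity. -/
inductive Red : RTerm → (RTerm →₀ ℕ) → Prop
  | beta (s : RTerm) (T : Multiset RTerm) : Red (app (lam s) T) (linSubst s T)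
  | lam {s : RTerm} {U : RTerm →₀ ℕ} : Red s U → Red (lam s) (U.mapDomain lam)
  | app_left {s : RTerm} {U : RTerm →₀ ℕ} (T : Multiset RTerm) :
      Red s U → Red (app s T) (U.mapDomain fun s' => app s' T)
  | app_right (u : RTerm) {s : RTerm} {U : RTerm →₀ ℕ} (T : Multiset RTerm) :
      Red s U → Red (app u (s ::ₘ T)) (U.mapDomain fun s' => app u (s' ::ₘ T))

/-- Reduction of linear combinations: one occurrence of one summand is reduced. -/
inductive Step : (RTerm →₀ ℕ) → (RTerm →₀ ℕ) → Prop
  | mk {s : RTerm} {U : RTerm →₀ ℕ} (V : RTerm →₀ ℕ) :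
      Red s U → Step (Finsupp.single s 1 + V) (U + V)

/-- A combination is normal if it does not reduce. -/
def IsNormal (U : RTerm →₀ ℕ) : Prop := ∀ V, ¬ Step U V

open Classical in
/-- The normal form of a linear combination (it exists and is unique, since the reduction is
strongly normalizing and confluent). -/
noncomputable def NF (U : RTerm →₀ ℕ) : RTerm →₀ ℕ :=
  if h : ∃ V, Relation.ReflTransGen Step U V ∧ IsNormal V then h.choose else 0

end RTerm

/-! # Resource states -/

/-- Resource closures `(T, e)`. An environment `e` is the list of the closures bound to the
variables `0, 1, 2, …` in scope; all other variables are bound to the empty closure. -/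
inductive RClo : Type where
  | mk (T : Multiset RTerm) (e : List RClo) : RClo

/-- The multiset of a closure. -/
def RClo.terms : RClo → Multiset RTerm
  | .mk T _ => T

/-- The environment of a closure. -/
def RClo.env : RClo → List RClo
  | .mk _ e => e

/-- The empty closure `1 = (1, e₀)`. -/
def RClo.one : RClo := .mk 0 []

/-- The closure `e(x)`. -/
def envAt (e : List RClo) (x : ℕ) : RClo := e.getD x RClo.one

mutual
/-- The closure is the empty closure `1 = (1, e₀)`, up to trailing empty closures in the lists. -/
def RClo.IsOne : RClo → Prop
  | .mk T e => T = 0 ∧ envIsOne e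
/-- The environment is `e₀`: it maps all variables to the empty closure. -/
def envIsOne : List RClo → Prop
  | [] => True
  | c :: e => c.IsOne ∧ envIsOne e
end

mutual
/-- The number of symbols of a closure. -/
noncomputable def RClo.size : RClo → ℕ
  | .mk T e => (T.map RTerm.size).sum + envSize e
/-- The number of symbols of an environment, or of a stack. -/
noncomputable def envSize : List RClo → ℕ
  | [] => 0
  | c :: e => c.size + envSize e
end

open Classical in
mutual
/-- The pairs `(c', c'')` with `c'c'' = c`, where `(T', e')(T'', e'') = (T'T'', e'e'')`. -/
noncomputable def RClo.splits : RClo → Finset (RClo × RClo)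
  | .mk T e => (T.antidiagonal.toFinset ×ˢ envSplits e).image
      fun p => (.mk p.1.1 p.2.1, .mk p.1.2 p.2.2)
/-- The pairs `(e', e'')` with `e'e'' = e`, where the product is taken pointwise. -/
noncomputable def envSplits : List RClo → Finset (List RClo × List RClo)
  | [] => {([], [])}
  | c :: e => (c.splits ×ˢ envSplits e).image
      fun p => (p.1.1 :: p.2.1, p.1.2 :: p.2.2)
end

mutual
theorem RClo.size_of_mem_splits : ∀ (c : RClo) (p : RClo × RClo), p ∈ c.splits →
    p.1.size + p.2.size = c.size
  | .mk T e, p, hp => by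
    rw [RClo.splits] at hp
    simp only [Finset.mem_image, Finset.mem_product, Multiset.mem_toFinset,
      Multiset.mem_antidiagonal] at hp
    obtain ⟨q, ⟨h1, h2⟩, rfl⟩ := hp
    have := size_of_mem_envSplits e q.2 h2
    have h3 := congrArg (fun T => (Multiset.map RTerm.size T).sum) h1
    simp only [Multiset.map_add, Multiset.sum_add] at h3
    simp only [RClo.size]
    omega
theorem size_of_mem_envSplits : ∀ (e : List RClo) (p : List RClo × List RClo),
    p ∈ envSplits e → envSize p.1 + envSize p.2 = envSize e
  | [], p, hp => by
    rw [envSplits] at hp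
    simp only [Finset.mem_singleton] at hp
    subst hp
    simp [envSize]
  | c :: e, p, hp => by
    rw [envSplits] at hp
    simp only [Finset.mem_image, Finset.mem_product] at hp
    obtain ⟨q, ⟨h1, h2⟩, rfl⟩ := hp
    have h3 := size_of_mem_envSplits e q.2 h2
    have h4 := RClo.size_of_mem_splits c q.1 h1
    simp only [envSize]
    omega
end

theorem RClo.size_eq (c : RClo) : c.size = (c.terms.map RTerm.size).sum + envSize c.env := by
  cases c
  rw [RClo.size, terms, env]

theorem size_envAt_le (e : List RClo) (x : ℕ) : (envAt e x).size ≤ envSize e := by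
  induction e generalizing x with
  | nil => simp [envAt, RClo.one, RClo.size, envSize]
  | cons d e ih =>
    rw [envSize]
    cases x with
    | zero => simp [envAt]
    | succ x =>
      have h : envAt (d :: e) (x + 1) = envAt e x := by simp [envAt]
      rw [h]
      have := ih x
      omega

/-! # The quantitative Krivine machine -/

open Classical in
/-- The coefficient `K(M, E, Π)_{(t, e, π)}`, for a syntactic representative `M` of the term at
the head of the algebraic state. -/
noncomputable def kamAux {S : Type*} [Semiring S] :
    ATerm S → List (AClo S) → List (AClo S) → RTerm → List RClo → List RClo → S
  | .const, _, Ps, t, e, ps =>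
      if Ps = [] ∧ t = RTerm.const ∧ envIsOne e ∧ ps = [] then 1 else 0
  | .var x, E, Ps, t, e, ps =>
      if h : t = RTerm.var x ∧ (∀ y, y ≠ x → (envAt e y).IsOne) ∧
          ∃ s, (envAt e x).terms = {s} then
        match E[x]? with
        | some (.mk N E') => kamAux N.out E' Ps h.2.2.choose (envAt e x).env ps
        | none => 0
      else 0
  | .lam M, E, Ps, t, e, ps =>
      match _ht : t.shape with
      | .lam u =>
          match Ps, ps with
          | G :: Ps, c :: ps => kamAux M (G :: E) Ps u (c :: e) ps
          | _, _ => 0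
      | _ => 0
  | .app M N, E, Ps, t, e, ps =>
      match _ht : t.shape with
      | .app u T => ∑ p ∈ (envSplits e).attach,
          kamAux M E (.mk ⟦N⟧ E :: Ps) u p.1.1 (.mk T p.1.2 :: ps)
      | _ => 0
  | .smul a M, E, Ps, t, e, ps => a * kamAux M E Ps t e ps
  | .add M N, E, Ps, t, e, ps => kamAux M E Ps t e ps + kamAux N E Ps t e ps
  | .zero, _, _, _, _, _ => 0
termination_by M _ _ t e ps => (t.size + envSize e + envSize ps, sizeOf M)
decreasing_by
  · have h1 := size_envAt_le e x
    rw [RClo.size_eq, h.2.2.choose_spec] at h1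
    simp only [Multiset.map_singleton, Multiset.sum_singleton] at h1
    have h2 : t.size = 1 := by rw [h.1, RTerm.size_var]
    apply Prod.Lex.left
    generalize_proofs at *
    omega
  · apply Prod.Lex.left
    rw [RTerm.eq_of_shape_lam _ht, RTerm.size_lam]
    simp only [envSize]
    omega
  · apply Prod.Lex.left
    have h1 := size_of_mem_envSplits e p.1 p.2
    rw [RTerm.eq_of_shape_app _ht, RTerm.size_app]
    simp only [envSize, RClo.size]
    omega
  · apply Prod.Lex.right
    simp
  · apply Prod.Lex.right
    simp
    omega
  · apply Prod.Lex.right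
    simp

theorem kamAux_app_congr {S : Type*} [Semiring S] {M M' N N' : ATerm S}
    (hM : ∀ E Ps t e ps, kamAux M E Ps t e ps = kamAux M' E Ps t e ps)
    (hN : (⟦N⟧ : AlgTerm S) = ⟦N'⟧) (E Ps t e ps) :
    kamAux (.app M N) E Ps t e ps = kamAux (.app M' N') E Ps t e ps := by
  rw [kamAux, kamAux]
  simp only [hM, hN]

theorem kamAux_congr {S : Type*} [Semiring S] {M M' : ATerm S} (h : AlgEq M M') :
    ∀ E Ps t e ps, kamAux M E Ps t e ps = kamAux M' E Ps t e ps := by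
  induction h with
  | refl M => intros; rfl
  | symm _ ih => intros; rw [ih]
  | trans _ _ ih1 ih2 => intros; rw [ih1, ih2]
  | congr_lam _ ih => intro E Ps t e ps; rw [kamAux, kamAux]; simp only [ih]
  | congr_app _ hN ih1 _ => exact kamAux_app_congr ih1 (Quotient.sound hN)
  | congr_smul a _ ih => intros; simp only [kamAux, ih]
  | congr_add _ _ ih1 ih2 => intros; simp only [kamAux, ih1, ih2]
  | add_zero M => intros; simp only [kamAux, _root_.add_zero]
  | add_assoc M N P => intros; simp only [kamAux, _root_.add_assoc]
  | add_comm M N => intros; simp only [kamAux, _root_.add_comm]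
  | smul_add a M N => intros; simp only [kamAux, mul_add]
  | add_smul a b M => intros; simp only [kamAux, add_mul]
  | smul_smul a b M => intros; simp only [kamAux, mul_assoc]
  | one_smul M => intros; simp only [kamAux, one_mul]
  | zero_smul M => intros; simp only [kamAux, zero_mul]
  | smul_zero a => intros; simp only [kamAux, mul_zero]
  | lam_add M N =>
    intro E Ps t e ps
    simp only [kamAux]
    cases t.shape <;> cases Ps <;> cases ps <;> simp
  | lam_smul a M =>
    intro E Ps t e ps
    simp only [kamAux]
    cases t.shape <;> cases Ps <;> cases ps <;> simp
  | lam_zero =>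
    intro E Ps t e ps
    simp only [kamAux]
    cases t.shape <;> cases Ps <;> cases ps <;> rfl
  | zero_app M =>
    intro E Ps t e ps
    simp only [kamAux]
    split <;> simp
  | smul_app a M N =>
    intro E Ps t e ps
    simp only [kamAux]
    split <;> simp [Finset.mul_sum]
  | add_app M N P =>
    intro E Ps t e ps
    simp only [kamAux]
    split <;> simp [Finset.sum_add_distrib]

/-- The quantitative Krivine machine: the coefficient `K(M, E, Π)_{(t, e, π)}`. -/
noncomputable def kam {S : Type*} [Semiring S] (M : AlgTerm S) (E Ps : List (AClo S))
    (t : RTerm) (e ps : List RClo) : S :=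
  Quotient.lift (fun M => kamAux M E Ps t e ps) (fun _ _ h => kamAux_congr h E Ps t e ps) M

/-- The coefficient of `(M, t)` in the machine, started on empty environments and stacks. -/
noncomputable def kamHat {S : Type*} [Semiring S] (M : AlgTerm S) (t : RTerm) : S :=
  kam M [] [] t [] []

/-! # Taylor expansion -/

open Classical in
/-- The multiplicity `m(t)` of a resource term. -/
noncomputable def RTerm.mult (t : RTerm) : ℕ :=
  match _ht : t.shape with
  | .var _ => 1
  | .const => 1
  | .lam u => u.mult
  | .app u T => u.mult * ∏ s ∈ T.toFinset.attach,
      (T.count s.1).factorial * s.1.mult ^ T.count s.1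
termination_by t.size
decreasing_by
  · rw [RTerm.eq_of_shape_lam _ht, RTerm.size_lam]
    omega
  · rw [RTerm.eq_of_shape_app _ht, RTerm.size_app]
    omega
  · have := RTerm.size_le_of_mem (Multiset.mem_toFinset.1 s.2)
    rw [RTerm.eq_of_shape_app _ht, RTerm.size_app]
    omega

open Classical in
/-- The weight `w(t, M)`, for a syntactic representative `M`. -/
noncomputable def weightAux {S : Type*} [CommSemiring S] : ATerm S → RTerm → S
  | .var x, t => if t = RTerm.var x then 1 else 0
  | .const, t => if t = RTerm.const then 1 else 0
  | .lam M, t =>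
      match t.shape with
      | .lam u => weightAux M u
      | _ => 0
  | .app M N, t =>
      match t.shape with
      | .app u T => weightAux M u * ∏ s ∈ T.toFinset, weightAux N s ^ T.count s
      | _ => 0
  | .smul a M, t => a * weightAux M t
  | .add M N, t => weightAux M t + weightAux N t
  | .zero, _ => 0

theorem weightAux_congr {S : Type*} [CommSemiring S] {M M' : ATerm S} (h : AlgEq M M') :
    ∀ t, weightAux M t = weightAux M' t := by
  induction h with
  | refl M => intro; rfl
  | symm _ ih => intro; rw [ih]
  | trans _ _ ih1 ih2 => intro; rw [ih1, ih2]
  | congr_lam _ ih => intro t; simp only [weightAux, ih]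
  | congr_app _ _ ih1 ih2 => intro t; simp only [weightAux, ih1, ih2]
  | congr_smul a _ ih => intro; simp only [weightAux, ih]
  | congr_add _ _ ih1 ih2 => intro; simp only [weightAux, ih1, ih2]
  | add_zero M => intro; simp only [weightAux, _root_.add_zero]
  | add_assoc M N P => intro; simp only [weightAux, _root_.add_assoc]
  | add_comm M N => intro; simp only [weightAux, _root_.add_comm]
  | smul_add a M N => intro; simp only [weightAux, mul_add]
  | add_smul a b M => intro; simp only [weightAux, add_mul]
  | smul_smul a b M => intro; simp only [weightAux, mul_assoc]
  | one_smul M => intro; simp only [weightAux, one_mul]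
  | zero_smul M => intro; simp only [weightAux, zero_mul]
  | smul_zero a => intro; simp only [weightAux, mul_zero]
  | lam_add M N => intro t; simp only [weightAux]; split <;> simp
  | lam_smul a M => intro t; simp only [weightAux]; split <;> simp
  | lam_zero => intro t; simp only [weightAux]; split <;> rfl
  | zero_app M => intro t; simp only [weightAux]; split <;> simp
  | smul_app a M N => intro t; simp only [weightAux]; split <;> simp [mul_assoc]
  | add_app M N P => intro t; simp only [weightAux]; split <;> simp [add_mul]

/-- The weight `w(t, M)` of a resource term in an algebraic term. -/
noncomputable def weight {S : Type*} [CommSemiring S] (t : RTerm) (M : AlgTerm S) : S :=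
  Quotient.lift (fun M => weightAux M t) (fun _ _ h => weightAux_congr h t) M

/-- The Taylor expansion `M* = ∑ₜ (w(t, M) / m(t)) t`, as the family of its coefficients. -/
noncomputable def taylor {S : Type*} [Semifield S] (M : AlgTerm S) (t : RTerm) : S :=
  weight t M / (t.mult : S)

-- The division by `m(t)` hides the induction, so the identity is first proved without it, over any
-- commutative semiring and from arbitrary states (`kamAux_mul_mult`): the coefficient of the
-- machine times `m(t) m(e) m(π)` is `w(t,M) w(e,E) w(π,Π)` times the coefficient of `c₀` in the
-- head normal form of `t`, with the closures of `e` linearly substituted in it, applied to the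
-- closures of `π`. The induction is on the size of the resource state, then on `M` for the linear
-- constructors, which leave that state unchanged. With empty environments and stacks this is the
-- theorem, since `m(t)` is a nonzero integer, hence invertible.
--
-- The delicate transition is the application. The machine sums over the distinct pairs with `e'e''
-- = e`, whereas linear substitution in `⟨t⟩T` distributes the occurrences of the closures, and so
-- meets each pair as many times as labelled occurrences can produce it. A pair `(A, B)` of bags
-- arises `T! / (A! B!)` times, where `T!` is the product of the factorials of the multiplicities
-- (`count_antidiagonal_mul`). The factors `m` are exactly what turns one sum into the other
-- (`sum_envLabSplits_mult`). The weights, being multiplicative, are the same for all splittings of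
-- a given environment (`envWeight_envLabSplits`).
--
-- To compute with linear substitution, bags are seen as monomials of a commutative algebra over
-- `ℕ`, with the splittings of a bag as coproduct. The sum over permutations defining `∂ₓ(s,T)` is
-- the iterated derivative of `s` at `x` along the elements of `T`, followed by the removal of the
-- terms where `x` remains (`RTerm.linSubst_eq`). The Leibniz rule then says how substitution
-- distributes over an application (`lsub_appL`, `act_appL`), and substitution is itself compatible
-- with the coproduct (`cop_lsubB`).
--
-- It remains to relate head reduction, which the machine follows, to the normal form. The
-- functional `headL p` counts how often the head reduction against the stack `p` ends on `c₀`. It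
-- is invariant under the reduction of any redex (`redInv_headL`), by an induction on size in which
-- derivatives and substitutions of invariant functionals are again invariant. On a normal
-- combination, `headL []` is the coefficient of `c₀` (`headL_of_normal`). Since every step makes
-- terms smaller, normal forms exist, and all of them have the same coefficient at `c₀`, so
-- confluence is not needed.

/-! # Combinations of terms and of bags -/

namespace RTerm

/-- Induction on simple terms. -/
theorem induct {p : RTerm → Prop} (var : ∀ n, p (var n)) (const : p const)
    (lam : ∀ t, p t → p (lam t))
    (app : ∀ t T, p t → (∀ s ∈ T, p s) → p (app t T)) (t : RTerm) : p t := by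
  induction h : t.size using Nat.strong_induction_on generalizing t with
  | _ n ih =>
    subst h
    cases hs : t.shape with
    | var n => rw [eq_of_shape_var hs]; exact var n
    | const => rw [eq_of_shape_const hs]; exact const
    | lam u =>
      rw [eq_of_shape_lam hs] at ih ⊢
      exact lam u (ih _ (by rw [size_lam]; omega) u rfl)
    | app u T =>
      rw [eq_of_shape_app hs] at ih ⊢
      refine app u T (ih _ (by rw [size_app]; omega) u rfl) fun s hsT => ih _ ?_ s rfl
      have := size_le_of_mem hsT
      rw [size_app]; omega

end RTerm

/-- Finite linear combinations of simple terms. -/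
abbrev Comb : Type := RTerm →₀ ℕ

/-- Finite linear combinations of bags (finite multisets of simple terms). -/
abbrev Bags : Type := AddMonoidAlgebra ℕ (Multiset RTerm)

/-- A simple term as a combination. -/
noncomputable def pt (t : RTerm) : Comb := Finsupp.single t 1

/-- A bag as a combination. -/
noncomputable def bag (T : Multiset RTerm) : Bags := AddMonoidAlgebra.single T 1

/-- Coefficients are natural numbers, so sums of simple terms exhaust the combinations and no case
for scalars is needed. -/
theorem comb_ind {p : Comb → Prop} (v : Comb) (zero : p 0) (add : ∀ x y, p x → p y → p (x + y))
    (pt : ∀ t, p (pt t)) : p v := by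
  induction v using Finsupp.induction_linear with
  | zero => exact zero
  | add x y hx hy => exact add x y hx hy
  | single t n =>
    induction n with
    | zero => simpa using zero
    | succ n ih => rw [Finsupp.single_add]; exact add _ _ ih (pt t)

theorem bag_ind {p : Bags → Prop} (b : Bags) (zero : p 0)
    (add : ∀ x y, p x → p y → p (x + y)) (bag : ∀ T, p (bag T)) : p b := by
  suffices h : ∀ f : Multiset RTerm →₀ ℕ, p (AddMonoidAlgebra.ofCoeff f) from h b.coeff
  intro f
  induction f using Finsupp.induction_linear with
  | zero => exact zero
  | add x y hx hy => exact add _ _ hx hy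
  | single t n =>
    induction n with
    | zero => rw [Finsupp.single_zero]; exact zero
    | succ n ih => rw [Finsupp.single_add]; exact add _ _ ih (bag t)

section lift
variable {X : Type*} [AddCommMonoid X]

/-- Linear extension from simple terms to combinations. -/
noncomputable def combLift (f : RTerm → X) : Comb →+ X :=
  Finsupp.liftAddHom fun t => (multiplesHom X) (f t)

/-- Linear extension from bags to combinations. -/
noncomputable def bagLift (f : Multiset RTerm → X) : Bags →+ X where
  toFun b := Finsupp.liftAddHom (fun t => (multiplesHom X) (f t)) b.coeff
  map_zero' := by simp
  map_add' x y := by simp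

@[simp] theorem combLift_pt (f : RTerm → X) (t : RTerm) : combLift f (pt t) = f t := by
  simp [combLift, pt]

@[simp] theorem bagLift_bag (f : Multiset RTerm → X) (T : Multiset RTerm) :
    bagLift f (bag T) = f T := by
  change Finsupp.liftAddHom _ (Finsupp.single T 1) = f T
  simp

end lift

theorem bag_zero : bag 0 = 1 := rfl

theorem bag_add (T U : Multiset RTerm) : bag (T + U) = bag T * bag U := by
  simp [bag, AddMonoidAlgebra.single_mul_single]

/-- Combinations of terms as combinations of singleton bags. -/
noncomputable def sing : Comb →+ Bags := combLift fun t => bag {t}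

@[simp] theorem sing_pt (t : RTerm) : sing (pt t) = bag {t} := combLift_pt _ _

theorem bag_cons (t : RTerm) (T : Multiset RTerm) : bag (t ::ₘ T) = sing (pt t) * bag T := by
  rw [sing_pt, ← bag_add, Multiset.singleton_add]

theorem bag_eq_prod (T : Multiset RTerm) : bag T = (T.map fun t => sing (pt t)).prod := by
  induction T using Multiset.induction with
  | empty => exact bag_zero
  | cons t T ih => rw [bag_cons, ih, Multiset.map_cons, Multiset.prod_cons]

/-- Linear extension of abstraction. -/
noncomputable def lamL : Comb →+ Comb := combLift fun t => pt (.lam t)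

@[simp] theorem lamL_pt (t : RTerm) : lamL (pt t) = pt (.lam t) := combLift_pt _ _

/-- Bilinear extension of application. -/
noncomputable def appL : Comb →+ Bags →+ Comb :=
  combLift fun t => bagLift fun T => pt (.app t T)

@[simp] theorem appL_pt_bag (t : RTerm) (T : Multiset RTerm) :
    appL (pt t) (bag T) = pt (.app t T) := by
  simp [appL]

/-- The algebra homomorphism on bags that maps each term `t` to `f t`. -/
noncomputable def bagHom (f : RTerm → Comb) : Bags →+* Bags :=
  (AddMonoidAlgebra.lift ℕ Bags (Multiset RTerm)
    { toFun := fun T => (T.toAdd.map fun t => sing (f t)).prod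
      map_one' := by simp
      map_mul' := fun T U => by simp }).toRingHom

theorem bagHom_bag (f : RTerm → Comb) (T : Multiset RTerm) :
    bagHom f (bag T) = (T.map fun t => sing (f t)).prod := by
  change AddMonoidAlgebra.lift ℕ Bags (Multiset RTerm) _ (AddMonoidAlgebra.single T 1) = _
  rw [AddMonoidAlgebra.lift_single, one_smul]; rfl

@[simp] theorem bagHom_sing (f : RTerm → Comb) (v : Comb) :
    bagHom f (sing v) = sing (combLift f v) := by
  induction v using comb_ind with
  | zero => simp
  | add x y hx hy => simp [hx, hy]
  | pt t => simp [bagHom_bag]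

open Classical in
/-- The derivation on bags that maps each term `t` to `f t`. -/
noncomputable def bagDer (f : RTerm → Comb) : Bags →+ Bags :=
  bagLift fun T => (T.map fun t => sing (f t) * bag (T.erase t)).sum

theorem bagDer_one (f : RTerm → Comb) : bagDer f 1 = 0 := by
  rw [← bag_zero, bagDer, bagLift_bag]; simp

theorem bagDer_bag_cons (f : RTerm → Comb) (t : RTerm) (T : Multiset RTerm) :
    bagDer f (bag (t ::ₘ T)) = sing (f t) * bag T + bag {t} * bagDer f (bag T) := by
  classical
  simp only [bagDer, bagLift_bag, Multiset.map_cons, Multiset.sum_cons, Multiset.erase_cons_head,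
    ← Multiset.sum_map_mul_left]
  congr 2
  refine Multiset.map_congr rfl fun s hs => ?_
  -- Since `s ∈ T`, the occurrence to erase can be taken in `T` even when `s = t`.
  have : (t ::ₘ T).erase s = t ::ₘ T.erase s := by
    by_cases h : t = s
    · subst h; rw [Multiset.erase_cons_head, Multiset.cons_erase hs]
    · rw [Multiset.erase_cons_tail]; exact h
  rw [this, bag_cons, sing_pt]; ring

theorem bagDer_mul (f : RTerm → Comb) (a b : Bags) :
    bagDer f (a * b) = bagDer f a * b + a * bagDer f b := by
  induction a using bag_ind with
  | zero => simp
  | add x y hx hy => simp only [add_mul, map_add, hx, hy]; ring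
  | bag T =>
    induction b using bag_ind with
    | zero => simp
    | add x y hx hy => simp only [mul_add, map_add, hx, hy]; ring
    | bag U =>
      induction T using Multiset.induction with
      | empty => simp [bag_zero, bagDer_one]
      | cons t T ih =>
        rw [← bag_add, Multiset.cons_add, bagDer_bag_cons, bag_add, ih, bagDer_bag_cons, bag_cons,
          sing_pt]
        ring

@[simp] theorem bagDer_sing (f : RTerm → Comb) (v : Comb) :
    bagDer f (sing v) = sing (combLift f v) := by
  induction v using comb_ind with
  | zero => simp
  | add x y hx hy => simp [hx, hy]
  | pt t =>
    have := bagDer_bag_cons f t 0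
    rw [bag_zero, bagDer_one] at this
    simpa using this

namespace RTerm

/-! # Shifts -/

theorem shift_var (n k c : ℕ) : (var n).shift k c = if n < c then var n else var (n + k) := by
  rw [shift, fold_var]

theorem shift_const (k c : ℕ) : const.shift k c = const := by
  rw [shift, fold_const]

theorem shift_lam (t : RTerm) (k c : ℕ) : (lam t).shift k c = lam (t.shift k (c + 1)) := by
  rw [shift, fold_lam]; rfl

theorem shift_app (t : RTerm) (T : Multiset RTerm) (k c : ℕ) :
    (app t T).shift k c = app (t.shift k c) (T.map fun s => s.shift k c) := by
  rw [shift, fold_app]; simp only [Multiset.map_map]; rfl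

theorem shift_zero (t : RTerm) (c : ℕ) : t.shift 0 c = t := by
  induction t using induct generalizing c with
  | var n => simp [shift_var]
  | const => rw [shift_const]
  | lam t ih => rw [shift_lam, ih]
  | app t T iht ihT =>
    rw [shift_app, iht, Multiset.map_congr rfl fun s hs => ihT s hs c, Multiset.map_id']

theorem shift_shift_of_le (t : RTerm) (j k b c : ℕ) (h : b ≤ c) :
    (t.shift k c).shift j b = (t.shift j b).shift k (c + j) := by
  induction t using induct generalizing b c with
  | var n =>
    simp only [shift_var]
    split_ifs <;> simp only [shift_var] <;> split_ifs <;>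
      first | rfl | (exfalso; omega) | (congr 1; omega)
  | const => simp only [shift_const]
  | lam t ih =>
    simp only [shift_lam]
    rw [ih _ _ (Nat.succ_le_succ h)]
    congr 2; omega
  | app t T iht ihT =>
    simp only [shift_app, Multiset.map_map, Function.comp_def]
    rw [iht _ _ h, Multiset.map_congr rfl fun s hs => ihT s hs b c h]

theorem shift_shift_add (t : RTerm) (j k b c : ℕ) (h : c ≤ b) (h' : b ≤ c + k) :
    (t.shift k c).shift j b = t.shift (k + j) c := by
  induction t using induct generalizing b c with
  | var n =>
    simp only [shift_var]
    split_ifs <;> simp only [shift_var] <;> split_ifs <;>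
      first | rfl | (exfalso; omega) | (congr 1; omega)
  | const => simp only [shift_const]
  | lam t ih =>
    simp only [shift_lam]
    rw [ih _ _ (Nat.succ_le_succ h) (by omega)]
  | app t T iht ihT =>
    simp only [shift_app, Multiset.map_map, Function.comp_def]
    rw [iht _ _ h h', Multiset.map_congr rfl fun s hs => ihT s hs b c h h']

theorem size_shift (t : RTerm) (k c : ℕ) : (t.shift k c).size = t.size := by
  induction t using induct generalizing c with
  | var n => rw [shift_var]; split_ifs <;> simp [size_var]
  | const => rw [shift_const]
  | lam t ih => rw [shift_lam, size_lam, ih, size_lam]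
  | app t T iht ihT =>
    rw [shift_app, size_app, size_app, iht, Multiset.map_map]
    simp only [Function.comp_def]
    rw [Multiset.map_congr rfl fun s hs => ihT s hs c]

/-! # Derivatives -/

open Classical in
/-- The derivative of `t` at the variable of index `d` in the direction `u`: the sum of the terms
obtained by replacing one occurrence of this variable by `u`. -/
noncomputable def ins (d : ℕ) (u t : RTerm) : Comb :=
  match _ht : t.shape with
  | .var n => if n = d then pt u else 0
  | .const => 0
  | .lam t => lamL (ins (d + 1) (u.shift 1 0) t)
  | .app t T => appL (ins d u t) (bag T) +
      appL (pt t) (T.attach.map fun s => sing (ins d u s.1) * bag (T.erase s.1)).sum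
termination_by t.size
decreasing_by
  · rw [eq_of_shape_lam _ht, size_lam]; omega
  · rw [eq_of_shape_app _ht, size_app]; omega
  · have := size_le_of_mem s.2
    rw [eq_of_shape_app _ht, size_app]; omega

theorem ins_var (d : ℕ) (u : RTerm) (n : ℕ) : ins d u (var n) = if n = d then pt u else 0 := by
  rw [ins]
  split <;> rename_i h <;> rw [shape_var] at h <;> cases h
  rfl

theorem ins_const (d : ℕ) (u : RTerm) : ins d u const = 0 := by
  rw [ins]
  split <;> rename_i h <;> rw [shape_const] at h <;> cases h

theorem ins_lam (d : ℕ) (u t : RTerm) :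
    ins d u (lam t) = lamL (ins (d + 1) (u.shift 1 0) t) := by
  rw [ins]
  split <;> rename_i h <;> rw [shape_lam] at h <;> cases h
  rfl

theorem ins_app (d : ℕ) (u t : RTerm) (T : Multiset RTerm) :
    ins d u (app t T) = appL (ins d u t) (bag T) + appL (pt t) (bagDer (ins d u) (bag T)) := by
  classical
  rw [ins]
  split <;> rename_i h <;> rw [shape_app] at h <;> cases h
  rw [bagDer, bagLift_bag]
  congr 3
  exact Multiset.attach_map_val' T fun s => sing (ins d u s) * bag (T.erase s)

/-- The terms that do not contain the variable of index `d`, lowered accordingly; the other terms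
are mapped to `0`. -/
noncomputable def zap (d : ℕ) (t : RTerm) : Comb :=
  fold (α := ℕ → Comb)
    (fun n d => if n < d then pt (var n) else if n = d then 0 else pt (var (n - 1)))
    (fun _ => pt const) (fun t d => lamL (t (d + 1)))
    (fun t T d => appL (t d) (T.map fun s => sing (s d)).prod) t d

theorem zap_var (d n : ℕ) : zap d (var n) =
    if n < d then pt (var n) else if n = d then 0 else pt (var (n - 1)) := by
  rw [zap, fold_var]

theorem zap_const (d : ℕ) : zap d const = pt const := by rw [zap, fold_const]

theorem zap_lam (d : ℕ) (t : RTerm) : zap d (lam t) = lamL (zap (d + 1) t) := by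
  rw [zap, fold_lam]; rfl

theorem zap_app (d : ℕ) (t : RTerm) (T : Multiset RTerm) :
    zap d (app t T) = appL (zap d t) (bagHom (zap d) (bag T)) := by
  rw [zap, fold_app, bagHom_bag]; simp only [Multiset.map_map]; rfl

end RTerm

-- Linear and multiplicative extensions of derivatives, lowering and shifts.

open RTerm

/-- Bilinear extension of the derivative. -/
noncomputable def dif (d : ℕ) : Comb →+ Comb →+ Comb := combLift fun u => combLift (ins d u)

/-- The derivative on bags. -/
noncomputable def der (d : ℕ) : Comb →+ Bags →+ Bags := combLift fun u => bagDer (ins d u)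

/-- Linear extension of `RTerm.zap`. -/
noncomputable def zapL (d : ℕ) : Comb →+ Comb := combLift (zap d)

/-- Multiplicative extension of `RTerm.zap`. -/
noncomputable def zapB (d : ℕ) : Bags →+* Bags := bagHom (zap d)

/-- Linear extension of the shift. -/
noncomputable def shL (k c : ℕ) : Comb →+ Comb := combLift fun t => pt (t.shift k c)

/-- Multiplicative extension of the shift. -/
noncomputable def shB (k c : ℕ) : Bags →+* Bags := bagHom fun t => pt (t.shift k c)

theorem dif_pt_pt (d : ℕ) (u t : RTerm) : dif d (pt u) (pt t) = ins d u t := by simp [dif]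

@[simp] theorem zapL_pt (d : ℕ) (t : RTerm) : zapL d (pt t) = zap d t := combLift_pt _ _

@[simp] theorem shL_pt (k c : ℕ) (t : RTerm) : shL k c (pt t) = pt (t.shift k c) :=
  combLift_pt _ _

theorem shB_bag (k c : ℕ) (T : Multiset RTerm) :
    shB k c (bag T) = bag (T.map fun t => t.shift k c) := by
  rw [shB, bagHom_bag, bag_eq_prod, Multiset.map_map]; rfl

@[simp] theorem zapB_sing (d : ℕ) (v : Comb) : zapB d (sing v) = sing (zapL d v) := bagHom_sing _ _

@[simp] theorem shB_sing (k c : ℕ) (v : Comb) : shB k c (sing v) = sing (shL k c v) :=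
  bagHom_sing _ _

@[simp] theorem der_sing (d : ℕ) (x v : Comb) : der d x (sing v) = sing (dif d x v) := by
  induction x using comb_ind with
  | zero => simp
  | add x y hx hy => simp [hx, hy]
  | pt u => simp [der, dif]

@[simp] theorem der_one (d : ℕ) (x : Comb) : der d x 1 = 0 := by
  induction x using comb_ind with
  | zero => simp
  | add x y hx hy => simp [hx, hy]
  | pt u => simp [der, bagDer_one]

theorem der_mul (d : ℕ) (x : Comb) (a b : Bags) :
    der d x (a * b) = der d x a * b + a * der d x b := by
  induction x using comb_ind with
  | zero => simp
  | add x y hx hy => simp only [map_add, AddMonoidHom.add_apply, hx, hy]; ring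
  | pt u => simp [der, bagDer_mul]

theorem dif_lamL (d : ℕ) (x v : Comb) : dif d x (lamL v) = lamL (dif (d + 1) (shL 1 0 x) v) := by
  induction x using comb_ind with
  | zero => simp
  | add x y hx hy => simp [hx, hy]
  | pt u =>
    induction v using comb_ind with
    | zero => simp
    | add x y hx hy => simp [hx, hy]
    | pt t => simp [dif_pt_pt, ins_lam]

theorem dif_appL (d : ℕ) (x v : Comb) (b : Bags) :
    dif d x (appL v b) = appL (dif d x v) b + appL v (der d x b) := by
  induction x using comb_ind with
  | zero => simp
  | add x y hx hy => simp only [map_add, AddMonoidHom.add_apply, hx, hy]; abel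
  | pt u =>
    induction v using comb_ind with
    | zero => simp
    | add x y hx hy => simp only [map_add, AddMonoidHom.add_apply, hx, hy]; abel
    | pt t =>
      induction b using bag_ind with
      | zero => simp
      | add x y hx hy => simp only [map_add, hx, hy]; abel
      | bag T => simp [dif_pt_pt, ins_app, der]

@[simp] theorem dif_var (d : ℕ) (x : Comb) (n : ℕ) :
    dif d x (pt (.var n)) = if n = d then x else 0 := by
  induction x using comb_ind with
  | zero => simp
  | add x y hx hy => simp only [map_add, AddMonoidHom.add_apply, hx, hy]; split_ifs <;> simp
  | pt u => rw [dif_pt_pt, ins_var]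

@[simp] theorem dif_const (d : ℕ) (x : Comb) : dif d x (pt .const) = 0 := by
  induction x using comb_ind with
  | zero => simp
  | add x y hx hy => simp only [map_add, AddMonoidHom.add_apply, hx, hy]; simp
  | pt u => rw [dif_pt_pt, ins_const]

theorem zapL_lamL (d : ℕ) (v : Comb) : zapL d (lamL v) = lamL (zapL (d + 1) v) := by
  induction v using comb_ind with
  | zero => simp
  | add x y hx hy => simp [hx, hy]
  | pt t => simp [zap_lam]

theorem zapL_appL (d : ℕ) (v : Comb) (b : Bags) :
    zapL d (appL v b) = appL (zapL d v) (zapB d b) := by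
  induction v using comb_ind with
  | zero => simp
  | add x y hx hy => simp only [map_add, AddMonoidHom.add_apply, hx, hy]
  | pt t =>
    induction b using bag_ind with
    | zero => simp
    | add x y hx hy => simp only [map_add, hx, hy]
    | bag T => simp [zap_app, zapB]

theorem shL_lamL (k c : ℕ) (v : Comb) : shL k c (lamL v) = lamL (shL k (c + 1) v) := by
  induction v using comb_ind with
  | zero => simp
  | add x y hx hy => simp [hx, hy]
  | pt t => simp [shift_lam]

theorem shL_appL (k c : ℕ) (v : Comb) (b : Bags) :
    shL k c (appL v b) = appL (shL k c v) (shB k c b) := by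
  induction v using comb_ind with
  | zero => simp
  | add x y hx hy => simp only [map_add, AddMonoidHom.add_apply, hx, hy]
  | pt t =>
    induction b using bag_ind with
    | zero => simp
    | add x y hx hy => simp only [map_add, hx, hy]
    | bag T => simp [shift_app, shB_bag]

/-! # Commutations -/

/-- Induction on combinations, along the structure of terms. -/
theorem comb_struct_ind {p : Comb → Prop} (zero : p 0) (add : ∀ x y, p x → p y → p (x + y))
    (var : ∀ n, p (pt (.var n))) (const : p (pt .const))
    (lam : ∀ t, p (pt t) → p (lamL (pt t)))
    (app : ∀ t T, p (pt t) → (∀ s ∈ T, p (pt s)) → p (appL (pt t) (bag T))) (v : Comb) : p v := by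
  refine comb_ind v zero add fun t => ?_
  induction t using RTerm.induct with
  | var n => exact var n
  | const => exact const
  | lam t ih => rw [← lamL_pt]; exact lam t ih
  | app t T iht ihT => rw [← appL_pt_bag]; exact app t T iht ihT

theorem ringHom_bag_congr {f g : Bags →+* Bags} {T : Multiset RTerm}
    (h : ∀ s ∈ T, f (sing (pt s)) = g (sing (pt s))) : f (bag T) = g (bag T) := by
  rw [bag_eq_prod, map_multiset_prod, map_multiset_prod, Multiset.map_map, Multiset.map_map]
  exact congrArg _ (Multiset.map_congr rfl h)

theorem ringHom_bag_congr₂ {f g f' g' : Bags →+* Bags} {T : Multiset RTerm}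
    (h : ∀ s ∈ T, f (g (sing (pt s))) = f' (g' (sing (pt s)))) :
    f (g (bag T)) = f' (g' (bag T)) :=
  ringHom_bag_congr (f := f.comp g) (g := f'.comp g') h

theorem bag_subst_ind {p : Bags → Prop} {T : Multiset RTerm} (one : p 1)
    (mul : ∀ s ∈ T, ∀ b, p (sing (pt s)) → p b → p (sing (pt s) * b))
    (h : ∀ s ∈ T, p (sing (pt s))) : p (bag T) := by
  induction T using Multiset.induction with
  | empty => exact one
  | cons t T ih =>
    rw [bag_cons]
    refine mul t (Multiset.mem_cons_self t T) _ (h t (Multiset.mem_cons_self t T)) (ih ?_ ?_)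
    · exact fun s hs => mul s (Multiset.mem_cons_of_mem hs)
    · exact fun s hs => h s (Multiset.mem_cons_of_mem hs)

/-- Over the ring homomorphism `H`, both sides satisfy the same twisted Leibniz rule, so they are
determined by their values on the elements of the bag. The commutations below pass from arguments to
applications in this way. -/
theorem hom_der_bag {H : Bags →+* Bags} {d d' : ℕ} {x x' : Comb} {T : Multiset RTerm}
    (h : ∀ s ∈ T, H (der d x (sing (pt s))) = der d' x' (H (sing (pt s)))) :
    H (der d x (bag T)) = der d' x' (H (bag T)) := by
  refine bag_subst_ind (p := fun b => H (der d x b) = der d' x' (H b)) (by simp) ?_ h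
  intro s _ b h1 h2
  rw [der_mul, map_add, map_mul, map_mul, map_mul, h1, h2, der_mul]

theorem shL_shL_of_le (j k b c : ℕ) (h : b ≤ c) (v : Comb) :
    shL j b (shL k c v) = shL k (c + j) (shL j b v) := by
  induction v using comb_ind with
  | zero => simp
  | add x y hx hy => simp [hx, hy]
  | pt t => simp [shift_shift_of_le _ _ _ _ _ h]

theorem shL_shL_add (j k b c : ℕ) (h : c ≤ b) (h' : b ≤ c + k) (v : Comb) :
    shL j b (shL k c v) = shL (k + j) c v := by
  induction v using comb_ind with
  | zero => simp
  | add x y hx hy => simp [hx, hy]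
  | pt t => simp [shift_shift_add _ _ _ _ _ h h']

theorem shL_zero (c : ℕ) (v : Comb) : shL 0 c v = v := by
  induction v using comb_ind with
  | zero => simp
  | add x y hx hy => simp [hx, hy]
  | pt t => simp [shift_zero]

/-- Shift below the variable of the derivative. -/
theorem shL_dif_of_le (k c d : ℕ) (h : c ≤ d) (x v : Comb) :
    shL k c (dif d x v) = dif (d + k) (shL k c x) (shL k c v) := by
  induction v using comb_struct_ind generalizing c d x with
  | zero => simp
  | add x y hx hy => simp [hx _ _ h, hy _ _ h]
  | var n =>
    simp only [dif_var, shL_pt, shift_var]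
    split_ifs <;> simp only [dif_var, map_zero] <;> (try split_ifs) <;>
      first | rfl | (exfalso; omega)
  | const => simp [shift_const]
  | lam t ih =>
    rw [dif_lamL, shL_lamL, shL_lamL, dif_lamL, ih _ _ (Nat.succ_le_succ h),
      shL_shL_of_le 1 k 0 c (Nat.zero_le c)]
    congr 4; omega
  | app t T iht ihT =>
    rw [dif_appL, map_add, shL_appL, shL_appL, shL_appL, dif_appL, iht _ _ h,
      hom_der_bag (d' := d + k) (x' := shL k c x)]
    intro s hs
    simp only [der_sing, shB_sing, ihT s hs _ _ h]

/-- Shift above the variable of the derivative. -/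
theorem shL_dif_of_lt (k c d : ℕ) (h : d < c) (x v : Comb) :
    shL k c (dif d x v) = dif d (shL k c x) (shL k c v) := by
  induction v using comb_struct_ind generalizing c d x with
  | zero => simp
  | add x y hx hy => simp [hx _ _ h, hy _ _ h]
  | var n =>
    simp only [dif_var, shL_pt, shift_var]
    split_ifs <;> simp only [dif_var, map_zero] <;> (try split_ifs) <;>
      first | rfl | (exfalso; omega)
  | const => simp [shift_const]
  | lam t ih =>
    rw [dif_lamL, shL_lamL, shL_lamL, dif_lamL, ih _ _ (Nat.succ_lt_succ h),
      shL_shL_of_le 1 k 0 c (Nat.zero_le c)]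
  | app t T iht ihT =>
    rw [dif_appL, map_add, shL_appL, shL_appL, shL_appL, dif_appL, iht _ _ h,
      hom_der_bag (d' := d) (x' := shL k c x)]
    intro s hs
    simp only [der_sing, shB_sing, ihT s hs _ _ h]

/-- Derivative at a variable that does not occur. -/
theorem dif_shL (k c d : ℕ) (h : c ≤ d) (h' : d < c + k) (x v : Comb) :
    dif d x (shL k c v) = 0 := by
  induction v using comb_struct_ind generalizing c d x with
  | zero => simp
  | add x y hx hy => simp [hx _ _ h h', hy _ _ h h']
  | var n =>
    simp only [shL_pt, shift_var]
    split_ifs <;> simp only [dif_var] <;> split_ifs <;> first | rfl | (exfalso; omega)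
  | const => simp [shift_const]
  | lam t ih => rw [shL_lamL, dif_lamL, ih _ _ (by omega) (by omega), map_zero]
  | app t T iht ihT =>
    rw [shL_appL, dif_appL, iht _ _ h h']
    have : der d x (shB k c (bag T)) = 0 := by
      refine bag_subst_ind (p := fun b => der d x (shB k c b) = 0) (by simp) ?_ ?_
      · intro s _ b h1 h2
        rw [map_mul, der_mul, h1, h2, zero_mul, mul_zero, add_zero]
      · intro s hs
        simp only [shB_sing, der_sing, ihT s hs _ _ h h', map_zero]
    simp [this]

theorem zapL_shL (k c d : ℕ) (h : c ≤ d) (h' : d ≤ c + k) (v : Comb) :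
    zapL d (shL (k + 1) c v) = shL k c v := by
  induction v using comb_struct_ind generalizing c d with
  | zero => simp
  | add x y hx hy => simp [hx _ _ h h', hy _ _ h h']
  | var n =>
    simp only [shL_pt, shift_var]
    split_ifs <;> simp only [zapL_pt, zap_var] <;> split_ifs <;>
      first | rfl | (exfalso; omega)
  | const => simp [shift_const, zap_const]
  | lam t ih => rw [shL_lamL, zapL_lamL, ih _ _ (by omega) (by omega), shL_lamL]
  | app t T iht ihT =>
    rw [shL_appL, zapL_appL, shL_appL, iht _ _ h h']
    refine congrArg _ ?_
    exact ringHom_bag_congr₂ (g' := RingHom.id _) fun s hs => by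
      simp only [zapB_sing, shB_sing, RingHom.id_apply, ihT s hs _ _ h h']

/-- Lowering and shifting above. -/
theorem zapL_shL_of_le (k c d : ℕ) (h : d ≤ c) (v : Comb) :
    zapL d (shL k (c + 1) v) = shL k c (zapL d v) := by
  induction v using comb_struct_ind generalizing c d with
  | zero => simp
  | add x y hx hy => simp [hx _ _ h, hy _ _ h]
  | var n =>
    simp only [shL_pt, shift_var, zapL_pt, zap_var]
    split_ifs <;> simp only [zap_var, shL_pt, shift_var, map_zero] <;> (try split_ifs) <;>
      first | rfl | (exfalso; omega) | (congr 2; omega)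
  | const => simp [shift_const, zap_const]
  | lam t ih => rw [shL_lamL, zapL_lamL, ih _ _ (by omega), zapL_lamL, shL_lamL]
  | app t T iht ihT =>
    rw [shL_appL, zapL_appL, zapL_appL, shL_appL, iht _ _ h]
    refine congrArg _ ?_
    exact ringHom_bag_congr₂ fun s hs => by simp only [zapB_sing, shB_sing, ihT s hs _ _ h]

/-- Lowering and shifting below. -/
theorem zapL_shL_of_ge (k c d : ℕ) (h : c ≤ d) (v : Comb) :
    zapL (d + k) (shL k c v) = shL k c (zapL d v) := by
  induction v using comb_struct_ind generalizing c d with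
  | zero => simp
  | add x y hx hy => simp [hx _ _ h, hy _ _ h]
  | var n =>
    simp only [shL_pt, shift_var, zapL_pt, zap_var]
    split_ifs <;> simp only [zap_var, shL_pt, shift_var, map_zero] <;> (try split_ifs) <;>
      first | rfl | (exfalso; omega) | (congr 2; omega)
  | const => simp [shift_const, zap_const]
  | lam t ih =>
    rw [shL_lamL, zapL_lamL, zapL_lamL, shL_lamL, ← ih _ _ (Nat.succ_le_succ h)]
    congr 3; omega
  | app t T iht ihT =>
    rw [shL_appL, zapL_appL, zapL_appL, shL_appL, iht _ _ h]
    refine congrArg _ ?_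
    exact ringHom_bag_congr₂ fun s hs => by simp only [zapB_sing, shB_sing, ihT s hs _ _ h]

/-- Lowering commutes with a derivative at a larger index. -/
theorem zapL_dif (c d : ℕ) (h : c ≤ d) (x v : Comb) :
    zapL c (dif (d + 1) x v) = dif d (zapL c x) (zapL c v) := by
  induction v using comb_struct_ind generalizing c d x with
  | zero => simp
  | add x y hx hy => simp [hx _ _ h, hy _ _ h]
  | var n =>
    simp only [dif_var, zapL_pt, zap_var]
    split_ifs <;> simp only [dif_var, map_zero] <;> (try split_ifs) <;>
      first | rfl | (exfalso; omega)
  | const => simp [zap_const]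
  | lam t ih =>
    rw [dif_lamL, zapL_lamL, zapL_lamL, dif_lamL, ih _ _ (Nat.succ_le_succ h),
      zapL_shL_of_ge 1 0 c (Nat.zero_le c)]
  | app t T iht ihT =>
    rw [dif_appL, map_add, zapL_appL, zapL_appL, zapL_appL, dif_appL, iht _ _ h,
      hom_der_bag (d' := d) (x' := zapL c x)]
    intro s hs
    simp only [der_sing, zapB_sing, ihT s hs _ _ h]

/-- Lowering commutes with a derivative at a smaller index. -/
theorem zapL_dif_of_lt (c d : ℕ) (h : d < c) (x v : Comb) :
    zapL c (dif d x v) = dif d (zapL c x) (zapL c v) := by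
  induction v using comb_struct_ind generalizing c d x with
  | zero => simp
  | add x y hx hy => simp [hx _ _ h, hy _ _ h]
  | var n =>
    simp only [dif_var, zapL_pt, zap_var]
    split_ifs <;> simp only [dif_var, map_zero] <;> (try split_ifs) <;>
      first | rfl | (exfalso; omega)
  | const => simp [zap_const]
  | lam t ih =>
    rw [dif_lamL, zapL_lamL, zapL_lamL, dif_lamL, ih _ _ (Nat.succ_lt_succ h),
      zapL_shL_of_ge 1 0 c (Nat.zero_le c)]
  | app t T iht ihT =>
    rw [dif_appL, map_add, zapL_appL, zapL_appL, zapL_appL, dif_appL, iht _ _ h,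
      hom_der_bag (d' := d) (x' := zapL c x)]
    intro s hs
    simp only [der_sing, zapB_sing, ihT s hs _ _ h]

theorem zapL_zapL (c d : ℕ) (h : c ≤ d) (v : Comb) :
    zapL d (zapL c v) = zapL c (zapL (d + 1) v) := by
  induction v using comb_struct_ind generalizing c d with
  | zero => simp
  | add x y hx hy => simp [hx _ _ h, hy _ _ h]
  | var n =>
    simp only [zapL_pt, zap_var]
    split_ifs <;> simp only [zapL_pt, zap_var, map_zero] <;> (try split_ifs) <;>
      first | rfl | (exfalso; omega)
  | const => simp [zap_const]
  | lam t ih => simp only [zapL_lamL]; rw [ih _ _ (Nat.succ_le_succ h)]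
  | app t T iht ihT =>
    simp only [zapL_appL]
    rw [iht _ _ h]
    refine congrArg _ ?_
    exact ringHom_bag_congr₂ fun s hs => by simp only [zapB_sing, ihT s hs _ _ h]

/-- The commutator of two derivatives. -/
theorem dif_dif (c d : ℕ) (x y v : Comb) :
    dif c x (dif d y v) + dif c (dif d y x) v = dif d y (dif c x v) + dif d (dif c x y) v := by
  induction v using comb_struct_ind generalizing c d x y with
  | zero => simp
  | add v w hv hw =>
    simp only [map_add]
    rw [add_add_add_comm, hv, hw, add_add_add_comm]
  | var n =>
    simp only [dif_var]
    split_ifs <;> simp [add_comm]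
  | const => simp
  | lam t ih =>
    simp only [dif_lamL, ← map_add]
    rw [shL_dif_of_le 1 0 d (Nat.zero_le d), shL_dif_of_le 1 0 c (Nat.zero_le c), ih]
  | app t T iht ihT =>
    have h : der c x (der d y (bag T)) + der c (dif d y x) (bag T) =
        der d y (der c x (bag T)) + der d (dif c x y) (bag T) := by
      refine bag_subst_ind (p := fun b => der c x (der d y b) + der c (dif d y x) b =
        der d y (der c x b) + der d (dif c x y) b) (by simp) ?_ ?_
      · intro s _ b h1 h2
        simp only [der_mul, map_add]
        linear_combination b * h1 + sing (pt s) * h2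
      · intro s hs
        simp only [der_sing, ← map_add, ihT s hs c d x y]
    have h1 := congrArg (fun v => appL v (bag T)) (iht c d x y)
    have h2 := congrArg (appL (pt t)) h
    simp only [map_add, AddMonoidHom.add_apply] at h1 h2
    simp only [dif_appL, map_add]
    -- The mixed terms, with one derivative in the function and the other in the bag, occur on both
    -- sides in opposite orders.
    have h3 := congrArg₂ (· + ·) (congrArg₂ (· + ·) h1 h2)
      (add_comm (appL (dif c x (pt t)) (der d y (bag T))) (appL (dif d y (pt t)) (der c x (bag T))))
    refine Eq.trans ?_ (h3.trans ?_) <;> abel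

theorem der_der (c d : ℕ) (x y : Comb) (b : Bags) :
    der c x (der d y b) + der c (dif d y x) b = der d y (der c x b) + der d (dif c x y) b := by
  induction b using bag_ind with
  | zero => simp
  | add v w hv hw =>
    simp only [map_add]
    rw [add_add_add_comm, hv, hw, add_add_add_comm]
  | bag T =>
    refine bag_subst_ind (p := fun b => der c x (der d y b) + der c (dif d y x) b =
      der d y (der c x b) + der d (dif c x y) b) (by simp) ?_ ?_
    · intro s _ b h1 h2
      simp only [der_mul, map_add]
      linear_combination b * h1 + sing (pt s) * h2
    · intro s _
      simp only [der_sing, ← map_add, dif_dif c d x y]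

/-- In `dif_dif`, the correction terms record that the term inserted by one derivative may contain
the variable of the other. They vanish when neither direction contains the variable. -/
theorem dif_comm_of_eq_zero {d : ℕ} {x y : Comb} (hx : dif d y x = 0) (hy : dif d x y = 0)
    (v : Comb) : dif d x (dif d y v) = dif d y (dif d x v) := by
  simpa [hx, hy] using dif_dif d d x y v

theorem der_comm_of_eq_zero {d : ℕ} {x y : Comb} (hx : dif d y x = 0) (hy : dif d x y = 0)
    (b : Bags) : der d x (der d y b) = der d y (der d x b) := by
  simpa [hx, hy] using der_der d d x y b

/-- A shift by `d + 1` passes the `d` binders and the variable `d` itself, which is therefore absent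
from the result. Derivatives along such directions commute, so they can be iterated along an
unordered bag. -/
theorem dif_shL_succ (d : ℕ) (x y : Comb) : dif d x (shL (d + 1) 0 y) = 0 :=
  dif_shL _ _ _ (Nat.zero_le d) (by omega) x y

/-! # Iterated derivatives along bags -/

/-- The composite of the additive maps `f t`, for the elements `t` of a bag. -/
noncomputable def bagIter {X : Type} [AddCommMonoid X] (f : Comb →+ X →+ X)
    (h : ∀ x y v, f x (f y v) = f y (f x v)) : Bags →+ X →+ X :=
  haveI : LeftCommutative fun (t : RTerm) (F : X →+ X) => (f (pt t)).comp F :=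
    ⟨fun _ _ _ => AddMonoidHom.ext fun _ => h _ _ _⟩
  bagLift fun T => T.foldr (fun t F => (f (pt t)).comp F) (AddMonoidHom.id X)

section bagIter
variable {X : Type} [AddCommMonoid X] (f : Comb →+ X →+ X) (h : ∀ x y v, f x (f y v) = f y (f x v))

theorem bagIter_one (v : X) : bagIter f h 1 v = v := by
  rw [← bag_zero, bagIter, bagLift_bag, Multiset.foldr_zero]; rfl

theorem bagIter_sing_mul (y : Comb) (b : Bags) (v : X) :
    bagIter f h (sing y * b) v = f y (bagIter f h b v) := by
  induction y using comb_ind with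
  | zero => simp
  | add x y hx hy => simp [add_mul, hx, hy]
  | pt t =>
    induction b using bag_ind with
    | zero => simp
    | add x y hx hy => simp only [mul_add, map_add, AddMonoidHom.add_apply, hx, hy]
    | bag T =>
      rw [← bag_cons, bagIter, bagLift_bag, bagLift_bag, Multiset.foldr_cons]; rfl

theorem bagIter_mul (a b : Bags) (v : X) :
    bagIter f h (a * b) v = bagIter f h a (bagIter f h b v) := by
  induction a using bag_ind with
  | zero => simp
  | add x y hx hy => simp only [add_mul, map_add, AddMonoidHom.add_apply, hx, hy]
  | bag T =>
    induction T using Multiset.induction with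
    | empty => rw [bag_zero, one_mul, bagIter_one]
    | cons t T ih => rw [bag_cons, mul_assoc, bagIter_sing_mul, bagIter_sing_mul, ih]

end bagIter

/-- The iterated derivative of terms along a bag, whose elements do not live under the `d` binders
considered. -/
noncomputable def mdif (d : ℕ) : Bags →+ Comb →+ Comb :=
  bagIter ((dif d).comp (shL (d + 1) 0)) fun _ _ v =>
    dif_comm_of_eq_zero (dif_shL_succ d _ _) (dif_shL_succ d _ _) v

/-- The iterated derivative of bags along a bag. -/
noncomputable def mder (d : ℕ) : Bags →+ Bags →+ Bags :=
  bagIter ((der d).comp (shL (d + 1) 0)) fun _ _ v =>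
    der_comm_of_eq_zero (dif_shL_succ d _ _) (dif_shL_succ d _ _) v

theorem mdif_one (d : ℕ) (v : Comb) : mdif d 1 v = v := bagIter_one _ _ v
theorem mder_one (d : ℕ) (v : Bags) : mder d 1 v = v := bagIter_one _ _ v

theorem mdif_sing_mul (d : ℕ) (y : Comb) (b : Bags) (v : Comb) :
    mdif d (sing y * b) v = dif d (shL (d + 1) 0 y) (mdif d b v) := bagIter_sing_mul _ _ y b v
theorem mder_sing_mul (d : ℕ) (y : Comb) (b v : Bags) :
    mder d (sing y * b) v = der d (shL (d + 1) 0 y) (mder d b v) := bagIter_sing_mul _ _ y b v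

theorem mdif_mul (d : ℕ) (a b : Bags) (v : Comb) : mdif d (a * b) v = mdif d a (mdif d b v) :=
  bagIter_mul _ _ a b v

/-- Linear substitution of a bag for the variable of index `d`. -/
noncomputable def lsub (d : ℕ) : Bags →+ Comb →+ Comb := (mdif d).compr₂ (zapL d)

/-- Linear substitution in bags. -/
noncomputable def lsubB (d : ℕ) : Bags →+ Bags →+ Bags := (mder d).compr₂ (zapB d).toAddMonoidHom

theorem lsub_apply (d : ℕ) (b : Bags) (v : Comb) : lsub d b v = zapL d (mdif d b v) := rfl
theorem lsubB_apply (d : ℕ) (b v : Bags) : lsubB d b v = zapB d (mder d b v) := rfl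

/-! # The coproduct of bags -/

section cop
variable {X : Type} [AddCommMonoid X]

/-- The value of a bilinear map on the coproduct of a combination of bags. -/
noncomputable def cop (G : Bags →+ Bags →+ X) : Bags →+ X :=
  bagLift fun T => (T.antidiagonal.map fun p => G (bag p.1) (bag p.2)).sum

theorem cop_bag (G : Bags →+ Bags →+ X) (T : Multiset RTerm) :
    cop G (bag T) = (T.antidiagonal.map fun p => G (bag p.1) (bag p.2)).sum := by
  rw [cop, bagLift_bag]

theorem cop_one (G : Bags →+ Bags →+ X) : cop G 1 = G 1 1 := by
  rw [← bag_zero, cop, bagLift_bag]; simp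

theorem cop_add (G H : Bags →+ Bags →+ X) (b : Bags) : cop (G + H) b = cop G b + cop H b := by
  induction b using bag_ind with
  | zero => simp
  | add x y hx hy => simp only [map_add, hx, hy]; abel
  | bag T => simp [cop, Multiset.sum_map_add]

theorem cop_comp {Y : Type} [AddCommMonoid Y] (f : X →+ Y) (G : Bags →+ Bags →+ X) (b : Bags) :
    cop (G.compr₂ f) b = f (cop G b) := by
  induction b using bag_ind with
  | zero => simp
  | add x y hx hy => simp only [map_add, hx, hy]
  | bag T => simp [cop, map_multiset_sum]

/-- A one-element bag is primitive: in a splitting, the new element goes to the left or to the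
right. -/
theorem cop_sing_mul (G : Bags →+ Bags →+ X) (y : Comb) (b : Bags) :
    cop G (sing y * b) = cop (G.comp (AddMonoidHom.mulLeft (sing y))) b +
      cop (G.compl₂ (AddMonoidHom.mulLeft (sing y))) b := by
  induction b using bag_ind with
  | zero => simp
  | add x y hx hy => simp only [map_add, mul_add, hx, hy]; abel
  | bag T =>
    induction y using comb_ind with
    | zero =>
      simp [cop]
    | add x y hx hy =>
      rw [map_add, add_mul, map_add, hx, hy]
      simp only [cop, bagLift_bag, AddMonoidHom.comp_apply, AddMonoidHom.compl₂_apply,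
        AddMonoidHom.coe_mulLeft, add_mul, map_add, AddMonoidHom.add_apply, Multiset.sum_map_add]
      abel
    | pt t =>
      rw [← bag_cons, cop_bag, cop_bag, cop_bag, Multiset.antidiagonal_cons, Multiset.map_add,
        Multiset.sum_add, Multiset.map_map, Multiset.map_map, add_comm]
      simp only [Function.comp_def, Prod.map, id, AddMonoidHom.comp_apply,
        AddMonoidHom.compl₂_apply, AddMonoidHom.coe_mulLeft, bag_cons]

/-- The Leibniz rule for iterated derivatives. -/
theorem bagIter_leibniz {Y Z : Type} [AddCommMonoid Y] [AddCommMonoid Z]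
    {f : Comb →+ X →+ X} {hf : ∀ x y v, f x (f y v) = f y (f x v)}
    {g : Comb →+ Y →+ Y} {hg : ∀ x y v, g x (g y v) = g y (g x v)}
    {k : Comb →+ Z →+ Z} {hk : ∀ x y v, k x (k y v) = k y (k x v)}
    (m : X →+ Y →+ Z) (h : ∀ x v w, k x (m v w) = m (f x v) w + m v (g x w))
    (b : Bags) (v : X) (w : Y) :
    bagIter k hk b (m v w) =
      cop ((m.comp ((bagIter f hf).flip v)).compl₂ ((bagIter g hg).flip w)) b := by
  induction b using bag_ind with
  | zero => simp
  | add x y hx hy => simp only [map_add, AddMonoidHom.add_apply, hx, hy]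
  | bag T =>
    induction T using Multiset.induction with
    | empty => simp [bag_zero, cop_one, bagIter_one]
    | cons t T ih =>
      rw [bag_cons, bagIter_sing_mul, ih, ← cop_comp, cop_sing_mul, ← cop_add]
      congr 1
      congr 1
      refine AddMonoidHom.ext fun a => AddMonoidHom.ext fun b => ?_
      simp only [AddMonoidHom.compr₂_apply, AddMonoidHom.compl₂_apply, AddMonoidHom.comp_apply,
        AddMonoidHom.flip_apply, AddMonoidHom.add_apply, AddMonoidHom.coe_mulLeft,
        bagIter_sing_mul, h]

end cop

theorem mdif_appL (d : ℕ) (b : Bags) (v : Comb) (w : Bags) :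
    mdif d b (appL v w) = cop ((appL.comp ((mdif d).flip v)).compl₂ ((mder d).flip w)) b :=
  bagIter_leibniz appL (fun x v w => dif_appL d (shL (d + 1) 0 x) v w) b v w

theorem mder_mul (d : ℕ) (b v w : Bags) :
    mder d b (v * w) =
      cop ((AddMonoidHom.mul.comp ((mder d).flip v)).compl₂ ((mder d).flip w)) b :=
  bagIter_leibniz AddMonoidHom.mul (fun x v w => der_mul d (shL (d + 1) 0 x) v w) b v w

/-- The Leibniz rule sends each substituted element to the function or to the arguments, and
lowering respects products, so it applies to the two parts separately. -/
theorem lsub_appL (d : ℕ) (b : Bags) (v : Comb) (w : Bags) :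
    lsub d b (appL v w) = cop ((appL.comp ((lsub d).flip v)).compl₂ ((lsubB d).flip w)) b := by
  rw [lsub_apply, mdif_appL, ← cop_comp]
  refine DFunLike.congr_fun (congrArg cop ?_) b
  exact AddMonoidHom.ext fun a => AddMonoidHom.ext fun b => zapL_appL d _ _

theorem lsubB_mul (d : ℕ) (b v w : Bags) :
    lsubB d b (v * w) =
      cop ((AddMonoidHom.mul.comp ((lsubB d).flip v)).compl₂ ((lsubB d).flip w)) b := by
  rw [lsubB_apply, mder_mul]
  refine (cop_comp (zapB d).toAddMonoidHom _ b).symm.trans (DFunLike.congr_fun (congrArg cop ?_) b)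
  exact AddMonoidHom.ext fun a => AddMonoidHom.ext fun b => map_mul (zapB d) _ _

/-- Crossing the binder shifts each direction once more, which gives precisely the shift by `d + 2`
built in `mdif (d + 1)`. -/
theorem mdif_lamL (d : ℕ) (b : Bags) (v : Comb) : mdif d b (lamL v) = lamL (mdif (d + 1) b v) := by
  induction b using bag_ind with
  | zero => simp
  | add x y hx hy => simp only [map_add, AddMonoidHom.add_apply, hx, hy]
  | bag T =>
    induction T using Multiset.induction with
    | empty => rw [bag_zero, mdif_one, mdif_one]
    | cons t T ih =>
      rw [bag_cons, mdif_sing_mul, mdif_sing_mul, ih, dif_lamL,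
        shL_shL_add _ _ _ _ (le_refl 0) (Nat.zero_le _)]

theorem lsub_lamL (d : ℕ) (b : Bags) (v : Comb) : lsub d b (lamL v) = lamL (lsub (d + 1) b v) := by
  rw [lsub_apply, mdif_lamL, zapL_lamL, lsub_apply]

-- Counit and linear part of bags, and substitution in variables and constants.

open Classical in
/-- The coefficient of the empty bag. -/
noncomputable def bagCounit : Bags →+ ℕ := bagLift fun T => if T = 0 then 1 else 0

open Classical in
/-- The projection on combinations of one-element bags. -/
noncomputable def bagLin : Bags →+ Comb :=
  bagLift fun T => if h : ∃ t, T = {t} then pt h.choose else 0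

theorem bagCounit_bag (T : Multiset RTerm) [Decidable (T = 0)] :
    bagCounit (bag T) = if T = 0 then 1 else 0 := by
  rw [bagCounit, bagLift_bag]; congr

theorem bagCounit_sing_mul (v : Comb) (b : Bags) : bagCounit (sing v * b) = 0 := by
  classical
  induction v using comb_ind with
  | zero => simp
  | add x y hx hy => simp [add_mul, hx, hy]
  | pt t =>
    induction b using bag_ind with
    | zero => simp
    | add x y hx hy => rw [mul_add, map_add, hx, hy]
    | bag T => rw [← bag_cons, bagCounit_bag]; simp

theorem bagCounit_one : bagCounit 1 = 1 := by
  classical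
  rw [← bag_zero, bagCounit_bag]; simp

theorem bagLin_bag_singleton (t : RTerm) : bagLin (bag {t}) = pt t := by
  have h : ∃ s, ({t} : Multiset RTerm) = {s} := ⟨t, rfl⟩
  rw [bagLin, bagLift_bag, dif_pos h]
  congr 1
  exact (Multiset.singleton_inj.1 h.choose_spec).symm

theorem bagLin_bag_of_card_ne {T : Multiset RTerm} (h : T.card ≠ 1) : bagLin (bag T) = 0 := by
  rw [bagLin, bagLift_bag, dif_neg]
  rintro ⟨t, rfl⟩
  simp at h

theorem bagLin_sing (v : Comb) : bagLin (sing v) = v := by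
  induction v using comb_ind with
  | zero => simp
  | add x y hx hy => simp [hx, hy]
  | pt t => rw [sing_pt, bagLin_bag_singleton]

theorem bagIter_of_eq_zero {X : Type} [AddCommMonoid X] (f : Comb →+ X →+ X)
    (h : ∀ x y v, f x (f y v) = f y (f x v)) {v : X} (hv : ∀ x, f x v = 0) (b : Bags) :
    bagIter f h b v = bagCounit b • v := by
  induction b using bag_ind with
  | zero => simp
  | add x y hx hy => rw [map_add, AddMonoidHom.add_apply, hx, hy, map_add, add_smul]
  | bag T =>
    induction T using Multiset.induction with
    | empty => rw [bag_zero, bagIter_one, bagCounit_one, one_smul]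
    | cons t T ih =>
      -- The factors are exchanged so that `t` acts first, directly on `v`, and gives `0`.
      rw [bag_cons, bagCounit_sing_mul, mul_comm, bagIter_mul, ← mul_one (sing _),
        bagIter_sing_mul, bagIter_one, hv, map_zero, zero_smul]

theorem mdif_of_dif_eq_zero {d : ℕ} {v : Comb} (h : ∀ x, dif d x v = 0) (b : Bags) :
    mdif d b v = bagCounit b • v :=
  bagIter_of_eq_zero _ _ (fun x => h (shL (d + 1) 0 x)) b

theorem lsubB_one (d : ℕ) (b : Bags) : lsubB d b 1 = bagCounit b • 1 := by
  rw [lsubB_apply, mder, bagIter_of_eq_zero _ _ fun x => der_one d (shL (d + 1) 0 x), map_nsmul,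
    map_one]

theorem mder_sing (d : ℕ) (b : Bags) (v : Comb) : mder d b (sing v) = sing (mdif d b v) := by
  induction b using bag_ind with
  | zero => simp
  | add x y hx hy => simp only [map_add, AddMonoidHom.add_apply, hx, hy]
  | bag T =>
    induction T using Multiset.induction with
    | empty => rw [bag_zero, mdif_one, mder_one]
    | cons t T ih => rw [bag_cons, mdif_sing_mul, mder_sing_mul, ih, der_sing]

theorem lsubB_sing (d : ℕ) (b : Bags) (v : Comb) : lsubB d b (sing v) = sing (lsub d b v) := by
  rw [lsubB_apply, mder_sing, zapB_sing, lsub_apply]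

theorem lsub_const (d : ℕ) (b : Bags) : lsub d b (pt .const) = bagCounit b • pt .const := by
  rw [lsub_apply, mdif_of_dif_eq_zero (by simp), map_nsmul, zapL_pt, zap_const]

theorem lsub_var_of_ne {d n : ℕ} (h : n ≠ d) (b : Bags) :
    lsub d b (pt (.var n)) = bagCounit b • pt (.var (if n < d then n else n - 1)) := by
  rw [lsub_apply, mdif_of_dif_eq_zero (by simp [h]), map_nsmul, zapL_pt, zap_var, if_neg h]
  split_ifs <;> rfl

theorem lsub_shL (d : ℕ) (b : Bags) (v : Comb) :
    lsub d b (shL (d + 1) 0 v) = bagCounit b • shL d 0 v := by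
  rw [lsub_apply, mdif_of_dif_eq_zero (fun x => dif_shL_succ d x v), map_nsmul,
    zapL_shL _ _ _ (Nat.zero_le d) (by omega)]

/-- One element of the bag takes the only occurrence. The inserted term does not contain the
variable, so nothing may be left in the bag; and an empty bag leaves the variable in place, which
lowering sends to `0`. -/
theorem lsub_var_self (d : ℕ) (b : Bags) : lsub d b (pt (.var d)) = shL d 0 (bagLin b) := by
  induction b using bag_ind with
  | zero => simp
  | add x y hx hy => rw [map_add, AddMonoidHom.add_apply, hx, hy, map_add, map_add]
  | bag T =>
    induction T using Multiset.induction with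
    | empty =>
      rw [bagLin_bag_of_card_ne (by simp), bag_zero, lsub_apply, mdif_one, zapL_pt, zap_var]
      simp
    | cons t T ih =>
      rw [bag_cons, mul_comm, lsub_apply, mdif_mul, ← mul_one (sing _), mdif_sing_mul,
        mdif_one, dif_var, if_pos rfl, ← lsub_apply, lsub_shL]
      classical
      rw [bagCounit_bag]
      split_ifs with h
      · rw [h, bag_zero, one_mul, mul_one, bagLin_sing, one_smul]
      · rw [mul_one, mul_comm, ← bag_cons, bagLin_bag_of_card_ne, map_zero, zero_smul]
        rw [Multiset.card_cons]
        simpa using h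

/-! # Sums over the orderings of a list -/

section orderings
variable {α X : Type} [AddCommMonoid X]

/-- The sum of `g p q` over the decompositions `p ++ q` of a list. -/
def decSum : List α → (List α → List α → X) → X
  | [], g => g [] []
  | a :: l, g => g [] (a :: l) + decSum l fun p q => g (a :: p) q

/-- The sum of `g p q` over the ways to split a list in two complementary sublists. -/
def splitSum : List α → (List α → List α → X) → X
  | [], g => g [] []
  | a :: l, g => splitSum l (fun p q => g (a :: p) q) + splitSum l fun p q => g p (a :: q)

/-- The sum of `g` over the insertions of `a` in a list. -/
def insSum (a : α) (l : List α) (g : List α → X) : X := ((l.permutations'Aux a).map g).sum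

/-- The sum of `g` over the orderings of a list. -/
def permSum (l : List α) (g : List α → X) : X := (l.permutations'.map g).sum

theorem decSum_add (l : List α) (g h : List α → List α → X) :
    decSum l (fun p q => g p q + h p q) = decSum l g + decSum l h := by
  induction l generalizing g h with
  | nil => rfl
  | cons a l ih => simp only [decSum, ih]; abel

theorem insSum_cons (a b : α) (l : List α) (g : List α → X) :
    insSum a (b :: l) g = g (a :: b :: l) + insSum a l fun l => g (b :: l) := by
  simp [insSum, List.permutations'Aux, Function.comp_def]

theorem insSum_add (a : α) (l : List α) (g h : List α → X) :
    insSum a l (fun l => g l + h l) = insSum a l g + insSum a l h := List.sum_map_add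

theorem permSum_nil (g : List α → X) : permSum [] g = g [] := by simp [permSum]

theorem permSum_cons (a : α) (l : List α) (g : List α → X) :
    permSum (a :: l) g = permSum l fun l => insSum a l g := by
  simp only [permSum, insSum, List.permutations']
  induction l.permutations' with
  | nil => simp
  | cons b l ih => simp [ih]

theorem permSum_insSum_comm (a : α) (l m : List α) (g : List α → List α → X) :
    permSum l (fun p => insSum a m fun q => g p q) =
      insSum a m fun q => permSum l fun p => g p q := by
  simp only [permSum, insSum]
  induction l.permutations' with
  | nil => simp
  | cons b l ih => simp [ih, List.sum_map_add]

theorem permSum_congr {l : List α} {g h : List α → X} (H : ∀ l', l'.Perm l → g l' = h l') :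
    permSum l g = permSum l h :=
  congrArg List.sum (List.map_congr_left fun l' hl => H l' (List.mem_permutations'.1 hl))

theorem permSum_add (l : List α) (g h : List α → X) :
    permSum l (fun l => g l + h l) = permSum l g + permSum l h := List.sum_map_add

theorem map_permSum {Y : Type} [AddCommMonoid Y] (f : X →+ Y) (l : List α) (g : List α → X) :
    f (permSum l g) = permSum l fun l => f (g l) := by
  simp only [permSum, map_list_sum, List.map_map, Function.comp_def]

theorem bilin_permSum {Y Z : Type} [AddCommMonoid Y] [AddCommMonoid Z] (m : X →+ Y →+ Z)
    (p q : List α) (f : List α → X) (g : List α → Y) :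
    m (permSum p f) (permSum q g) = permSum p fun p => permSum q fun q => m (f p) (g q) := by
  simp only [← map_permSum (m _)]
  exact map_permSum (m.flip (permSum q g)) p f

/-- Inserting and then cutting is cutting and then inserting in one of the two parts. An insertion
at the cutting point of `l` gives one list with two cuts, one on each side of `a`. -/
theorem decSum_insSum (a : α) (l : List α) (g : List α → List α → X) :
    insSum a l (fun l => decSum l g) =
      decSum l fun p q => insSum a p (fun p => g p q) + insSum a q fun q => g p q := by
  induction l generalizing g with
  | nil => simp [insSum, decSum, add_comm]
  | cons b l ih =>
    simp only [insSum_cons, decSum, insSum_add, ih, decSum_add]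
    simp only [insSum, List.permutations'Aux, List.map_cons, List.map_nil, List.sum_cons,
      List.sum_nil, add_zero]
    abel

/-- To order `l` and cut the result is to choose which elements come first and to order the two
parts independently. This links the coproduct, a `splitSum`, with the way `fill` consumes an ordered
list piece by piece, a `decSum`. -/
theorem permSum_decSum (l : List α) (g : List α → List α → X) :
    permSum l (fun l => decSum l g) =
      splitSum l fun p q => permSum p fun p => permSum q fun q => g p q := by
  induction l generalizing g with
  | nil => simp [permSum_nil, decSum, splitSum]
  | cons a l ih =>
    simp only [permSum_cons, decSum_insSum, splitSum]
    simp only [decSum_add, permSum_add, ih]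
    simp only [permSum_insSum_comm]

theorem decSum_eq_of_length {k : ℕ} {g : List α → List α → X}
    (hg : ∀ p q, p.length ≠ k → g p q = 0) (l : List α) :
    decSum l g = if k ≤ l.length then g (l.take k) (l.drop k) else 0 := by
  induction l generalizing k g with
  | nil =>
    cases k with
    | zero => simp [decSum]
    | succ k => simp [decSum, hg]
  | cons a l ih =>
    cases k with
    | zero =>
      -- All the remaining prefixes start with `a`, so their terms vanish. The length `l.length +
      -- 1`, which no prefix of `l` can have, makes the induction hypothesis return `0`.
      rw [decSum, ih (k := l.length + 1)]
      · simp
      · intro p q _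
        exact hg _ _ (by simp)
    | succ k =>
      rw [decSum, hg _ _ (by simp), zero_add, ih (k := k)]
      · simp
      · intro p q h
        exact hg _ _ (by simpa using h)

/-- The sum over permutations of the positions. -/
theorem sum_perm_eq_permSum (l : List α) (g : List α → X) :
    ∑ f : Equiv.Perm (Fin l.length), g (List.ofFn fun i => l.get (f i)) = permSum l g := by
  -- Permuting positions rather than values makes the orderings pairwise distinct, even if `l` has
  -- repetitions, so that the sum over the list becomes a sum over a finite set.
  have h1 : permSum l g = ((List.finRange l.length).permutations'.map
      fun m => g (m.map l.get)).sum := by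
    rw [permSum]
    conv_lhs => rw [← List.map_get_finRange l, ← List.map_permutations', List.map_map]
    rfl
  rw [h1]
  have hnd : (List.finRange l.length).permutations'.Nodup :=
    (List.permutations_perm_permutations' _).nodup_iff.1
      (List.nodup_permutations _ (List.nodup_finRange _))
  rw [← List.sum_toFinset _ hnd]
  refine Finset.sum_bij (fun f _ => List.ofFn f) ?_ ?_ ?_ ?_
  · intro f _
    rw [List.mem_toFinset, List.mem_permutations', List.perm_ext_iff_of_nodup
      (List.nodup_ofFn.2 f.injective) (List.nodup_finRange _)]
    intro i
    simp only [List.mem_finRange, iff_true, List.mem_ofFn]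
    exact ⟨f.symm i, by simp⟩
  · intro f _ f' _ h
    exact Equiv.ext fun i => congrFun (List.ofFn_injective h) i
  · intro m hm
    rw [List.mem_toFinset, List.mem_permutations'] at hm
    have hlen : m.length = l.length := by simpa using hm.length_eq
    have hn : m.Nodup := hm.nodup_iff.2 (List.nodup_finRange _)
    let f : Fin l.length → Fin l.length := fun i => m.get (i.cast hlen.symm)
    have hf : Function.Injective f := fun i j h => by
      have := List.nodup_iff_injective_get.1 hn h
      simpa using this
    refine ⟨Equiv.ofBijective f (Finite.injective_iff_bijective.1 hf), Finset.mem_univ _, ?_⟩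
    apply List.ext_get
    · simp [hlen]
    · intro n h1 h2
      simp [f]
  · intro f _
    rw [List.map_ofFn]
    rfl

end orderings

/-! # Linear substitution as an iterated derivative -/

theorem cop_bag_coe {X : Type} [AddCommMonoid X] (G : Bags →+ Bags →+ X) (l : List RTerm) :
    cop G (bag l) = splitSum l fun p q => G (bag p) (bag q) := by
  induction l generalizing G with
  | nil => exact cop_one G
  | cons a l ih =>
    rw [← Multiset.cons_coe, bag_cons, cop_sing_mul, ih, ih, splitSum]
    simp only [← Multiset.cons_coe, bag_cons]
    rfl

namespace RTerm

theorem deg_var (n d : ℕ) : (var n).deg d = if n = d then 1 else 0 := by rw [deg, fold_var]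
theorem deg_const (d : ℕ) : const.deg d = 0 := by rw [deg, fold_const]
theorem deg_lam (t : RTerm) (d : ℕ) : (lam t).deg d = t.deg (d + 1) := by
  rw [deg, fold_lam]
theorem deg_app (t : RTerm) (T : Multiset RTerm) (d : ℕ) :
    (app t T).deg d = t.deg d + (T.map fun s => s.deg d).sum := by
  rw [deg, fold_app]; simp only [Multiset.map_map]; rfl

theorem fill_var (n d : ℕ) (us : List RTerm) : (var n).fill d us =
    if n < d then (var n, us) else if n = d then
      match us with
      | [] => (var n, [])
      | u :: us => (u.shift d 0, us)
    else (var (n - 1), us) :=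
  congrFun (congrFun (fold_var (α := ℕ → List RTerm → RTerm × List RTerm) _ _ _ _ n) d) us
theorem fill_const (d : ℕ) (us : List RTerm) : const.fill d us = (const, us) := by
  rw [fill, fold_const]
theorem fill_lam (t : RTerm) (d : ℕ) (us : List RTerm) :
    (lam t).fill d us = (lam (t.fill (d + 1) us).1, (t.fill (d + 1) us).2) := by
  rw [fill, fold_lam]

/-- `fill` orders the arguments of an application through a listing of their filling functions. This
lifts such a listing to the arguments themselves, whether or not distinct arguments give distinct
functions. -/
theorem exists_list_map_eq {α β : Type} (f : α → β) (l : List β) (T : Multiset α)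
    (h : (l : Multiset β) = T.map f) : ∃ m : List α, (m : Multiset α) = T ∧ m.map f = l := by
  induction l generalizing T with
  | nil => exact ⟨[], by simpa [eq_comm] using h, rfl⟩
  | cons b l ih =>
    classical
    rw [← Multiset.cons_coe, eq_comm, ← Multiset.map_eq_cons] at h
    obtain ⟨a, ha, hb, h⟩ := h
    obtain ⟨m, hm, hl⟩ := ih _ h.symm
    refine ⟨a :: m, ?_, by rw [List.map_cons, hb, hl]⟩
    rw [← Multiset.cons_coe, hm, Multiset.cons_erase ha]

/-- The arguments are ordered before the index and the list of terms are supplied, so a single `ws`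
serves for all `d` and `us`. -/
theorem fill_app (t : RTerm) (T : Multiset RTerm) : ∃ ws : List RTerm, (ws : Multiset RTerm) = T ∧
    ∀ d us, (app t T).fill d us =
      (app (t.fill d us).1 (thread (ws.map fun s => s.fill d) (t.fill d us).2).1,
        (thread (ws.map fun s => s.fill d) (t.fill d us).2).2) := by
  obtain ⟨ws, h1, h2⟩ := exists_list_map_eq fill (T.map fill).toList T (Multiset.coe_toList _)
  have h : ∀ d us, (app t T).fill d us = (app (t.fill d us).1
      (Multiset.ofList (thread ((T.map fill).toList.map fun s => s d) (t.fill d us).2).1),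
      (thread ((T.map fill).toList.map fun s => s d) (t.fill d us).2).2) :=
    fun d us => by rw [fill, fold_app]
  refine ⟨ws, h1, fun d us => ?_⟩
  rw [h, ← h2, List.map_map]
  rfl

theorem thread_append {ws : List RTerm} {d : ℕ}
    (h : ∀ s ∈ ws, ∀ l₁ l₂ : List RTerm, l₁.length = s.deg d →
      s.fill d (l₁ ++ l₂) = ((s.fill d l₁).1, l₂))
    (l₁ l₂ : List RTerm) (hl : l₁.length = (ws.map fun s => s.deg d).sum) :
    thread (ws.map fun s => s.fill d) (l₁ ++ l₂) =
      ((thread (ws.map fun s => s.fill d) l₁).1, l₂) := by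
  induction ws generalizing l₁ with
  | nil =>
    obtain rfl : l₁ = [] := by simpa using hl
    rfl
  | cons w ws ih =>
    rw [List.map_cons, List.sum_cons] at hl
    have hlen : (l₁.take (w.deg d)).length = w.deg d := by simp; omega
    have h1 := fun l => h w (List.mem_cons_self ..) (l₁.take (w.deg d)) l hlen
    have h2 := h1 (l₁.drop (w.deg d))
    have h3 := h1 (l₁.drop (w.deg d) ++ l₂)
    rw [← List.append_assoc] at h3
    rw [List.take_append_drop] at h2 h3
    have h4 := ih (fun s hs => h s (List.mem_cons_of_mem _ hs)) (l₁.drop (w.deg d))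
      (by simp; omega)
    simp only [List.map_cons, thread, h2, h3, h4]

theorem fill_append (t : RTerm) (d : ℕ) (l₁ l₂ : List RTerm) (hl : l₁.length = t.deg d) :
    t.fill d (l₁ ++ l₂) = ((t.fill d l₁).1, l₂) := by
  induction t using RTerm.induct generalizing d l₁ l₂ with
  | var n =>
    rw [deg_var] at hl
    simp only [fill_var]
    split_ifs at hl with h
    · subst h
      obtain ⟨a, rfl⟩ := List.length_eq_one_iff.1 hl
      simp
    · obtain rfl := List.length_eq_zero_iff.1 hl
      split_ifs <;> simp
  | const =>
    rw [deg_const] at hl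
    obtain rfl := List.length_eq_zero_iff.1 hl
    simp [fill_const]
  | lam t ih =>
    rw [deg_lam] at hl
    simp [fill_lam, ih _ _ l₂ hl]
  | app t T iht ihT =>
    obtain ⟨ws, rfl, h⟩ := fill_app t T
    rw [deg_app, Multiset.map_coe, Multiset.sum_coe] at hl
    have h1 := fun l => iht d (l₁.take (t.deg d)) l (by simp; omega)
    have h2 := h1 (l₁.drop (t.deg d))
    have h3 := h1 (l₁.drop (t.deg d) ++ l₂)
    rw [← List.append_assoc] at h3
    rw [List.take_append_drop] at h2 h3
    have h4 := thread_append (d := d) (fun s hs l₁ l₂ => ihT s (by simpa using hs) d l₁ l₂)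
      (l₁.drop (t.deg d)) l₂ (by simp; omega)
    simp only [h, h2, h3, h4]

/-- The term `t` filled with `l`, if the lengths agree. -/
noncomputable def fillC (t : RTerm) (d : ℕ) (l : List RTerm) : Comb :=
  if l.length = t.deg d then pt (t.fill d l).1 else 0

/-- The bag filled with `l`, if the lengths agree. -/
noncomputable def threadC (ws : List RTerm) (d : ℕ) (l : List RTerm) : Bags :=
  if l.length = (ws.map fun s => s.deg d).sum then
    bag (thread (ws.map fun s => s.fill d) l).1 else 0

/-- Because `fillC` checks lengths, only the cut after `w.deg d` elements contributes. Writing a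
single term as a sum over all cuts is what permits the use of `permSum_decSum`. -/
theorem threadC_cons (w : RTerm) (ws : List RTerm) (d : ℕ) (l : List RTerm) :
    threadC (w :: ws) d l = decSum l fun p q => sing (fillC w d p) * threadC ws d q := by
  rw [decSum_eq_of_length (k := w.deg d)]
  · split_ifs with h
    · have h1 := fill_append w d (l.take (w.deg d)) (l.drop (w.deg d)) (by simp [h])
      rw [List.take_append_drop] at h1
      have hlen : (l.take (w.deg d)).length = w.deg d := by simp [h]
      rw [fillC, if_pos hlen, threadC, threadC]
      have : (l.length = ((w :: ws).map fun s => s.deg d).sum) ↔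
        (l.drop (w.deg d)).length = (ws.map fun s => s.deg d).sum := by simp; omega
      simp only [this]
      split_ifs
      · rw [List.map_cons, thread, h1, ← Multiset.cons_coe, bag_cons]
      · rw [mul_zero]
    · rw [threadC, if_neg]
      simp; omega
  · intro p q hp
    rw [fillC, if_neg hp, map_zero, zero_mul]

theorem fillC_app (t : RTerm) (T : Multiset RTerm) :
    ∃ ws : List RTerm, (ws : Multiset RTerm) = T ∧ ∀ d l,
      fillC (app t T) d l = decSum l fun p q => appL (fillC t d p) (threadC ws d q) := by
  obtain ⟨ws, rfl, hws⟩ := fill_app t T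
  refine ⟨ws, rfl, fun d l => ?_⟩
  rw [decSum_eq_of_length (k := t.deg d)]
  · rw [fillC, deg_app, Multiset.map_coe, Multiset.sum_coe]
    split_ifs with h1 h h
    · have h2 := fill_append t d (l.take (t.deg d)) (l.drop (t.deg d)) (by simp [h])
      rw [List.take_append_drop] at h2
      rw [fillC, if_pos (by simp [h]), threadC, if_pos (by simp; omega), hws, h2, appL_pt_bag]
    · omega
    · rw [threadC, if_neg (by simp; omega), map_zero]
    · rfl
  · intro p q hp
    rw [fillC, if_neg hp, map_zero, AddMonoidHom.zero_apply]

end RTerm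

theorem permSum_two_zero {X : Type} [AddCommMonoid X] {k : ℕ} {g : List RTerm → X}
    (hg : ∀ l, l.length ≠ k → g l = 0) (l : List RTerm) (hl : l.length ≠ k) : permSum l g = 0 := by
  rw [permSum_congr (h := fun _ => 0) fun l' h => hg l' (by rwa [h.length_eq])]
  simp [permSum]

theorem permSum_of_zero {X : Type} [AddCommMonoid X] {g : List RTerm → X}
    (hg : ∀ l, l.length ≠ 0 → g l = 0) (l : List RTerm) :
    permSum l g = bagCounit (bag l) • g [] := by
  classical
  rw [bagCounit_bag]
  cases l with
  | nil => simp [permSum_nil]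
  | cons a l =>
    rw [permSum_two_zero hg _ (by simp)]
    simp

/-- Both sides satisfy the same recursion on `t`. At an application, the left side splits the bag by
`lsub_appL`, and the right side orders the list and cuts it; the two agree by `permSum_decSum`. The
argument bag is treated in the same way, one argument at a time. -/
theorem lsub_pt (d : ℕ) (l : List RTerm) (t : RTerm) :
    lsub d (bag l) (pt t) = permSum l (fillC t d) := by
  induction t using RTerm.induct generalizing d l with
  | var n =>
    by_cases h : n = d
    · subst h
      rw [lsub_var_self]
      by_cases hl : l.length = 1
      · obtain ⟨a, rfl⟩ := List.length_eq_one_iff.1 hl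
        rw [Multiset.coe_singleton, bagLin_bag_singleton, permSum_cons, permSum_nil, insSum]
        simp [fillC, deg_var, fill_var]
      · rw [bagLin_bag_of_card_ne (by simpa using hl), map_zero, permSum_two_zero (k := 1) _ _ hl]
        intro m hm
        rw [fillC, if_neg]
        simpa [deg_var] using hm
    · rw [lsub_var_of_ne h, permSum_of_zero]
      · congr 1
        simp only [fillC, deg_var, fill_var, h]
        split_ifs <;> simp_all
      · intro m hm
        rw [fillC, if_neg]
        simpa [deg_var, h] using hm
  | const =>
    rw [lsub_const, permSum_of_zero]
    · simp [fillC, deg_const, fill_const]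
    · intro m hm
      rw [fillC, if_neg]
      simpa [deg_const] using hm
  | lam t ih =>
    rw [← lamL_pt, lsub_lamL, ih, map_permSum]
    refine permSum_congr fun l' _ => ?_
    rw [fillC, fillC, deg_lam, fill_lam]
    split_ifs <;> simp
  | app t T iht ihT =>
    obtain ⟨ws, rfl, hws⟩ := fillC_app t T
    have hB : ∀ d (l : List RTerm), lsubB d (bag l) (bag ws) = permSum l (threadC ws d) := by
      clear hws
      induction ws with
      | nil =>
        intro d l
        rw [permSum_of_zero]
        · rw [Multiset.coe_nil, bag_zero, lsubB_one, threadC]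
          simp [thread, bag_zero]
        · intro m hm
          rw [threadC, if_neg]
          simpa using hm
      | cons w ws ih =>
        intro d l
        have hw : ∀ p : List RTerm, lsubB d (bag p) (sing (pt w)) = permSum p fun p =>
            sing (fillC w d p) := by
          intro p
          rw [lsubB_sing, ihT w (by simp), map_permSum]
        rw [← Multiset.cons_coe, bag_cons, lsubB_mul, cop_bag_coe]
        rw [show threadC (w :: ws) d = _ from funext (threadC_cons w ws d)]
        rw [permSum_decSum]
        congr 1
        funext p q
        simp only [AddMonoidHom.compl₂_apply, AddMonoidHom.comp_apply, AddMonoidHom.flip_apply,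
          AddMonoidHom.mul_apply]
        rw [hw, ih fun s hs => ihT s (by simp at hs ⊢; exact Or.inr hs)]
        exact bilin_permSum AddMonoidHom.mul p q _ _
    rw [← appL_pt_bag, lsub_appL, cop_bag_coe]
    rw [show fillC (app t ws) d = _ from funext (hws d)]
    rw [permSum_decSum]
    congr 1
    funext p q
    simp only [AddMonoidHom.compl₂_apply, AddMonoidHom.comp_apply, AddMonoidHom.flip_apply, iht, hB]
    exact bilin_permSum appL p q _ _

theorem RTerm.linSubst_eq (s : RTerm) (T : Multiset RTerm) :
    linSubst s T = lsub 0 (bag T) (pt s) := by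
  conv_rhs => rw [← Multiset.coe_toList T]
  rw [lsub_pt, ← sum_perm_eq_permSum, linSubst]
  split_ifs with h
  · refine Finset.sum_congr rfl fun f _ => ?_
    rw [fillC, if_pos (by simp [h])]
    rfl
  · refine (Finset.sum_eq_zero fun f _ => ?_).symm
    rw [fillC, if_neg]
    simpa [eq_comm] using h

/-! # Size bounds -/

/-- The number of symbols of a bag. -/
noncomputable def bagSize (T : Multiset RTerm) : ℕ := (T.map RTerm.size).sum

theorem bagSize_add (T U : Multiset RTerm) : bagSize (T + U) = bagSize T + bagSize U := by
  simp [bagSize]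

theorem bagSize_cons (t : RTerm) (T : Multiset RTerm) :
    bagSize (t ::ₘ T) = t.size + bagSize T := by simp [bagSize]

theorem bagSize_zero : bagSize 0 = 0 := by simp [bagSize]

theorem bagSize_singleton (t : RTerm) : bagSize {t} = t.size := by simp [bagSize]

theorem RTerm.size_app' (t : RTerm) (T : Multiset RTerm) :
    (app t T).size = t.size + bagSize T + 1 := size_app t T

/-- The combinations of terms with at most `N` symbols. -/
noncomputable def combLe (N : ℕ) : AddSubmonoid Comb :=
  AddSubmonoid.closure (pt '' {t | t.size ≤ N})

/-- The combinations of bags with at most `N` symbols. -/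
noncomputable def bagLe (N : ℕ) : AddSubmonoid Bags :=
  AddSubmonoid.closure (bag '' {T | bagSize T ≤ N})

theorem pt_mem_combLe {t : RTerm} {N : ℕ} (h : t.size ≤ N) : pt t ∈ combLe N :=
  AddSubmonoid.subset_closure ⟨t, h, rfl⟩

theorem bag_mem_bagLe {T : Multiset RTerm} {N : ℕ} (h : bagSize T ≤ N) : bag T ∈ bagLe N :=
  AddSubmonoid.subset_closure ⟨T, h, rfl⟩

@[elab_as_elim]
theorem combLe_ind {N : ℕ} {p : Comb → Prop} {v : Comb} (hv : v ∈ combLe N) (zero : p 0)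
    (add : ∀ x y, p x → p y → p (x + y)) (pt : ∀ t, t.size ≤ N → p (pt t)) : p v := by
  induction hv using AddSubmonoid.closure_induction with
  | mem x hx => obtain ⟨t, ht, rfl⟩ := hx; exact pt t ht
  | zero => exact zero
  | add x y _ _ hx hy => exact add x y hx hy

@[elab_as_elim]
theorem bagLe_ind {N : ℕ} {p : Bags → Prop} {v : Bags} (hv : v ∈ bagLe N) (zero : p 0)
    (add : ∀ x y, p x → p y → p (x + y)) (bag : ∀ T, bagSize T ≤ N → p (bag T)) : p v := by
  induction hv using AddSubmonoid.closure_induction with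
  | mem x hx => obtain ⟨t, ht, rfl⟩ := hx; exact bag t ht
  | zero => exact zero
  | add x y _ _ hx hy => exact add x y hx hy

theorem combLe_mono {M N : ℕ} (h : M ≤ N) {v : Comb} (hv : v ∈ combLe M) : v ∈ combLe N :=
  combLe_ind hv (zero_mem _) (fun _ _ => add_mem) fun _ ht => pt_mem_combLe (ht.trans h)

theorem bagLe_mono {M N : ℕ} (h : M ≤ N) {v : Bags} (hv : v ∈ bagLe M) : v ∈ bagLe N :=
  bagLe_ind hv (zero_mem _) (fun _ _ => add_mem) fun _ ht => bag_mem_bagLe (ht.trans h)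

theorem size_le_of_mem_combLe {N : ℕ} {v : Comb} (hv : v ∈ combLe N) {t : RTerm}
    (ht : v t ≠ 0) : t.size ≤ N := by
  revert ht
  refine combLe_ind hv (by simp) (fun x y hx hy h => ?_) fun s hs h => ?_
  · by_cases h' : x t = 0
    · exact hy fun h'' => h (by simp [h', h''])
    · exact hx h'
  · classical
    rw [pt, Finsupp.single_apply] at h
    split_ifs at h with e
    · exact e ▸ hs
    · exact absurd rfl h

theorem lamL_mem {N : ℕ} {v : Comb} (hv : v ∈ combLe N) : lamL v ∈ combLe (N + 1) := by
  refine combLe_ind hv (by simp) (fun x y hx hy => ?_) fun t ht => ?_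
  · rw [map_add]; exact add_mem hx hy
  · rw [lamL_pt]; exact pt_mem_combLe (by rw [size_lam]; omega)

theorem appL_mem {M N : ℕ} {v : Comb} (hv : v ∈ combLe M) {b : Bags} (hb : b ∈ bagLe N) :
    appL v b ∈ combLe (M + N + 1) := by
  refine combLe_ind hv (by simp) (fun x y hx hy => ?_) fun t ht => ?_
  · rw [map_add]; exact add_mem hx hy
  refine bagLe_ind hb (by simp) (fun x y hx hy => ?_) fun T hT => ?_
  · rw [map_add]; exact add_mem hx hy
  · rw [appL_pt_bag]; exact pt_mem_combLe (by rw [size_app']; omega)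

theorem sing_mem {N : ℕ} {v : Comb} (hv : v ∈ combLe N) : sing v ∈ bagLe N := by
  refine combLe_ind hv (by simp) (fun x y hx hy => ?_) fun t ht => ?_
  · rw [map_add]; exact add_mem hx hy
  · rw [sing_pt]; exact bag_mem_bagLe (by rwa [bagSize_singleton])

theorem mul_mem_bagLe {M N : ℕ} {a b : Bags} (ha : a ∈ bagLe M) (hb : b ∈ bagLe N) :
    a * b ∈ bagLe (M + N) := by
  refine bagLe_ind ha (by simp) (fun x y hx hy => ?_) fun t ht => ?_
  · rw [add_mul]; exact add_mem hx hy
  refine bagLe_ind hb (by simp) (fun x y hx hy => ?_) fun T hT => ?_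
  · rw [mul_add]; exact add_mem hx hy
  · rw [← bag_add]; exact bag_mem_bagLe (by rw [bagSize_add]; omega)

open Classical in
theorem der_bag (d : ℕ) (x : Comb) (T : Multiset RTerm) :
    der d x (bag T) = (T.map fun t => sing (dif d x (pt t)) * bag (T.erase t)).sum := by
  induction x using comb_ind with
  | zero => simp
  | add x y hx hy => simp [hx, hy, add_mul, Multiset.sum_map_add]
  | pt u => simp only [der, combLift_pt, bagDer, bagLift_bag, dif_pt_pt]

theorem der_bag_mem {d N : ℕ} {x : Comb} {T : Multiset RTerm}
    (h : ∀ t ∈ T, dif d x (pt t) ∈ combLe (t.size + N)) :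
    der d x (bag T) ∈ bagLe (bagSize T + N) := by
  classical
  rw [der_bag]
  refine multiset_sum_mem _ fun y hy => ?_
  obtain ⟨t, ht, rfl⟩ := Multiset.mem_map.1 hy
  refine bagLe_mono ?_ (mul_mem_bagLe (sing_mem (h t ht)) (bag_mem_bagLe le_rfl))
  have := bagSize_cons t (T.erase t)
  rw [Multiset.cons_erase ht] at this
  omega

/-- At most one occurrence is replaced in each summand, and shifts under binders do not change the
size of `u`. -/
theorem dif_pt_mem (d : ℕ) {u : RTerm} (t : RTerm) {N : ℕ} (h : u.size ≤ N) :
    dif d (pt u) (pt t) ∈ combLe (t.size + N) := by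
  induction t using RTerm.induct generalizing d u with
  | var n =>
    rw [dif_var]
    split_ifs
    · exact pt_mem_combLe (by omega)
    · exact zero_mem _
  | const => rw [dif_const]; exact zero_mem _
  | lam t ih =>
    rw [← lamL_pt, dif_lamL, shL_pt]
    refine combLe_mono ?_ (lamL_mem (ih (d + 1) (by rwa [size_shift])))
    rw [size_lam]; omega
  | app t T iht ihT =>
    rw [← appL_pt_bag, dif_appL]
    refine add_mem (combLe_mono ?_ (appL_mem (iht d h) (bag_mem_bagLe le_rfl)))
      (combLe_mono ?_ (appL_mem (pt_mem_combLe le_rfl) (der_bag_mem fun s hs => ihT s hs d h)))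
    all_goals rw [size_app']; omega

theorem dif_mem (d : ℕ) {u : RTerm} {M N : ℕ} (h : u.size ≤ N) {v : Comb} (hv : v ∈ combLe M) :
    dif d (pt u) v ∈ combLe (M + N) := by
  refine combLe_ind hv (by simp) (fun x y hx hy => ?_) fun t ht => ?_
  · rw [map_add]; exact add_mem hx hy
  · exact combLe_mono (by omega) (dif_pt_mem d t h)

theorem der_mem (d : ℕ) {u : RTerm} {N : ℕ} (h : u.size ≤ N) (T : Multiset RTerm) :
    der d (pt u) (bag T) ∈ bagLe (bagSize T + N) :=
  der_bag_mem fun t _ => dif_pt_mem d t h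

theorem bagHom_mem {f : RTerm → Comb} {T : Multiset RTerm}
    (h : ∀ t ∈ T, f t ∈ combLe t.size) : bagHom f (bag T) ∈ bagLe (bagSize T) := by
  induction T using Multiset.induction with
  | empty => rw [bag_zero, map_one]; exact bag_mem_bagLe le_rfl
  | cons t T ih =>
    rw [bag_cons, map_mul, bagHom_sing, combLift_pt, bagSize_cons]
    exact mul_mem_bagLe (sing_mem (h t (Multiset.mem_cons_self t T)))
      (ih fun s hs => h s (Multiset.mem_cons_of_mem hs))

theorem zap_mem (d : ℕ) (t : RTerm) : zap d t ∈ combLe t.size := by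
  induction t using RTerm.induct generalizing d with
  | var n =>
    rw [zap_var, size_var]
    split_ifs
    · exact pt_mem_combLe (by rw [size_var])
    · exact zero_mem _
    · exact pt_mem_combLe (by rw [size_var])
  | const => rw [zap_const]; exact pt_mem_combLe le_rfl
  | lam t ih => rw [zap_lam, size_lam]; exact lamL_mem (ih _)
  | app t T iht ihT =>
    rw [zap_app, size_app']
    exact appL_mem (iht d) (bagHom_mem fun s hs => ihT s hs d)

theorem zapL_mem (d : ℕ) {N : ℕ} {v : Comb} (hv : v ∈ combLe N) : zapL d v ∈ combLe N := by
  refine combLe_ind hv (by simp) (fun x y hx hy => ?_) fun t ht => ?_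
  · rw [map_add]; exact add_mem hx hy
  · rw [zapL_pt]; exact combLe_mono ht (zap_mem d t)

theorem zapB_mem (d : ℕ) (T : Multiset RTerm) : zapB d (bag T) ∈ bagLe (bagSize T) :=
  bagHom_mem fun s _ => zap_mem d s

theorem mdif_mem (d : ℕ) {N : ℕ} {v : Comb} (hv : v ∈ combLe N) (T : Multiset RTerm) :
    mdif d (bag T) v ∈ combLe (N + bagSize T) := by
  induction T using Multiset.induction with
  | empty => rw [bag_zero, mdif_one, bagSize_zero]; exact hv
  | cons t T ih =>
    rw [bag_cons, mdif_sing_mul, shL_pt]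
    refine combLe_mono ?_ (dif_mem d (le_refl _) ih)
    rw [bagSize_cons, size_shift]; omega

/-- The redex has size `t.size + bagSize T + 2`, so contracting it makes terms strictly smaller. The
recursion of `head` and the existence of normal forms both rest on this. -/
theorem lsub_mem (d : ℕ) (t : RTerm) (T : Multiset RTerm) :
    lsub d (bag T) (pt t) ∈ combLe (t.size + bagSize T) :=
  zapL_mem d (mdif_mem d (pt_mem_combLe le_rfl) T)

/-! # Derivatives and linear substitution -/

/-- The derivative reaches an occurrence in the body or in a substituted term. This is `dif_dif` for
the indices `d + 1` and `0`, where one correction vanishes because the shifted direction `x` avoids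
the substituted variable; the other correction differentiates the bag. -/
theorem dif_lsub (d : ℕ) (x : Comb) (b : Bags) (v : Comb) :
    dif d x (lsub 0 b v) = lsub 0 b (dif (d + 1) (shL 1 0 x) v) + lsub 0 (der d x b) v := by
  have h : ∀ b, dif (d + 1) (shL 1 0 x) (mdif 0 b v) =
      mdif 0 b (dif (d + 1) (shL 1 0 x) v) + mdif 0 (der d x b) v := by
    intro b
    induction b using bag_ind with
    | zero => simp
    | add x y hx hy => simp only [map_add, AddMonoidHom.add_apply, hx, hy]; abel
    | bag T =>
      induction T using Multiset.induction with
      | empty => simp [bag_zero, mdif_one]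
      | cons t T ih =>
        have h1 := dif_dif (d + 1) 0 (shL 1 0 x) (shL 1 0 (pt t)) (mdif 0 (bag T) v)
        rw [dif_shL_succ 0, map_zero, AddMonoidHom.zero_apply, add_zero, ih, map_add,
          ← shL_dif_of_le 1 0 d (Nat.zero_le d)] at h1
        rw [bag_cons, mdif_sing_mul, mdif_sing_mul, h1, der_mul, der_sing, map_add,
          AddMonoidHom.add_apply, mdif_sing_mul, mdif_sing_mul, add_assoc]
        exact congrArg _ (add_comm _ _)
  have h2 := zapL_dif 0 d (Nat.zero_le d) (shL 1 0 x) (mdif 0 b v)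
  rw [zapL_shL 0 0 0 le_rfl le_rfl, shL_zero] at h2
  rw [lsub_apply, ← h2, h, map_add]; rfl

theorem zapL_lsub (d : ℕ) (b : Bags) (v : Comb) :
    zapL d (lsub 0 b v) = lsub 0 (zapB d b) (zapL (d + 1) v) := by
  rw [lsub_apply, lsub_apply, zapL_zapL 0 d (Nat.zero_le d)]
  congr 1
  induction b using bag_ind with
  | zero => simp
  | add x y hx hy => simp only [map_add, AddMonoidHom.add_apply, hx, hy]
  | bag T =>
    induction T using Multiset.induction with
    | empty => simp [bag_zero, mdif_one]
    | cons t T ih =>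
      rw [bag_cons, mdif_sing_mul, zapL_dif_of_lt _ _ (Nat.succ_pos d),
        zapL_shL_of_ge 1 0 d (Nat.zero_le d), ih, map_mul, zapB_sing, mdif_sing_mul]

theorem shL_lsub (k c : ℕ) (b : Bags) (v : Comb) :
    shL k c (lsub 0 b v) = lsub 0 (shB k c b) (shL k (c + 1) v) := by
  rw [lsub_apply, lsub_apply, ← zapL_shL_of_le k c 0 (Nat.zero_le c)]
  congr 1
  induction b using bag_ind with
  | zero => simp
  | add x y hx hy => simp only [map_add, AddMonoidHom.add_apply, hx, hy]
  | bag T =>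
    induction T using Multiset.induction with
    | empty => simp [bag_zero, mdif_one]
    | cons t T ih =>
      rw [bag_cons, mdif_sing_mul, shL_dif_of_lt _ _ _ (Nat.succ_pos c),
        ← shL_shL_of_le 1 k 0 c (Nat.zero_le c), ih, map_mul, shB_sing, mdif_sing_mul]

/-! # Functionals that are invariant under reduction -/

theorem mapDomain_eq_combLift (f : RTerm → RTerm) (U : Comb) :
    U.mapDomain f = combLift (fun t => pt (f t)) U := by
  induction U using comb_ind with
  | zero => simp
  | add x y hx hy => rw [Finsupp.mapDomain_add, hx, hy, map_add]
  | pt t => rw [combLift_pt, pt, Finsupp.mapDomain_single]; rfl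

theorem mapDomain_lam (U : Comb) : U.mapDomain lam = lamL U := mapDomain_eq_combLift _ _

theorem mapDomain_app_left (T : Multiset RTerm) (U : Comb) :
    U.mapDomain (fun s => app s T) = appL U (bag T) := by
  rw [mapDomain_eq_combLift]
  induction U using comb_ind with
  | zero => simp
  | add x y hx hy => simp only [map_add, AddMonoidHom.add_apply, hx, hy]
  | pt t => simp

theorem mapDomain_app_right (u : RTerm) (T : Multiset RTerm) (U : Comb) :
    U.mapDomain (fun s => app u (s ::ₘ T)) = appL (pt u) (sing U * bag T) := by
  rw [mapDomain_eq_combLift]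
  induction U using comb_ind with
  | zero => simp
  | add x y hx hy => simp only [map_add, add_mul, hx, hy]
  | pt t => rw [combLift_pt, ← bag_cons, appL_pt_bag]

theorem RTerm.Red.shift {s : RTerm} {U : Comb} (h : Red s U) (k c : ℕ) :
    Red (s.shift k c) (shL k c U) := by
  induction h generalizing c with
  | beta s T =>
    rw [linSubst_eq, shL_lsub, shB_bag, shL_pt, ← linSubst_eq, shift_app, shift_lam]
    exact Red.beta _ _
  | lam _ ih =>
    rw [mapDomain_lam, shL_lamL, shift_lam, ← mapDomain_lam]
    exact Red.lam (ih _)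
  | app_left T _ ih =>
    rw [mapDomain_app_left, shL_appL, shift_app, shB_bag, ← mapDomain_app_left]
    exact Red.app_left _ (ih _)
  | app_right u T _ ih =>
    rw [mapDomain_app_right, shL_appL, shift_app, map_mul, shB_sing, shB_bag, shL_pt,
      ← mapDomain_app_right, Multiset.map_cons]
    exact Red.app_right _ _ (ih _)

/-- The functional `φ` is invariant under the reduction of terms with at most `N` symbols. -/
def RedInv (N : ℕ) (φ : Comb →+ ℕ) : Prop :=
  ∀ (s : RTerm) (U : Comb), Red s U → s.size ≤ N → φ (pt s) = φ U

theorem RedInv.mono {M N : ℕ} {φ : Comb →+ ℕ} (h : RedInv N φ) (hMN : M ≤ N) : RedInv M φ :=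
  fun s U hs hN => h s U hs (hN.trans hMN)

theorem RedInv.lam {N : ℕ} {φ : Comb →+ ℕ} (h : RedInv (N + 1) φ) : RedInv N (φ.comp lamL) := by
  intro s U hs hN
  have := h _ _ (Red.lam hs) (by rw [size_lam]; omega)
  rw [mapDomain_lam] at this
  simpa using this

theorem RedInv.app_left {N K : ℕ} {φ : Comb →+ ℕ} (h : RedInv (N + K + 1) φ) {b : Bags}
    (hb : b ∈ bagLe K) : RedInv N (φ.comp (appL.flip b)) := by
  intro s U hs hN
  simp only [AddMonoidHom.comp_apply, AddMonoidHom.flip_apply]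
  refine bagLe_ind hb (by simp) (fun x y hx hy => by simp only [map_add, hx, hy]) fun T hT => ?_
  have := h _ _ (Red.app_left T hs) (by rw [size_app']; omega)
  rwa [mapDomain_app_left, ← appL_pt_bag] at this

/-- The context of an argument. -/
noncomputable def argL (v : Comb) (b : Bags) : Comb →+ Comb :=
  (appL v).comp ((AddMonoidHom.mulRight b).comp sing)

theorem argL_apply (v : Comb) (b : Bags) (x : Comb) : argL v b x = appL v (sing x * b) := rfl

theorem RedInv.app_right {N M K : ℕ} {φ : Comb →+ ℕ} (h : RedInv (N + M + K + 1) φ) {v : Comb}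
    (hv : v ∈ combLe M) {b : Bags} (hb : b ∈ bagLe K) : RedInv N (φ.comp (argL v b)) := by
  intro s U hs hN
  simp only [AddMonoidHom.comp_apply, argL_apply]
  refine combLe_ind hv (by simp)
    (fun x y hx hy => by simp only [map_add, AddMonoidHom.add_apply, hx, hy]) fun t ht => ?_
  refine bagLe_ind hb (by simp)
    (fun x y hx hy => by simp only [mul_add, map_add, hx, hy]) fun T hT => ?_
  have := h _ _ (Red.app_right t T hs) (by rw [size_app', bagSize_cons]; omega)
  rwa [mapDomain_app_right, ← appL_pt_bag, bag_cons] at this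

theorem RedInv.beta {N M K : ℕ} {φ : Comb →+ ℕ} (h : RedInv N φ) {v : Comb}
    (hv : v ∈ combLe M) {b : Bags} (hb : b ∈ bagLe K) (hN : M + K + 2 ≤ N) :
    φ (appL (lamL v) b) = φ (lsub 0 b v) := by
  refine combLe_ind hv (by simp)
    (fun x y hx hy => by simp only [map_add, AddMonoidHom.add_apply, hx, hy]) fun t ht => ?_
  refine bagLe_ind hb (by simp)
    (fun x y hx hy => by simp only [map_add, AddMonoidHom.add_apply, hx, hy]) fun T hT => ?_
  have := h _ _ (Red.beta t T) (by rw [size_app', size_lam]; omega)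
  rwa [linSubst_eq, ← appL_pt_bag, ← lamL_pt] at this

-- Stability of invariant functionals under derivatives and linear substitution.

/-- Differentiating a reduction gives reductions in several summands rather than one step, so the
comparison is made through an invariant functional. At the redex, derivatives in the body and in the
bag match the two terms of `dif_lsub`. In a context, the derivative falls either on the reduced
subterm, where induction applies, or beside it, where the same step is still available. -/
theorem RTerm.Red.apply_dif {s : RTerm} {U : Comb} (h : Red s U) (d : ℕ) (u : RTerm) {φ : Comb →+ ℕ}
    (hφ : RedInv (s.size + u.size) φ) : φ (dif d (pt u) (pt s)) = φ (dif d (pt u) U) := by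
  induction h generalizing d u φ with
  | beta s T =>
    rw [size_app', size_lam] at hφ
    rw [linSubst_eq, dif_lsub, ← appL_pt_bag, ← lamL_pt, dif_appL, dif_lamL, shL_pt, map_add,
      map_add,
      hφ.beta (dif_mem (d + 1) (u := u.shift 1 0) (N := u.size) (by rw [size_shift])
        (pt_mem_combLe (le_refl s.size))) (bag_mem_bagLe (le_refl (bagSize T))) (by omega),
      hφ.beta (pt_mem_combLe (le_refl s.size)) (der_mem d (le_refl u.size) T) (by omega)]
  | @lam s U _ ih =>
    rw [size_lam] at hφ
    rw [mapDomain_lam, dif_lamL, ← lamL_pt, dif_lamL, shL_pt]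
    refine ih (d + 1) (u.shift 1 0) (φ := φ.comp lamL) (RedInv.lam (hφ.mono ?_))
    rw [size_shift]; omega
  | @app_left s U T hs ih =>
    rw [size_app'] at hφ
    rw [mapDomain_app_left, dif_appL, ← appL_pt_bag, dif_appL, map_add, map_add]
    congr 1
    · exact ih d u (φ := φ.comp (appL.flip (bag T)))
        (RedInv.app_left (K := bagSize T) (hφ.mono (by omega)) (bag_mem_bagLe le_rfl))
    · exact RedInv.app_left (N := s.size) (hφ.mono (by omega)) (der_mem d (le_refl u.size) T) s U hs
        le_rfl
  | @app_right t s U T hs ih =>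
    rw [size_app', bagSize_cons] at hφ
    rw [mapDomain_app_right, dif_appL, ← appL_pt_bag, dif_appL, bag_cons, der_mul, der_mul,
      der_sing, der_sing]
    simp only [map_add, ← argL_apply]
    congr 1
    · exact RedInv.app_right (N := s.size) (K := bagSize T) (hφ.mono (by omega))
        (dif_mem d (le_refl u.size) (pt_mem_combLe (le_refl t.size))) (bag_mem_bagLe le_rfl) s U hs
        le_rfl
    congr 1
    · exact ih d u (φ := φ.comp (argL (pt t) (bag T))) (RedInv.app_right (M := t.size)
        (K := bagSize T) (hφ.mono (by omega)) (pt_mem_combLe le_rfl) (bag_mem_bagLe le_rfl))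
    · exact RedInv.app_right (N := s.size) (M := t.size) (hφ.mono (by omega)) (pt_mem_combLe le_rfl)
        (der_mem d (le_refl u.size) T) s U hs le_rfl

theorem RedInv.comp_dif {N : ℕ} {φ : Comb →+ ℕ} (u : RTerm) (h : RedInv (N + u.size) φ) (d : ℕ) :
    RedInv N (φ.comp (dif d (pt u))) :=
  fun s U hs hN => hs.apply_dif d u (h.mono (by omega))

/-- Each summand of the derivative contains one inserted copy of `s`, shifted under binders, and the
reduction takes place in that copy. -/
theorem RTerm.Red.apply_dif_left {s : RTerm} {U : Comb} (h : Red s U) (d : ℕ) (t : RTerm)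
    {φ : Comb →+ ℕ} (hφ : RedInv (t.size + s.size) φ) :
    φ (dif d (pt s) (pt t)) = φ (dif d U (pt t)) := by
  induction t using RTerm.induct generalizing s U d φ with
  | var n =>
    rw [dif_var, dif_var]
    split_ifs
    · exact hφ s U h (by omega)
    · rfl
  | const => rw [dif_const, dif_const]
  | lam t ih =>
    rw [size_lam] at hφ
    rw [← lamL_pt, dif_lamL, dif_lamL, shL_pt]
    refine ih (h.shift 1 0) (d + 1) (φ := φ.comp lamL) (RedInv.lam (hφ.mono ?_))
    rw [size_shift]; omega
  | app t T iht ihT =>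
    rw [size_app'] at hφ
    rw [← appL_pt_bag, dif_appL, dif_appL, map_add, map_add]
    congr 1
    · exact iht h d (φ := φ.comp (appL.flip (bag T)))
        (RedInv.app_left (K := bagSize T) (hφ.mono (by omega)) (bag_mem_bagLe le_rfl))
    · classical
      rw [der_bag, der_bag, map_multiset_sum, map_multiset_sum, map_multiset_sum,
        map_multiset_sum, Multiset.map_map, Multiset.map_map, Multiset.map_map, Multiset.map_map]
      refine congrArg _ (Multiset.map_congr rfl fun w hw => ?_)
      have hsz := bagSize_cons w (T.erase w)
      rw [Multiset.cons_erase hw] at hsz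
      exact ihT w hw h d (φ := φ.comp (argL (pt t) (bag (T.erase w)))) (RedInv.app_right
        (M := t.size) (K := bagSize (T.erase w)) (hφ.mono (by omega)) (pt_mem_combLe le_rfl)
        (bag_mem_bagLe le_rfl))

theorem RTerm.Red.apply_zapL {s : RTerm} {U : Comb} (h : Red s U) (d : ℕ) {φ : Comb →+ ℕ}
    (hφ : RedInv s.size φ) : φ (zapL d (pt s)) = φ (zapL d U) := by
  induction h generalizing d φ with
  | beta s T =>
    rw [size_app', size_lam] at hφ
    rw [linSubst_eq, zapL_lsub, ← appL_pt_bag, ← lamL_pt, zapL_appL, zapL_lamL,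
      hφ.beta (zapL_mem (d + 1) (pt_mem_combLe (le_refl s.size))) (zapB_mem d T) (by omega)]
  | @lam s U _ ih =>
    rw [size_lam] at hφ
    rw [mapDomain_lam, zapL_lamL, ← lamL_pt, zapL_lamL]
    exact ih (d + 1) (φ := φ.comp lamL) (RedInv.lam hφ)
  | @app_left s U T hs ih =>
    rw [size_app'] at hφ
    rw [mapDomain_app_left, zapL_appL, ← appL_pt_bag, zapL_appL]
    exact ih d (φ := φ.comp (appL.flip (zapB d (bag T)))) (RedInv.app_left hφ (zapB_mem d T))
  | @app_right t s U T hs ih =>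
    rw [size_app', bagSize_cons] at hφ
    rw [mapDomain_app_right, zapL_appL, ← appL_pt_bag, zapL_appL, bag_cons,
      map_mul (zapB d), map_mul (zapB d), zapB_sing, zapB_sing]
    exact ih d (φ := φ.comp (argL (zapL d (pt t)) (zapB d (bag T)))) (RedInv.app_right
      (hφ.mono (by omega)) (zapL_mem d (pt_mem_combLe (le_refl t.size))) (zapB_mem d T))

theorem RedInv.comp_zapL {N : ℕ} {φ : Comb →+ ℕ} (h : RedInv N φ) (d : ℕ) :
    RedInv N (φ.comp (zapL d)) :=
  fun _ _ hs hN => hs.apply_zapL d (h.mono hN)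

theorem RedInv.comp_mdif {N : ℕ} {φ : Comb →+ ℕ} (T : Multiset RTerm)
    (h : RedInv (N + bagSize T) φ) (d : ℕ) :
    RedInv N (φ.comp (mdif d (bag T))) := by
  induction T using Multiset.induction generalizing N φ with
  | empty =>
    rw [bagSize_zero] at h
    have : φ.comp (mdif d (bag 0)) = φ := by
      ext; simp [bag_zero, mdif_one]
    rwa [this]
  | cons t T ih =>
    have h1 := RedInv.comp_dif (t.shift (d + 1) 0) (N := N + bagSize T)
      (h.mono (by rw [bagSize_cons, size_shift]; omega)) d
    intro s U hs hN
    have := ih h1 s U hs hN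
    simpa only [bag_cons, AddMonoidHom.comp_apply, mdif_sing_mul, shL_pt] using this

theorem RedInv.comp_lsub {N : ℕ} {φ : Comb →+ ℕ} (T : Multiset RTerm)
    (h : RedInv (N + bagSize T) φ) (d : ℕ) :
    RedInv N (φ.comp (lsub d (bag T))) :=
  RedInv.comp_mdif T (h.comp_zapL d) d

/-- Since derivatives along the bag commute, `s` can be inserted first; the substitution of `T` is
absorbed in the functional by `RedInv.comp_lsub`. -/
theorem RTerm.Red.apply_lsub_left {s : RTerm} {U : Comb} (h : Red s U) (d : ℕ) (T : Multiset RTerm)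
    (t : RTerm) {φ : Comb →+ ℕ} (hφ : RedInv (t.size + s.size + bagSize T) φ) :
    φ (lsub d (bag (s ::ₘ T)) (pt t)) = φ (lsub d (sing U * bag T) (pt t)) := by
  have h1 := (h.shift (d + 1) 0).apply_dif_left d t
    (hφ.mono (by rw [size_shift]) |>.comp_lsub T d)
  have h2 : ∀ x, lsub d (sing x * bag T) (pt t) =
      lsub d (bag T) (dif d (shL (d + 1) 0 x) (pt t)) := fun x => by
    rw [mul_comm, lsub_apply, mdif_mul, ← mul_one (sing x), mdif_sing_mul, mdif_one, lsub_apply]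
  rw [bag_cons, h2, h2, shL_pt]
  exact h1

/-! # Head reduction -/

/-- The number of symbols of a stack of bags. -/
noncomputable def stackSize (p : List (Multiset RTerm)) : ℕ := (p.map fun T => bagSize T + 1).sum

theorem stackSize_cons (T : Multiset RTerm) (p : List (Multiset RTerm)) :
    stackSize (T :: p) = bagSize T + 1 + stackSize p := by simp [stackSize]

/-- The number of times that the head reduction of `t`, applied to the bags of the stack `p`, ends
on the constant. -/
noncomputable def head (t : RTerm) (p : List (Multiset RTerm)) : ℕ :=
  match _ht : t.shape with
  | .var _ => 0
  | .const => if p = [] then 1 else 0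
  | .lam u =>
      match p with
      | [] => 0
      | T :: p => ∑ s ∈ (lsub 0 (bag T) (pt u)).support.attach,
          lsub 0 (bag T) (pt u) s.1 * head s.1 p
  | .app u T => head u (T :: p)
termination_by (t.size + stackSize p, t.size)
decreasing_by
  · apply Prod.Lex.left
    have := size_le_of_mem_combLe (lsub_mem 0 u T) (Finsupp.mem_support_iff.1 s.2)
    rw [eq_of_shape_lam _ht, size_lam, stackSize_cons]
    omega
  · rw [eq_of_shape_app _ht, size_app', stackSize_cons]
    have : u.size + (bagSize T + 1 + stackSize p) = u.size + bagSize T + 1 + stackSize p := by omega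
    rw [this]
    apply Prod.Lex.right
    omega

/-- Linear extension of `head`. -/
noncomputable def headL (p : List (Multiset RTerm)) : Comb →+ ℕ := combLift fun t => head t p

@[simp] theorem headL_pt (p : List (Multiset RTerm)) (t : RTerm) : headL p (pt t) = head t p :=
  combLift_pt _ _

theorem combLift_nat (f : RTerm → ℕ) (v : Comb) : combLift f v = ∑ t ∈ v.support, v t * f t := by
  simp [combLift, Finsupp.sum]

theorem combLift_zero {X : Type*} [AddCommMonoid X] (v : Comb) :
    combLift (fun _ => (0 : X)) v = 0 := by
  induction v using comb_ind with
  | zero => simp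
  | add x y hx hy => rw [map_add, hx, hy, add_zero]
  | pt t => simp

theorem combLift_add {X : Type*} [AddCommMonoid X] (f g : RTerm → X) (v : Comb) :
    combLift (fun t => f t + g t) v = combLift f v + combLift g v := by
  induction v using comb_ind with
  | zero => simp
  | add x y hx hy => simp only [map_add, hx, hy]; abel
  | pt t => simp

theorem combLift_comp {X : Type*} [AddCommMonoid X] (f : Comb →+ X) (v : Comb) :
    combLift (fun t => f (pt t)) v = f v := by
  induction v using comb_ind with
  | zero => simp
  | add x y hx hy => rw [map_add, hx, hy, map_add]
  | pt t => simp

theorem head_var (n : ℕ) (p : List (Multiset RTerm)) : head (var n) p = 0 := by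
  rw [head]
  split <;> rename_i h <;> rw [shape_var] at h <;> cases h

theorem head_const (p : List (Multiset RTerm)) : head const p = if p = [] then 1 else 0 := by
  rw [head]
  split <;> rename_i h <;> rw [shape_const] at h <;> cases h

theorem head_app (t : RTerm) (T : Multiset RTerm) (p : List (Multiset RTerm)) :
    head (app t T) p = head t (T :: p) := by
  rw [head]
  split <;> rename_i h <;> rw [shape_app] at h <;> cases h
  rfl

theorem head_lam_nil (t : RTerm) : head (lam t) [] = 0 := by
  rw [head]
  split <;> rename_i h <;> rw [shape_lam] at h <;> cases h

theorem head_lam_cons (t : RTerm) (T : Multiset RTerm) (p : List (Multiset RTerm)) :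
    head (lam t) (T :: p) = headL p (lsub 0 (bag T) (pt t)) := by
  rw [head]
  split <;> rename_i h <;> rw [shape_lam] at h <;> cases h
  rw [headL, combLift_nat, ← Finset.sum_attach]

theorem headL_lamL_nil (v : Comb) : headL [] (lamL v) = 0 := by
  induction v using comb_ind with
  | zero => simp
  | add x y hx hy => simp [hx, hy]
  | pt t => simp [head_lam_nil]

theorem headL_lamL_cons (v : Comb) (T : Multiset RTerm) (p : List (Multiset RTerm)) :
    headL (T :: p) (lamL v) = headL p (lsub 0 (bag T) v) := by
  induction v using comb_ind with
  | zero => simp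
  | add x y hx hy => simp [hx, hy]
  | pt t => simp [head_lam_cons]

theorem headL_appL (v : Comb) (T : Multiset RTerm) (p : List (Multiset RTerm)) :
    headL p (appL v (bag T)) = headL (T :: p) v := by
  induction v using comb_ind with
  | zero => simp
  | add x y hx hy => simp [hx, hy]
  | pt t => simp [head_app]

/-- Head reduction moves arguments to the stack before consuming them, so reductions in the bags of
the stack must be covered too. While `t` is an application, the total size is constant and the
induction on `t` suffices. At an abstraction the size drops: either the bag of `s` is consumed, and
`hN` applies, or another bag is, and `hb` applies to each resulting term. -/
theorem head_red_stack {N : ℕ} (hN : ∀ (p : List (Multiset RTerm)) (M : ℕ),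
      M + stackSize p < N → RedInv M (headL p))
    (hb : ∀ (t : RTerm) (p q : List (Multiset RTerm)) (s : RTerm) (T : Multiset RTerm) (U : Comb),
      Red s U → t.size + stackSize p + (s.size + bagSize T + 1) + stackSize q < N →
      head t (p ++ (s ::ₘ T) :: q) = combLift (fun s => head t (p ++ (s ::ₘ T) :: q)) U)
    {s : RTerm} {U : Comb} (hs : Red s U) (t : RTerm) (p q : List (Multiset RTerm))
    (T : Multiset RTerm)
    (h : t.size + stackSize p + (s.size + bagSize T + 1) + stackSize q ≤ N) :
    head t (p ++ (s ::ₘ T) :: q) = combLift (fun s => head t (p ++ (s ::ₘ T) :: q)) U := by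
  induction t using RTerm.induct generalizing p with
  | var n => simp only [head_var]; rw [combLift_zero]
  | const => simp [head_const, combLift_zero]
  | lam t ih =>
    rw [size_lam] at h
    cases p with
    | nil =>
      simp only [List.nil_append, head_lam_cons]
      rw [hs.apply_lsub_left 0 T t (hN q _ (by omega))]
      refine Eq.trans (combLift_comp ((headL q).comp (((lsub 0).flip (pt t)).comp
        ((AddMonoidHom.mulRight (bag T)).comp sing))) U).symm ?_
      simp only [bag_cons]; rfl
    | cons W p =>
      rw [stackSize_cons] at h
      simp only [List.cons_append, head_lam_cons]
      -- The substitution is decomposed into simple terms that all keep the size bound, as `hb`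
      -- requires.
      refine combLe_ind (lsub_mem 0 t W) ?_ ?_ ?_
      · simp [combLift_zero]
      · intro x y hx hy
        simp only [map_add, combLift_add, hx, hy]
      · intro t' ht'
        simp only [headL_pt]
        exact hb t' p q s T U hs (by omega)
  | app t W ih =>
    rw [size_app'] at h
    simp only [head_app]
    exact ih (W :: p) (by rw [stackSize_cons]; omega)

/-- Invariance for reductions in the head term and for reductions in the stack is proved together,
by induction on the total size, since each calls on the other: an argument of the head term becomes
an element of the stack, and an element of the stack is substituted in the head term. -/
theorem redInv_headL (N : ℕ) :
    (∀ (p : List (Multiset RTerm)) (M : ℕ), M + stackSize p ≤ N → RedInv M (headL p)) ∧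
    (∀ (t : RTerm) (p q : List (Multiset RTerm)) (s : RTerm) (T : Multiset RTerm) (U : Comb),
      Red s U → t.size + stackSize p + (s.size + bagSize T + 1) + stackSize q ≤ N →
      head t (p ++ (s ::ₘ T) :: q) = combLift (fun s => head t (p ++ (s ::ₘ T) :: q)) U) := by
  induction N using Nat.strong_induction_on with
  | _ N ih =>
    have h1 : ∀ (p : List (Multiset RTerm)) (M : ℕ), M + stackSize p < N → RedInv M (headL p) :=
      fun p M h => (ih _ h).1 p M le_rfl
    have h2 : ∀ (t : RTerm) (p q : List (Multiset RTerm)) (s : RTerm) (T : Multiset RTerm)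
        (U : Comb), Red s U →
        t.size + stackSize p + (s.size + bagSize T + 1) + stackSize q ≤ N →
        head t (p ++ (s ::ₘ T) :: q) = combLift (fun s => head t (p ++ (s ::ₘ T) :: q)) U :=
      fun t p q s T U hs h => head_red_stack h1
        (fun t p q s T U hs h => (ih _ h).2 t p q s T U hs le_rfl) hs t p q T h
    refine ⟨fun p M h s U hs hM => ?_, h2⟩
    replace h : s.size + stackSize p ≤ N := by omega
    clear hM
    induction hs generalizing p with
    | beta s T => rw [headL_pt, head_app, head_lam_cons, linSubst_eq]
    | @lam s U hs _ =>
      rw [size_lam] at h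
      rw [mapDomain_lam, ← lamL_pt]
      cases p with
      | nil => rw [headL_lamL_nil, headL_lamL_nil]
      | cons T p =>
        rw [stackSize_cons] at h
        rw [headL_lamL_cons, headL_lamL_cons]
        exact (h1 p (s.size + bagSize T) (by omega)).comp_lsub T 0 s U hs le_rfl
    | app_left T _ ih =>
      rw [size_app'] at h
      rw [mapDomain_app_left, ← appL_pt_bag, headL_appL, headL_appL]
      -- Moving `T` to the stack preserves the total size, so the induction used here is the one on
      -- the derivation of the reduction.
      exact ih _ (by rw [stackSize_cons]; omega)
    | @app_right u s U T hs _ =>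
      rw [size_app', bagSize_cons] at h
      rw [mapDomain_app_right, headL_pt, head_app]
      -- The reduced argument now lies in the first bag of the stack.
      refine (h2 u [] p s T U hs (by simp [stackSize] at h ⊢; omega)).trans ?_
      rw [← argL_apply]
      refine Eq.trans ?_ (combLift_comp ((headL p).comp (argL (pt u) (bag T))) U)
      simp only [AddMonoidHom.comp_apply, argL_apply, ← bag_cons, appL_pt_bag, headL_pt, head_app,
        List.nil_append]

theorem headL_red {s : RTerm} {U : Comb} (h : Red s U) (p : List (Multiset RTerm)) :
    headL p (pt s) = headL p U :=
  (redInv_headL _).1 p s.size le_rfl s U h le_rfl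

/-! # Normal forms -/

theorem isNormal_iff {U : Comb} : IsNormal U ↔ ∀ s, U s ≠ 0 → ∀ W, ¬ Red s W := by
  constructor
  · intro h s hs W hW
    have : U = Finsupp.single s 1 + (U - Finsupp.single s 1) := by
      classical
      ext t
      simp only [Finsupp.add_apply, Finsupp.tsub_apply, Finsupp.single_apply]
      split_ifs with e
      · subst e; omega
      · omega
    rw [this] at h
    exact h _ (Step.mk _ hW)
  · intro h V hV
    cases hV with
    | mk V hs =>
      refine h _ ?_ _ hs
      simp

theorem Step.add_right {U V : Comb} (h : Step U V) (W : Comb) : Step (U + W) (V + W) := by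
  cases h with
  | mk V hs => rw [add_assoc, add_assoc]; exact Step.mk _ hs

theorem steps_add {U V U' V' : Comb} (h : Relation.ReflTransGen Step U V)
    (h' : Relation.ReflTransGen Step U' V') : Relation.ReflTransGen Step (U + U') (V + V') := by
  refine (h.lift (· + U') fun _ _ h => Step.add_right h _).trans ?_
  rw [add_comm V V']
  simp only [add_comm V U']
  exact h'.lift (· + V) fun _ _ h => Step.add_right h _

/-- One bound below `s.size` holds for all summands at once, so normalization is an induction on
size bounds of combinations. -/
theorem red_mem_combLe {s : RTerm} {U : Comb} (h : Red s U) : ∃ M < s.size, U ∈ combLe M := by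
  induction h with
  | beta s T =>
    refine ⟨s.size + bagSize T, by rw [size_app', size_lam]; omega, ?_⟩
    rw [linSubst_eq]
    exact lsub_mem 0 s T
  | lam _ ih =>
    obtain ⟨M, hM, hU⟩ := ih
    refine ⟨M + 1, by rw [size_lam]; omega, ?_⟩
    rw [mapDomain_lam]
    exact lamL_mem hU
  | app_left T _ ih =>
    obtain ⟨M, hM, hU⟩ := ih
    refine ⟨M + bagSize T + 1, by rw [size_app']; omega, ?_⟩
    rw [mapDomain_app_left]
    exact appL_mem hU (bag_mem_bagLe le_rfl)
  | app_right u T _ ih =>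
    obtain ⟨M, hM, hU⟩ := ih
    refine ⟨u.size + (M + bagSize T) + 1, by rw [size_app', bagSize_cons]; omega, ?_⟩
    rw [mapDomain_app_right]
    exact appL_mem (pt_mem_combLe le_rfl) (mul_mem_bagLe (sing_mem hU) (bag_mem_bagLe le_rfl))

theorem exists_normal (N : ℕ) {U : Comb} (hU : U ∈ combLe N) :
    ∃ V, Relation.ReflTransGen Step U V ∧ IsNormal V := by
  induction N using Nat.strong_induction_on generalizing U with
  | _ N ih =>
    refine combLe_ind hU ?_ ?_ ?_
    · exact ⟨0, .refl, isNormal_iff.2 fun s hs => absurd rfl hs⟩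
    · rintro x y ⟨V, hV, hV'⟩ ⟨W, hW, hW'⟩
      refine ⟨V + W, steps_add hV hW, isNormal_iff.2 fun s hs => ?_⟩
      by_cases h : V s = 0
      · exact isNormal_iff.1 hW' s fun h' => hs (by rw [Finsupp.add_apply, h, h'])
      · exact isNormal_iff.1 hV' s h
    · intro t ht
      by_cases h : ∃ W, Red t W
      · obtain ⟨W, hW⟩ := h
        obtain ⟨M, hM, hWM⟩ := red_mem_combLe hW
        obtain ⟨V, hV, hV'⟩ := ih M (by omega) hWM
        refine ⟨V, .head ?_ hV, hV'⟩
        have := Step.mk 0 hW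
        rw [add_zero, add_zero] at this
        exact this
      · refine ⟨pt t, .refl, isNormal_iff.2 fun s hs => ?_⟩
        have : s = t := by
          by_contra e
          exact hs (by rw [pt, Finsupp.single_eq_of_ne]; exact e)
        rw [this]
        exact not_exists.1 h

theorem headL_step {U V : Comb} (h : Step U V) (p : List (Multiset RTerm)) :
    headL p U = headL p V := by
  cases h with
  | mk V hs => rw [map_add, map_add, ← headL_red hs]; rfl

/-- Along the spine of a normal application no function part is an abstraction, for it would form a
redex. The head is thus a variable, or the constant with a nonempty stack. -/
theorem head_of_normal {s : RTerm} (hs : ∀ W, ¬ Red s W) (hl : ∀ u, s ≠ lam u)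
    (p : List (Multiset RTerm)) (h : s ≠ const ∨ p ≠ []) : head s p = 0 := by
  induction s using RTerm.induct generalizing p with
  | var n => exact head_var n p
  | const =>
    rw [head_const, if_neg]
    simpa using h
  | lam t _ => exact absurd rfl (hl t)
  | app t T ih _ =>
    rw [head_app]
    refine ih (fun W hW => hs _ (Red.app_left T hW)) ?_ _ (Or.inr (by simp))
    rintro u rfl
    exact hs _ (Red.beta u T)

theorem headL_of_normal {V : Comb} (hV : IsNormal V) : headL [] V = V const := by
  rw [headL, combLift_nat, Finset.sum_eq_single const]
  · rw [head_const, if_pos rfl, mul_one]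
  · intro s hs hc
    by_cases hl : ∃ u, s = lam u
    · obtain ⟨u, rfl⟩ := hl
      rw [head_lam_nil, mul_zero]
    · rw [head_of_normal (isNormal_iff.1 hV s (Finsupp.mem_support_iff.1 hs)) (not_exists.1 hl) _
        (Or.inl hc), mul_zero]
  · intro h
    rw [Finsupp.notMem_support_iff.1 h, zero_mul]

/-- The coefficient of the constant in a normal form is computed by head reduction. -/
theorem NF_const (t : RTerm) : NF (Finsupp.single t 1) const = head t [] := by
  have h := exists_normal t.size (pt_mem_combLe (le_refl t.size))
  change ∃ V, Relation.ReflTransGen Step (Finsupp.single t 1) V ∧ IsNormal V at h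
  rw [NF, dif_pos h, ← headL_of_normal h.choose_spec.2, ← headL_pt]
  -- The value is preserved along every reduction sequence, so it does not matter which normal form
  -- was chosen in `NF`.
  have : ∀ U, Relation.ReflTransGen Step (pt t) U → headL [] (pt t) = headL [] U := by
    intro U hU
    induction hU with
    | refl => rfl
    | tail _ h ih => rw [ih, headL_step h]
  exact (this _ h.choose_spec.1).symm

/-! # Counit, linear part and coproduct under linear substitution -/

theorem bagLin_one : bagLin 1 = 0 := by rw [← bag_zero, bagLin_bag_of_card_ne (by simp)]

theorem bagLin_sing_mul (v : Comb) (b : Bags) : bagLin (sing v * b) = bagCounit b • v := by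
  classical
  induction v using comb_ind with
  | zero => simp
  | add x y hx hy => simp only [map_add, add_mul, hx, hy, smul_add]
  | pt t =>
    induction b using bag_ind with
    | zero => simp
    | add x y hx hy => simp only [map_add, mul_add, hx, hy, add_smul]
    | bag T =>
      rw [bagCounit_bag, ← bag_cons]
      split_ifs with h
      · rw [h, Multiset.cons_zero, bagLin_bag_singleton, one_smul]
      · rw [bagLin_bag_of_card_ne, zero_smul]
        simpa using h

/-- Induction on combinations of bags, one element at a time. -/
theorem bag_cons_ind {p : Bags → Prop} (b : Bags) (zero : p 0)
    (add : ∀ x y, p x → p y → p (x + y)) (one : p 1)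
    (cons : ∀ t b, p b → p (sing (pt t) * b)) : p b := by
  induction b using bag_ind with
  | zero => exact zero
  | add x y hx hy => exact add x y hx hy
  | bag T =>
    induction T using Multiset.induction with
    | empty => exact one
    | cons t T ih => rw [bag_cons]; exact cons t _ ih

/-- A derivation exchanges an element for other elements without changing their number. Counit and
linear part are components of this grading, hence their compatibility with derivatives, lowering and
substitution. -/
theorem bagCounit_der (d : ℕ) (x : Comb) (b : Bags) : bagCounit (der d x b) = 0 := by
  induction b using bag_cons_ind with
  | zero => simp
  | add x y hx hy => simp [hx, hy]
  | one => simp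
  | cons t b ih => rw [der_mul, der_sing, map_add, bagCounit_sing_mul, bagCounit_sing_mul]

theorem bagCounit_zapB (d : ℕ) (b : Bags) : bagCounit (zapB d b) = bagCounit b := by
  induction b using bag_cons_ind with
  | zero => simp
  | add x y hx hy => simp [hx, hy]
  | one => simp
  | cons t b ih => rw [map_mul, zapB_sing, bagCounit_sing_mul, bagCounit_sing_mul]

theorem bagLin_der (d : ℕ) (x : Comb) (b : Bags) : bagLin (der d x b) = dif d x (bagLin b) := by
  induction b using bag_cons_ind with
  | zero => simp
  | add x y hx hy => simp [hx, hy]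
  | one => simp [bagLin_one]
  | cons t b ih =>
    rw [der_mul, der_sing, map_add, bagLin_sing_mul, bagLin_sing_mul, bagLin_sing_mul,
      bagCounit_der, zero_smul, add_zero, map_nsmul]

theorem bagLin_zapB (d : ℕ) (b : Bags) : bagLin (zapB d b) = zapL d (bagLin b) := by
  induction b using bag_cons_ind with
  | zero => simp
  | add x y hx hy => simp [hx, hy]
  | one => simp [bagLin_one]
  | cons t b ih =>
    rw [map_mul, zapB_sing, bagLin_sing_mul, bagLin_sing_mul, bagCounit_zapB, map_nsmul]

theorem bagLin_mder (d : ℕ) (a b : Bags) : bagLin (mder d a b) = mdif d a (bagLin b) := by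
  induction a using bag_cons_ind with
  | zero => simp
  | add x y hx hy => simp [hx, hy]
  | one => rw [mder_one, mdif_one]
  | cons t a ih => rw [mder_sing_mul, mdif_sing_mul, bagLin_der, ih]

theorem bagLin_lsubB (d : ℕ) (a b : Bags) : bagLin (lsubB d a b) = lsub d a (bagLin b) := by
  rw [lsubB_apply, lsub_apply, bagLin_zapB, bagLin_mder]

theorem bagCounit_mder (d : ℕ) (a b : Bags) :
    bagCounit (mder d a b) = bagCounit a * bagCounit b := by
  induction a using bag_cons_ind with
  | zero => simp
  | add x y hx hy => simp [hx, hy, add_mul]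
  | one => rw [mder_one, bagCounit_one, one_mul]
  | cons t a ih => rw [mder_sing_mul, bagCounit_der, bagCounit_sing_mul, zero_mul]

theorem bagCounit_lsubB (d : ℕ) (a b : Bags) :
    bagCounit (lsubB d a b) = bagCounit a * bagCounit b := by
  rw [lsubB_apply, bagCounit_zapB, bagCounit_mder]

-- Compatibility of the coproduct with derivatives and linear substitution.

section cop
variable {X : Type} [AddCommMonoid X]

theorem cop_zero (b : Bags) : cop (0 : Bags →+ Bags →+ X) b = 0 := by
  induction b using bag_ind with
  | zero => simp
  | add x y hx hy => simp [hx, hy]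
  | bag T => simp [cop_bag]

/-- The bilinear map obtained from `G` by precomposition with `f` and `g`. -/
noncomputable def bicomp (G : Bags →+ Bags →+ X) (f g : Bags →+ Bags) : Bags →+ Bags →+ X :=
  (G.comp f).compl₂ g

@[simp] theorem bicomp_apply (G : Bags →+ Bags →+ X) (f g : Bags →+ Bags) (a b : Bags) :
    bicomp G f g a b = G (f a) (g b) := rfl

theorem bilin_ext {G H : Bags →+ Bags →+ X} (h : ∀ a b, G a b = H a b) : G = H :=
  AddMonoidHom.ext fun a => AddMonoidHom.ext (h a)

theorem cop_sing_mul' (G : Bags →+ Bags →+ X) (y : Comb) (b : Bags) :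
    cop G (sing y * b) = cop (bicomp G (AddMonoidHom.mulLeft (sing y)) (AddMonoidHom.id _) +
      bicomp G (AddMonoidHom.id _) (AddMonoidHom.mulLeft (sing y))) b := by
  rw [cop_sing_mul, cop_add]; rfl

/-- The differentiated element ends up on one side of the splitting: a derivation that preserves
one-element bags is also a coderivation. -/
theorem cop_der (d : ℕ) (x : Comb) (G : Bags →+ Bags →+ X) (b : Bags) :
    cop G (der d x b) = cop (bicomp G (der d x) (AddMonoidHom.id _) +
      bicomp G (AddMonoidHom.id _) (der d x)) b := by
  induction b using bag_cons_ind generalizing G with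
  | zero => simp
  | add x y hx hy => simp only [map_add, hx, hy]
  | one => simp [cop_one]
  | cons t b ih =>
    rw [der_mul, der_sing, map_add, cop_sing_mul', cop_sing_mul', cop_sing_mul', ih, ← cop_add]
    congr 1
    congr 1
    refine bilin_ext fun a b => ?_
    simp only [AddMonoidHom.add_apply, bicomp_apply, AddMonoidHom.id_apply,
      AddMonoidHom.coe_mulLeft, der_mul, der_sing, map_add]
    abel

theorem cop_zapB (d : ℕ) (G : Bags →+ Bags →+ X) (b : Bags) :
    cop G (zapB d b) = cop (bicomp G (zapB d).toAddMonoidHom (zapB d).toAddMonoidHom) b := by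
  induction b using bag_cons_ind generalizing G with
  | zero => simp
  | add x y hx hy => simp only [map_add, hx, hy]
  | one =>
    rw [map_one, cop_one, cop_one, bicomp_apply]
    congr 1
    · exact congrArg G (map_one (zapB d)).symm
    · exact (map_one (zapB d)).symm
  | cons t b ih =>
    rw [map_mul, zapB_sing, cop_sing_mul', cop_sing_mul', ih]
    congr 1
    congr 1
    refine bilin_ext fun a b => ?_
    simp only [AddMonoidHom.add_apply, bicomp_apply, AddMonoidHom.id_apply,
      AddMonoidHom.coe_mulLeft, RingHom.toAddMonoidHom_eq_coe, AddMonoidHom.coe_coe, map_mul,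
      zapB_sing]

theorem bicomp_add_left (G : Bags →+ Bags →+ X) (f f' g : Bags →+ Bags) :
    bicomp G (f + f') g = bicomp G f g + bicomp G f' g :=
  bilin_ext fun a b => by
    rw [bicomp_apply, AddMonoidHom.add_apply, map_add]; rfl

theorem bicomp_add_right (G : Bags →+ Bags →+ X) (f g g' : Bags →+ Bags) :
    bicomp G f (g + g') = bicomp G f g + bicomp G f g' :=
  bilin_ext fun a b => by
    rw [bicomp_apply, AddMonoidHom.add_apply, map_add]; rfl

theorem bicomp_zero_left (G : Bags →+ Bags →+ X) (g : Bags →+ Bags) : bicomp G 0 g = 0 :=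
  bilin_ext fun a b => by
    rw [bicomp_apply, AddMonoidHom.zero_apply, map_zero]; rfl

theorem bicomp_zero_right (G : Bags →+ Bags →+ X) (f : Bags →+ Bags) : bicomp G f 0 = 0 :=
  bilin_ext fun a b => by
    rw [bicomp_apply, AddMonoidHom.zero_apply, map_zero]; rfl

/-- The bilinear map `(a, a') ↦ cop (G ∘ (F a × F a')) v`. -/
noncomputable def copAct (F : Bags →+ Bags →+ Bags) (G : Bags →+ Bags →+ X) (v : Bags) :
    Bags →+ Bags →+ X where
  toFun a :=
    { toFun := fun a' => cop (bicomp G (F a) (F a')) v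
      map_zero' := by rw [map_zero, bicomp_zero_right, cop_zero]
      map_add' := fun x y => by rw [map_add, bicomp_add_right, cop_add] }
  map_zero' := AddMonoidHom.ext fun a =>
    show cop (bicomp G (F 0) (F a)) v = 0 by rw [map_zero, bicomp_zero_left, cop_zero]
  map_add' x y := AddMonoidHom.ext fun a =>
    show cop (bicomp G (F (x + y)) (F a)) v =
      cop (bicomp G (F x) (F a)) v + cop (bicomp G (F y) (F a)) v by
    rw [map_add, bicomp_add_left, cop_add]

theorem copAct_apply (F : Bags →+ Bags →+ Bags) (G : Bags →+ Bags →+ X) (v a a' : Bags) :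
    copAct F G v a a' = cop (bicomp G (F a) (F a')) v := rfl

theorem cop_mder (d : ℕ) (G : Bags →+ Bags →+ X) (a v : Bags) :
    cop G (mder d a v) = cop (copAct (mder d) G v) a := by
  induction a using bag_cons_ind generalizing G with
  | zero => simp
  | add x y hx hy => simp only [map_add, AddMonoidHom.add_apply, hx, hy]
  | one =>
    rw [mder_one, cop_one, copAct_apply]
    refine DFunLike.congr_fun (congrArg cop ?_) v
    refine bilin_ext fun a b => ?_
    rw [bicomp_apply, mder_one, mder_one]
  | cons t a ih =>
    rw [mder_sing_mul, cop_der, ih, cop_sing_mul']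
    congr 1
    congr 1
    refine bilin_ext fun a b => ?_
    simp only [AddMonoidHom.add_apply, bicomp_apply, copAct_apply, AddMonoidHom.id_apply,
      AddMonoidHom.coe_mulLeft]
    rw [← cop_add]
    congr 1
    congr 1
    refine bilin_ext fun a b => ?_
    simp only [AddMonoidHom.add_apply, bicomp_apply, AddMonoidHom.id_apply, mder_sing_mul]

/-- Substitution is a morphism of coproducts in both arguments: a splitting of the result comes from
a splitting of `v` and one of the substituted bag. This propagates splittings through nested
closures. -/
theorem cop_lsubB (d : ℕ) (G : Bags →+ Bags →+ X) (a v : Bags) :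
    cop G (lsubB d a v) = cop (copAct (lsubB d) G v) a := by
  rw [lsubB_apply, cop_zapB, cop_mder]
  rfl

end cop

/-! # Substitution of a list of bags -/

/-- Linear substitution of bags for the variables of indices `d, d + 1, …`. -/
noncomputable def act (d : ℕ) : List Bags → Comb →+ Comb
  | [] => AddMonoidHom.id _
  | b :: bs => (lsub d b).comp (act (d + 1) bs)

/-- Linear substitution of bags for the variables of indices `d, d + 1, …` in bags. -/
noncomputable def actB (d : ℕ) : List Bags → Bags →+ Bags
  | [] => AddMonoidHom.id _
  | b :: bs => (lsubB d b).comp (actB (d + 1) bs)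

theorem act_cons (d : ℕ) (b : Bags) (bs : List Bags) (v : Comb) :
    act d (b :: bs) v = lsub d b (act (d + 1) bs v) := rfl

theorem actB_cons (d : ℕ) (b : Bags) (bs : List Bags) (v : Bags) :
    actB d (b :: bs) v = lsubB d b (actB (d + 1) bs v) := rfl

theorem act_lamL (d : ℕ) (bs : List Bags) (v : Comb) :
    act d bs (lamL v) = lamL (act (d + 1) bs v) := by
  induction bs generalizing d with
  | nil => rfl
  | cons b bs ih => rw [act_cons, act_cons, ih, lsub_lamL]

theorem act_const (d : ℕ) (bs : List Bags) :
    act d bs (pt .const) = (bs.map bagCounit).prod • pt .const := by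
  induction bs generalizing d with
  | nil => rw [List.map_nil, List.prod_nil, one_smul]; rfl
  | cons b bs ih =>
    rw [act_cons, ih, map_nsmul, lsub_const, List.map_cons, List.prod_cons, smul_smul, mul_comm]

theorem act_var_of_lt {d n : ℕ} (h : n < d) (bs : List Bags) :
    act d bs (pt (.var n)) = (bs.map bagCounit).prod • pt (.var n) := by
  induction bs generalizing d with
  | nil => rw [List.map_nil, List.prod_nil, one_smul]; rfl
  | cons b bs ih =>
    rw [act_cons, ih (by omega), map_nsmul, lsub_var_of_ne h.ne, List.map_cons, List.prod_cons,
      smul_smul, mul_comm, if_pos h]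

theorem act_var_of_le {d n : ℕ} (bs : List Bags) (h : d + bs.length ≤ n) :
    act d bs (pt (.var n)) = (bs.map bagCounit).prod • pt (.var (n - bs.length)) := by
  induction bs generalizing d with
  | nil => rw [List.map_nil, List.prod_nil, one_smul]; rfl
  | cons b bs ih =>
    rw [List.length_cons] at h ⊢
    rw [act_cons, ih (by omega), map_nsmul, lsub_var_of_ne (by omega), List.map_cons,
      List.prod_cons, smul_smul, mul_comm, if_neg (by omega), Nat.sub_sub]

theorem bagLin_actB (d : ℕ) (bs : List Bags) (b : Bags) :
    bagLin (actB d bs b) = act d bs (bagLin b) := by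
  induction bs generalizing d with
  | nil => rfl
  | cons b bs ih => rw [act_cons, actB_cons, bagLin_lsubB, ih]

theorem bagCounit_actB (d : ℕ) (bs : List Bags) (b : Bags) :
    bagCounit (actB d bs b) = (bs.map bagCounit).prod * bagCounit b := by
  induction bs generalizing d with
  | nil => rw [List.map_nil, List.prod_nil, one_mul]; rfl
  | cons b bs ih => rw [actB_cons, bagCounit_lsubB, ih, List.map_cons, List.prod_cons, mul_assoc]

/-! # Observation of applications to bags -/

/-- The coefficient of `c₀` in the head normal form of `v`, applied to bags. -/
noncomputable def obs : List Bags → Comb →+ ℕ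
  | [] => headL []
  | b :: bs => (obs bs).comp (appL.flip b)

theorem obs_appL (bs : List Bags) (v : Comb) (b : Bags) : obs bs (appL v b) = obs (b :: bs) v := rfl

/-- The stacks of `headL` consist of bags and those of `obs` of combinations of bags; linearity in
each of them reduces the latter to the former. -/
theorem obs_congr {v w : Comb} (h : ∀ p, headL p v = headL p w) (bs : List Bags) :
    obs bs v = obs bs w := by
  induction bs generalizing v w with
  | nil => exact h []
  | cons b bs ih =>
    rw [← obs_appL, ← obs_appL]
    refine ih fun p => ?_
    induction b using bag_ind with
    | zero => simp
    | add x y hx hy => simp only [map_add, hx, hy]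
    | bag T => rw [headL_appL, headL_appL, h]

theorem obs_var (bs : List Bags) (n : ℕ) : obs bs (pt (.var n)) = 0 := by
  rw [obs_congr (w := 0), map_zero]
  intro p
  rw [headL_pt, head_var, map_zero]

theorem obs_const (bs : List Bags) : obs bs (pt .const) = if bs = [] then 1 else 0 := by
  cases bs with
  | nil =>
    rw [obs, headL_pt, head_const]
    simp
  | cons b bs =>
    rw [← obs_appL, obs_congr (w := 0), map_zero, if_neg (by simp)]
    intro p
    induction b using bag_ind with
    | zero => simp
    | add x y hx hy => rw [map_add, map_add, hx, hy, map_zero, add_zero]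
    | bag T => rw [headL_appL, headL_pt, head_const, map_zero, if_neg (by simp)]

theorem obs_lamL_nil (v : Comb) : obs [] (lamL v) = 0 := headL_lamL_nil v

theorem obs_lamL_cons (b : Bags) (bs : List Bags) (v : Comb) :
    obs (b :: bs) (lamL v) = obs bs (lsub 0 b v) := by
  rw [← obs_appL]
  refine obs_congr (fun p => ?_) bs
  induction b using bag_ind with
  | zero => simp
  | add x y hx hy => simp only [map_add, hx, hy, AddMonoidHom.add_apply]
  | bag T => rw [headL_appL, headL_lamL_cons]

/-! # Closures as combinations of bags -/

mutual
/-- The combination of bags denoted by a resource closure. -/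
noncomputable def RClo.toBags : RClo → Bags
  | .mk T e => actB 0 (envBags e) (bag T)
/-- The combinations of bags denoted by the closures of a list. -/
noncomputable def envBags : List RClo → List Bags
  | [] => []
  | c :: e => c.toBags :: envBags e
end

mutual
/-- The pairs `(c', c'')` with `c'c'' = c`, when the elements of bags are labelled. -/
noncomputable def RClo.labSplits : RClo → Multiset (RClo × RClo)
  | .mk T e => (envLabSplits e).bind fun q =>
      T.antidiagonal.map fun p => (.mk p.1 q.1, .mk p.2 q.2)
/-- The pairs `(e', e'')` with `e'e'' = e`, when the elements of bags are labelled. -/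
noncomputable def envLabSplits : List RClo → Multiset (List RClo × List RClo)
  | [] => {([], [])}
  | c :: e => (envLabSplits e).bind fun q =>
      c.labSplits.map fun p => (p.1 :: q.1, p.2 :: q.2)
end

mutual
theorem RClo.mem_splits_of_mem_labSplits :
    ∀ (c : RClo) (p : RClo × RClo), p ∈ c.labSplits → p ∈ c.splits
  | .mk T e, p, hp => by
    classical
    rw [RClo.labSplits, Multiset.mem_bind] at hp
    obtain ⟨q, hq, hp⟩ := hp
    obtain ⟨r, hr, rfl⟩ := Multiset.mem_map.1 hp
    rw [RClo.splits, Finset.mem_image]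
    exact ⟨(r, q), Finset.mem_product.2 ⟨Multiset.mem_toFinset.2 hr,
      mem_envSplits_of_mem_envLabSplits e q hq⟩, rfl⟩
theorem mem_envSplits_of_mem_envLabSplits : ∀ (e : List RClo) (p : List RClo × List RClo),
    p ∈ envLabSplits e → p ∈ envSplits e
  | [], p, hp => by
    rw [envLabSplits] at hp
    rw [envSplits]
    simpa using hp
  | c :: e, p, hp => by
    classical
    rw [envLabSplits, Multiset.mem_bind] at hp
    obtain ⟨q, hq, hp⟩ := hp
    obtain ⟨r, hr, rfl⟩ := Multiset.mem_map.1 hp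
    rw [envSplits, Finset.mem_image]
    exact ⟨(r, q), Finset.mem_product.2 ⟨RClo.mem_splits_of_mem_labSplits c r hr,
      mem_envSplits_of_mem_envLabSplits e q hq⟩, rfl⟩
end

theorem RClo.sum_labSplits_mk {X : Type*} [AddCommMonoid X] (T : Multiset RTerm) (e : List RClo)
    (g : RClo → RClo → X) :
    ((RClo.mk T e).labSplits.map fun p => g p.1 p.2).sum =
      ((envLabSplits e).map fun q =>
        (T.antidiagonal.map fun p => g (.mk p.1 q.1) (.mk p.2 q.2)).sum).sum := by
  rw [RClo.labSplits, Multiset.map_bind, Multiset.sum_bind]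
  simp only [Multiset.map_map, Function.comp_def]

theorem sum_envLabSplits_nil {X : Type*} [AddCommMonoid X] (g : List RClo → List RClo → X) :
    ((envLabSplits []).map fun p => g p.1 p.2).sum = g [] [] := by
  rw [envLabSplits, Multiset.map_singleton, Multiset.sum_singleton]

theorem sum_envLabSplits_cons {X : Type*} [AddCommMonoid X] (c : RClo) (e : List RClo)
    (g : List RClo → List RClo → X) :
    ((envLabSplits (c :: e)).map fun p => g p.1 p.2).sum =
      ((envLabSplits e).map fun q =>
        (c.labSplits.map fun p => g (p.1 :: q.1) (p.2 :: q.2)).sum).sum := by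
  rw [envLabSplits, Multiset.map_bind, Multiset.sum_bind]
  simp only [Multiset.map_map, Function.comp_def]

mutual
-- A closure denotes an iterated substitution, so by `cop_lsubB` its coproduct splits its multiset
-- and each closure of its environment independently. These are the labelled splittings, counted
-- with repetition.
theorem RClo.cop_toBags : ∀ (c : RClo) {X : Type} [AddCommMonoid X] (G : Bags →+ Bags →+ X),
    cop G c.toBags = (c.labSplits.map fun p => G p.1.toBags p.2.toBags).sum
  | .mk T e, X, _, G => by
    rw [RClo.sum_labSplits_mk T e fun c' c'' => G c'.toBags c''.toBags, RClo.toBags,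
      cop_actB_envBags]
    simp only [cop_bag, bicomp_apply, RClo.toBags]
theorem cop_actB_envBags : ∀ (e : List RClo) {X : Type} [AddCommMonoid X] (d : ℕ)
    (G : Bags →+ Bags →+ X) (b : Bags), cop G (actB d (envBags e) b) =
      ((envLabSplits e).map fun q =>
        cop (bicomp G (actB d (envBags q.1)) (actB d (envBags q.2))) b).sum
  | [], X, _, d, G, b => by
    rw [sum_envLabSplits_nil fun e' e'' =>
      cop (bicomp G (actB d (envBags e')) (actB d (envBags e''))) b, envBags]
    rfl
  | c :: e, X, _, d, G, b => by
    rw [sum_envLabSplits_cons c e fun e' e'' =>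
      cop (bicomp G (actB d (envBags e')) (actB d (envBags e''))) b, envBags, actB_cons,
      cop_lsubB, RClo.cop_toBags c, Multiset.sum_map_sum_map]
    refine congrArg _ (Multiset.map_congr rfl fun p _ => ?_)
    rw [copAct_apply, cop_actB_envBags e]
    refine congrArg _ (Multiset.map_congr rfl fun q _ => ?_)
    rw [envBags, envBags]
    rfl
end

/-- This mirrors the transition of the machine on applications, except that the splittings are
counted with labels. -/
theorem act_appL (e : List RClo) (d : ℕ) (v : Comb) (b : Bags) :
    act d (envBags e) (appL v b) = ((envLabSplits e).map fun q =>
      appL (act d (envBags q.1) v) (actB d (envBags q.2) b)).sum := by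
  induction e generalizing d with
  | nil =>
    rw [sum_envLabSplits_nil fun e' e'' => appL (act d (envBags e') v) (actB d (envBags e'') b),
      envBags]
    rfl
  | cons c e ih =>
    rw [sum_envLabSplits_cons c e fun e' e'' =>
      appL (act d (envBags e') v) (actB d (envBags e'') b), envBags, act_cons, ih,
      map_multiset_sum, Multiset.map_map]
    refine congrArg _ (Multiset.map_congr rfl fun q _ => ?_)
    rw [Function.comp_apply, lsub_appL, RClo.cop_toBags]
    refine congrArg _ (Multiset.map_congr rfl fun p _ => ?_)
    rw [envBags, envBags]
    rfl

open Classical in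
mutual
-- A closure bound to a variable without occurrences contributes its counit, which thus plays the
-- part of the machine's test that unused resources are empty.
theorem RClo.bagCounit_toBags : ∀ c : RClo, bagCounit c.toBags = if c.IsOne then 1 else 0
  | .mk T e => by
    rw [RClo.toBags, bagCounit_actB, prod_bagCounit_envBags e, bagCounit_bag, RClo.IsOne]
    split_ifs <;> simp_all
theorem prod_bagCounit_envBags :
    ∀ e : List RClo, ((envBags e).map bagCounit).prod = if envIsOne e then 1 else 0
  | [] => by rw [envBags, envIsOne]; simp
  | c :: e => by
    rw [envBags, envIsOne, List.map_cons, List.prod_cons, RClo.bagCounit_toBags c,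
      prod_bagCounit_envBags e]
    split_ifs <;> simp_all
end

theorem length_envBags (e : List RClo) : (envBags e).length = e.length := by
  induction e with
  | nil => rw [envBags]; rfl
  | cons c e ih => rw [envBags, List.length_cons, List.length_cons, ih]

theorem envIsOne_iff (e : List RClo) : envIsOne e ↔ ∀ y, (envAt e y).IsOne := by
  induction e with
  | nil =>
    rw [envIsOne]
    simp [envAt, RClo.one, RClo.IsOne, envIsOne]
  | cons c e ih =>
    rw [envIsOne, ih]
    constructor
    · rintro ⟨h, h'⟩ (_ | y)
      · exact h
      · exact h' y
    · exact fun h => ⟨h 0, fun y => h (y + 1)⟩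

-- Higher indices are substituted first, and the terms inserted for them avoid the lower ones. So
-- only the closure at `x` meets an occurrence; it contributes its linear part, and each of the
-- others its counit.
open Classical in
theorem act_var (d : ℕ) (e : List RClo) {x : ℕ} (hx : x < e.length) :
    act d (envBags e) (pt (.var (d + x))) =
      if ∀ y, y ≠ x → (envAt e y).IsOne then shL d 0 (bagLin (envAt e x).toBags) else 0 := by
  induction e generalizing d x with
  | nil => simp at hx
  | cons c e ih =>
    rw [envBags, act_cons]
    cases x with
    | zero =>
      rw [act_var_of_lt (by omega), map_nsmul, add_zero, lsub_var_self, prod_bagCounit_envBags,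
        envIsOne_iff]
      have : (∀ y, y ≠ 0 → (envAt (c :: e) y).IsOne) ↔ ∀ y, (envAt e y).IsOne :=
        ⟨fun h y => h (y + 1) (by simp), fun h y hy => by
          obtain ⟨y, rfl⟩ := Nat.exists_eq_succ_of_ne_zero hy
          exact h y⟩
      rw [ite_smul, one_smul, zero_smul]
      simp only [this]
      rfl
    | succ x =>
      rw [show d + (x + 1) = d + 1 + x by omega, ih (d + 1) (by simpa using hx)]
      have : (∀ y, y ≠ x + 1 → (envAt (c :: e) y).IsOne) ↔
          c.IsOne ∧ ∀ y, y ≠ x → (envAt e y).IsOne := by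
        constructor
        · exact fun h => ⟨h 0 (by simp), fun y hy => h (y + 1) (by simpa using hy)⟩
        · rintro ⟨h, h'⟩ (_ | y) hy
          · exact h
          · exact h' y (by simpa using hy)
      simp only [this]
      by_cases h : ∀ y, y ≠ x → (envAt e y).IsOne
      · rw [if_pos h, lsub_shL, RClo.bagCounit_toBags, ite_smul, one_smul, zero_smul]
        by_cases hc : c.IsOne
        · rw [if_pos hc, if_pos ⟨hc, h⟩]; rfl
        · rw [if_neg hc, if_neg fun h' => hc h'.1]
      · rw [if_neg h, if_neg fun h' => h h'.2, map_zero]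

/-! # Multiplicities of closures -/

section multiplicity
open Classical

/-- The number of permutations of the occurrences in `T` that fix the elements. -/
noncomputable def permCount (T : Multiset RTerm) : ℕ := ∏ s ∈ T.toFinset, (T.count s).factorial

theorem permCount_cons (a : RTerm) (T : Multiset RTerm) :
    permCount (a ::ₘ T) = ((a ::ₘ T).count a) * permCount T := by
  have h : ∀ U : Multiset RTerm, U ≤ a ::ₘ T →
      permCount U = ∏ s ∈ (a ::ₘ T).toFinset, (U.count s).factorial := fun U hU =>
    Finset.prod_subset (Multiset.toFinset_subset.2 (Multiset.subset_of_le hU)) fun s _ hs => by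
      rw [Multiset.mem_toFinset] at hs
      rw [Multiset.count_eq_zero_of_notMem hs, Nat.factorial_zero]
  rw [h _ le_rfl, h _ (Multiset.le_cons_self T a)]
  have ha : a ∈ (a ::ₘ T).toFinset := by simp
  rw [← Finset.mul_prod_erase _ _ ha, ← Finset.mul_prod_erase _ _ ha, ← mul_assoc]
  congr 1
  · rw [Multiset.count_cons_self, Nat.factorial_succ]
  · refine Finset.prod_congr rfl fun s hs => ?_
    rw [Multiset.count_cons_of_ne (Finset.ne_of_mem_erase hs)]

theorem permCount_of_mem {a : RTerm} {T : Multiset RTerm} (h : a ∈ T) :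
    permCount T = T.count a * permCount (T.erase a) := by
  obtain ⟨U, rfl⟩ := Multiset.exists_cons_of_mem h
  rw [permCount_cons, Multiset.erase_cons_head]

theorem count_map_antidiagonal_right (a : RTerm) (S : Multiset (Multiset RTerm × Multiset RTerm))
    (A B : Multiset RTerm) : (S.map (Prod.map id (Multiset.cons a))).count (A, B) =
      if a ∈ B then S.count (A, B.erase a) else 0 := by
  have hinj : Function.Injective
      (Prod.map id (Multiset.cons a) : Multiset RTerm × Multiset RTerm → _) :=
    Function.injective_id.prodMap fun _ _ h => (Multiset.cons_inj_right a).1 h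
  split_ifs with h
  · conv_lhs => rw [← Multiset.cons_erase h]
    exact Multiset.count_map_eq_count' _ S hinj (A, B.erase a)
  · refine Multiset.count_eq_zero_of_notMem fun h' => h ?_
    obtain ⟨p, _, hp⟩ := Multiset.mem_map.1 h'
    rw [← show a ::ₘ p.2 = B from (Prod.ext_iff.1 hp).2]
    exact Multiset.mem_cons_self _ _

theorem count_map_antidiagonal_left (a : RTerm) (S : Multiset (Multiset RTerm × Multiset RTerm))
    (A B : Multiset RTerm) : (S.map (Prod.map (Multiset.cons a) id)).count (A, B) =
      if a ∈ A then S.count (A.erase a, B) else 0 := by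
  have hinj : Function.Injective
      (Prod.map (Multiset.cons a) id : Multiset RTerm × Multiset RTerm → _) :=
    Function.Injective.prodMap (fun _ _ h => (Multiset.cons_inj_right a).1 h)
      Function.injective_id
  split_ifs with h
  · conv_lhs => rw [← Multiset.cons_erase h]
    exact Multiset.count_map_eq_count' _ S hinj (A.erase a, B)
  · refine Multiset.count_eq_zero_of_notMem fun h' => h ?_
    obtain ⟨p, _, hp⟩ := Multiset.mem_map.1 h'
    rw [← show a ::ₘ p.1 = A from (Prod.ext_iff.1 hp).1]
    exact Multiset.mem_cons_self _ _

/-- This is Pascal's rule, one element at a time: the new `a` belongs to `A` or to `B`, and the two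
contributions carry the factors `A.count a` and `B.count a`, whose sum is the factor gained by
`permCount T`. -/
theorem count_antidiagonal_mul (T A B : Multiset RTerm) (h : A + B = T) :
    T.antidiagonal.count (A, B) * (permCount A * permCount B) = permCount T := by
  induction T using Multiset.induction generalizing A B with
  | empty =>
    obtain ⟨rfl, rfl⟩ := add_eq_zero.1 h
    simp [permCount]
  | cons a T ih =>
    rw [Multiset.antidiagonal_cons, Multiset.count_add, count_map_antidiagonal_right,
      count_map_antidiagonal_left, permCount_cons, ← h, Multiset.count_add, add_mul, add_mul,
      add_comm]
    congr 1
    · split_ifs with ha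
      · have : A.erase a + B = T := by
          rw [← Multiset.erase_add_left_pos _ ha, h, Multiset.erase_cons_head]
        rw [permCount_of_mem ha, ← ih _ _ this]; ring
      · rw [Multiset.count_eq_zero_of_notMem ha, zero_mul, zero_mul]
    · split_ifs with hb
      · have : A + B.erase a = T := by
          rw [← Multiset.erase_add_right_pos _ hb, h, Multiset.erase_cons_head]
        rw [permCount_of_mem hb, ← ih _ _ this]; ring
      · rw [Multiset.count_eq_zero_of_notMem hb, zero_mul, zero_mul]

/-- The multiplicity of a bag. -/
noncomputable def bagMult (T : Multiset RTerm) : ℕ := permCount T * (T.map RTerm.mult).prod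

theorem bagMult_zero : bagMult 0 = 1 := by simp [bagMult, permCount]

theorem bagMult_singleton (t : RTerm) : bagMult {t} = t.mult := by simp [bagMult, permCount]

theorem RTerm.mult_var (n : ℕ) : (RTerm.var n).mult = 1 := by
  rw [RTerm.mult]
  split <;> rename_i h <;> rw [shape_var] at h <;> cases h

theorem RTerm.mult_const : RTerm.const.mult = 1 := by
  rw [RTerm.mult]
  split <;> rename_i h <;> rw [shape_const] at h <;> cases h

theorem RTerm.mult_lam (t : RTerm) : (RTerm.lam t).mult = t.mult := by
  rw [RTerm.mult]
  split <;> rename_i h <;> rw [shape_lam] at h <;> cases h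
  rfl

theorem RTerm.mult_app (t : RTerm) (T : Multiset RTerm) :
    (RTerm.app t T).mult = t.mult * bagMult T := by
  rw [RTerm.mult]
  split <;> rename_i h <;> rw [shape_app] at h <;> cases h
  rw [Finset.prod_attach T.toFinset fun s => (T.count s).factorial * s.mult ^ T.count s,
    Finset.prod_mul_distrib, bagMult, Finset.prod_multiset_map_count, permCount]

theorem RTerm.mult_ne_zero (t : RTerm) : t.mult ≠ 0 := by
  induction t using RTerm.induct with
  | var n => rw [mult_var]; exact one_ne_zero
  | const => rw [mult_const]; exact one_ne_zero
  | lam t ih => rwa [mult_lam]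
  | app t T ih ih' =>
    rw [mult_app, bagMult]
    refine mul_ne_zero ih (mul_ne_zero ?_ ?_)
    · exact Finset.prod_ne_zero_iff.2 fun s _ => Nat.factorial_ne_zero _
    · refine Multiset.prod_ne_zero fun h => ?_
      obtain ⟨s, hs, h⟩ := Multiset.mem_map.1 h
      exact ih' s hs h

/-- The product of the `m(s)` is the same for all splittings, and the repetitions of a pair combine
with its factorials into those of `T`. -/
theorem sum_antidiagonal_bagMult {S : Type*} [CommSemiring S] (T : Multiset RTerm)
    (g : Multiset RTerm × Multiset RTerm → S) :
    (T.antidiagonal.map fun p => (bagMult p.1 : S) * bagMult p.2 * g p).sum =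
      bagMult T * ∑ p ∈ T.antidiagonal.toFinset, g p := by
  rw [Finset.sum_multiset_map_count, Finset.mul_sum]
  refine Finset.sum_congr rfl fun p hp => ?_
  have h := Multiset.mem_antidiagonal.1 (Multiset.mem_toFinset.1 hp)
  rw [nsmul_eq_mul, ← mul_assoc]
  congr 1
  rw [← Nat.cast_mul, ← Nat.cast_mul, bagMult, bagMult, bagMult,
    ← count_antidiagonal_mul T p.1 p.2 h, ← h, Multiset.map_add, Multiset.prod_add]
  congr 1
  ring

mutual
/-- The multiplicity of a closure. -/
noncomputable def RClo.mult : RClo → ℕ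
  | .mk T e => bagMult T * envMult e
/-- The multiplicity of an environment or of a stack. -/
noncomputable def envMult : List RClo → ℕ
  | [] => 1
  | c :: e => c.mult * envMult e
end

mutual
-- The count for a single bag is carried through the nesting of closures. It converts the labelled
-- sums of linear substitution into the unlabelled sums of the machine.
theorem RClo.sum_labSplits_mult {S : Type*} [CommSemiring S] :
    ∀ (c : RClo) (g : RClo → RClo → S),
    (c.labSplits.map fun p => (p.1.mult : S) * p.2.mult * g p.1 p.2).sum =
      c.mult * ∑ p ∈ c.splits, g p.1 p.2
  | .mk T e, g => by
    rw [RClo.sum_labSplits_mk T e fun c' c'' => (c'.mult : S) * c''.mult * g c' c'',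
      RClo.splits, Finset.sum_image, Finset.sum_product_right]
    · have h : ∀ q : List RClo × List RClo, (T.antidiagonal.map fun p =>
          (((RClo.mk p.1 q.1).mult : ℕ) : S) * ((RClo.mk p.2 q.2).mult : ℕ) *
            g (.mk p.1 q.1) (.mk p.2 q.2)).sum = (envMult q.1 : S) * envMult q.2 *
          (bagMult T * ∑ p ∈ T.antidiagonal.toFinset, g (.mk p.1 q.1) (.mk p.2 q.2)) := by
        intro q
        rw [← sum_antidiagonal_bagMult T fun p => g (.mk p.1 q.1) (.mk p.2 q.2),
          ← Multiset.sum_map_mul_left]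
        refine congrArg _ (Multiset.map_congr rfl fun p _ => ?_)
        rw [RClo.mult, RClo.mult]
        push_cast
        ring
      simp only [h]
      rw [sum_envLabSplits_mult e fun e' e'' =>
        (bagMult T : S) * ∑ p ∈ T.antidiagonal.toFinset, g (.mk p.1 e') (.mk p.2 e''),
        ← Finset.mul_sum, RClo.mult]
      push_cast
      ring
    · rintro ⟨⟨A, B⟩, ⟨a, b⟩⟩ _ ⟨⟨A', B'⟩, ⟨a', b'⟩⟩ _ h
      simp only [Prod.mk.injEq, RClo.mk.injEq] at h ⊢
      tauto
theorem sum_envLabSplits_mult {S : Type*} [CommSemiring S] :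
    ∀ (e : List RClo) (g : List RClo → List RClo → S),
    ((envLabSplits e).map fun p => (envMult p.1 : S) * envMult p.2 * g p.1 p.2).sum =
      envMult e * ∑ p ∈ envSplits e, g p.1 p.2
  | [], g => by
    rw [sum_envLabSplits_nil fun e' e'' => (envMult e' : S) * envMult e'' * g e' e'', envSplits,
      Finset.sum_singleton, envMult]
    simp
  | c :: e, g => by
    rw [sum_envLabSplits_cons c e fun e' e'' => (envMult e' : S) * envMult e'' * g e' e'',
      envSplits, Finset.sum_image, Finset.sum_product_right]
    · have h : ∀ q : List RClo × List RClo, (c.labSplits.map fun p =>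
          ((envMult (p.1 :: q.1) : ℕ) : S) * (envMult (p.2 :: q.2) : ℕ) *
            g (p.1 :: q.1) (p.2 :: q.2)).sum = (envMult q.1 : S) * envMult q.2 *
          (c.mult * ∑ p ∈ c.splits, g (p.1 :: q.1) (p.2 :: q.2)) := by
        intro q
        rw [← RClo.sum_labSplits_mult c fun c' c'' => g (c' :: q.1) (c'' :: q.2),
          ← Multiset.sum_map_mul_left]
        refine congrArg _ (Multiset.map_congr rfl fun p _ => ?_)
        rw [envMult, envMult]
        push_cast
        ring
      simp only [h]
      rw [sum_envLabSplits_mult e fun e' e'' =>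
        (c.mult : S) * ∑ p ∈ c.splits, g (p.1 :: e') (p.2 :: e''),
        ← Finset.mul_sum, envMult]
      push_cast
      ring
    · rintro ⟨⟨A, B⟩, ⟨a, b⟩⟩ _ ⟨⟨A', B'⟩, ⟨a', b'⟩⟩ _ h
      simp only [Prod.mk.injEq, List.cons.injEq] at h ⊢
      tauto
end

mutual
theorem RClo.mult_of_isOne : ∀ c : RClo, c.IsOne → c.mult = 1
  | .mk T e, h => by
    rw [RClo.IsOne] at h
    rw [RClo.mult, h.1, bagMult_zero, envMult_of_isOne e h.2]
theorem envMult_of_isOne : ∀ e : List RClo, envIsOne e → envMult e = 1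
  | [], _ => by rw [envMult]
  | c :: e, h => by
    rw [envIsOne] at h
    rw [envMult, RClo.mult_of_isOne c h.1, envMult_of_isOne e h.2]
end

theorem envMult_of_forall_ne {e : List RClo} {x : ℕ} (h : ∀ y, y ≠ x → (envAt e y).IsOne) :
    envMult e = (envAt e x).mult := by
  induction e generalizing x with
  | nil => simp [envAt, RClo.one, RClo.mult, envMult, bagMult_zero]
  | cons c e ih =>
    rw [envMult]
    cases x with
    | zero =>
      rw [envMult_of_isOne e ((envIsOne_iff e).2 fun y => h (y + 1) (by simp)), mul_one]
      rfl
    | succ x =>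
      rw [RClo.mult_of_isOne c (h 0 (by simp)), one_mul,
        ih fun y hy => h (y + 1) (by simpa using hy)]
      rfl

end multiplicity

/-! # Weights of closures -/

section weights
open Classical
variable {S : Type*} [CommSemiring S]

mutual
/-- The weight of a resource closure in an algebraic closure. -/
noncomputable def RClo.weight : RClo → AClo S → S
  | .mk T e, .mk N E => (T.map fun s => _root_.weight s N).prod * envWeight e E
/-- The weight of a resource environment in an algebraic environment. -/
noncomputable def envWeight : List RClo → List (AClo S) → S
  | [], _ => 1
  | c :: e, G :: E => c.weight G * envWeight e E
  | c :: e, [] => if envIsOne (c :: e) then 1 else 0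
end

/-- The weight of a resource stack in an algebraic stack. -/
noncomputable def stackWeight : List RClo → List (AClo S) → S
  | [], [] => 1
  | c :: ps, G :: Ps => c.weight G * stackWeight ps Ps
  | _, _ => 0

mutual
theorem RClo.weight_of_isOne : ∀ (c : RClo) (G : AClo S), c.IsOne → c.weight G = 1
  | .mk T e, .mk N E, h => by
    rw [RClo.IsOne] at h
    rw [RClo.weight, envWeight_of_isOne e E h.2, h.1]
    simp
theorem envWeight_of_isOne : ∀ (e : List RClo) (E : List (AClo S)), envIsOne e → envWeight e E = 1
  | [], _, _ => by rw [envWeight]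
  | c :: e, [], h => by rw [envWeight, if_pos h]
  | c :: e, G :: E, h => by
    rw [envIsOne] at h
    rw [envWeight, RClo.weight_of_isOne c G h.1, envWeight_of_isOne e E h.2, one_mul]
end

mutual
theorem RClo.isOne_labSplits : ∀ (c : RClo) (p : RClo × RClo), p ∈ c.labSplits →
    (c.IsOne ↔ p.1.IsOne ∧ p.2.IsOne)
  | .mk T e, p, hp => by
    rw [RClo.labSplits, Multiset.mem_bind] at hp
    obtain ⟨q, hq, hp⟩ := hp
    obtain ⟨r, hr, rfl⟩ := Multiset.mem_map.1 hp
    rw [RClo.IsOne, RClo.IsOne, RClo.IsOne, envIsOne_envLabSplits e q hq,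
      ← Multiset.mem_antidiagonal.1 hr, add_eq_zero]
    tauto
theorem envIsOne_envLabSplits : ∀ (e : List RClo) (p : List RClo × List RClo),
    p ∈ envLabSplits e → (envIsOne e ↔ envIsOne p.1 ∧ envIsOne p.2)
  | [], p, hp => by
    rw [envLabSplits, Multiset.mem_singleton] at hp
    simp [hp, envIsOne]
  | c :: e, p, hp => by
    rw [envLabSplits, Multiset.mem_bind] at hp
    obtain ⟨q, hq, hp⟩ := hp
    obtain ⟨r, hr, rfl⟩ := Multiset.mem_map.1 hp
    rw [envIsOne, envIsOne, envIsOne, envIsOne_envLabSplits e q hq, RClo.isOne_labSplits c r hr]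
    tauto
end

mutual
-- The weight of a multiset is a product over its elements, hence independent of how they are
-- distributed.
theorem RClo.weight_labSplits : ∀ (c : RClo) (G : AClo S) (p : RClo × RClo), p ∈ c.labSplits →
    p.1.weight G * p.2.weight G = c.weight G
  | .mk T e, .mk N E, p, hp => by
    rw [RClo.labSplits, Multiset.mem_bind] at hp
    obtain ⟨q, hq, hp⟩ := hp
    obtain ⟨r, hr, rfl⟩ := Multiset.mem_map.1 hp
    rw [RClo.weight, RClo.weight, RClo.weight, ← envWeight_envLabSplits e E q hq,
      ← Multiset.mem_antidiagonal.1 hr, Multiset.map_add, Multiset.prod_add]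
    ring
theorem envWeight_envLabSplits : ∀ (e : List RClo) (E : List (AClo S))
    (p : List RClo × List RClo), p ∈ envLabSplits e →
    envWeight p.1 E * envWeight p.2 E = envWeight e E
  | [], E, p, hp => by
    rw [envLabSplits, Multiset.mem_singleton] at hp
    simp [hp, envWeight]
  | c :: e, [], p, hp => by
    -- Outside the domain of the algebraic environment the weight is the indicator of emptiness,
    -- which is multiplicative along splittings.
    have h := envIsOne_envLabSplits (c :: e) p hp
    rw [envLabSplits, Multiset.mem_bind] at hp
    obtain ⟨q, hq, hp⟩ := hp
    obtain ⟨r, hr, rfl⟩ := Multiset.mem_map.1 hp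
    rw [envWeight, envWeight, envWeight]
    split_ifs <;> simp_all
  | c :: e, G :: E, p, hp => by
    rw [envLabSplits, Multiset.mem_bind] at hp
    obtain ⟨q, hq, hp⟩ := hp
    obtain ⟨r, hr, rfl⟩ := Multiset.mem_map.1 hp
    rw [envWeight, envWeight, envWeight, ← envWeight_envLabSplits e E q hq,
      ← RClo.weight_labSplits c G r hr]
    ring
end

/-- This accounts for the states where the machine is stuck on an unbound variable while a resource
is present. -/
theorem envWeight_of_getElem?_none {e : List RClo} {E : List (AClo S)} {x : ℕ}
    (h : ¬ (envAt e x).IsOne) (hE : E[x]? = none) : envWeight e E = 0 := by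
  induction e generalizing E x with
  | nil =>
    refine absurd ?_ h
    simp [envAt, RClo.one, RClo.IsOne, envIsOne]
  | cons c e ih =>
    cases E with
    | nil => rw [envWeight, if_neg fun h' => h ((envIsOne_iff _).1 h' x)]
    | cons G E =>
      cases x with
      | zero => simp at hE
      | succ x => rw [envWeight, ih (x := x) h (by simpa using hE), mul_zero]

theorem envWeight_of_getElem?_some {e : List RClo} {E : List (AClo S)} {x : ℕ} {G : AClo S}
    (h : ∀ y, y ≠ x → (envAt e y).IsOne) (hE : E[x]? = some G) :
    envWeight e E = (envAt e x).weight G := by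
  induction e generalizing E x with
  | nil =>
    rw [envWeight, RClo.weight_of_isOne]
    simp [envAt, RClo.one, RClo.IsOne, envIsOne]
  | cons c e ih =>
    cases E with
    | nil => simp at hE
    | cons H E =>
      rw [envWeight]
      cases x with
      | zero =>
        rw [envWeight_of_isOne e E ((envIsOne_iff e).2 fun y => h (y + 1) (by simp)), mul_one]
        rw [show H = G by simpa using hE]
        rfl
      | succ x =>
        rw [RClo.weight_of_isOne c H (h 0 (by simp)), one_mul,
          ih (fun y hy => h (y + 1) (by simpa using hy)) (by simpa using hE)]
        rfl

end weights

/-! # Correctness of the machine -/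

section machine
variable {S : Type*} [CommSemiring S]

/-- The value predicted for the coefficient of the machine, multiplied by the multiplicity of the
resource state. -/
noncomputable def stateValue (w : S) (E Ps : List (AClo S)) (v : Comb) (e ps : List RClo) : S :=
  w * envWeight e E * stackWeight ps Ps * (obs (envBags ps) (act 0 (envBags e) v) : ℕ)

theorem kamAux_const (E Ps : List (AClo S)) (t : RTerm) (e ps : List RClo) :
    kamAux .const E Ps t e ps * (t.mult * envMult e * envMult ps : ℕ) =
      stateValue (weightAux .const t) E Ps (pt t) e ps := by
  rw [kamAux, weightAux, stateValue]
  by_cases ht : t = const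
  · subst ht
    rw [act_const, map_nsmul, obs_const, prod_bagCounit_envBags, mult_const]
    by_cases he : envIsOne e
    · rw [envWeight_of_isOne e E he, envMult_of_isOne e he]
      cases ps <;> cases Ps <;> simp [he, stackWeight, envBags, envMult]
    · simp [he]
  · simp [ht]

/-- When the other closures are empty, all multiplicities and weights of `e` reduce to those of the
closure at `x`, and `act_var` replaces the variable by the linear part of that closure, which is
nonzero only if its multiset is a singleton. The next state then has the same predicted value. -/
theorem kamAux_var {n : ℕ}
    (ih : ∀ (M : ATerm S) (E Ps : List (AClo S)) (t : RTerm) (e ps : List RClo),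
      t.size + envSize e + envSize ps < n →
      kamAux M E Ps t e ps * (t.mult * envMult e * envMult ps : ℕ) =
        stateValue (weightAux M t) E Ps (pt t) e ps)
    (x : ℕ) (E Ps : List (AClo S)) (t : RTerm) (e ps : List RClo)
    (hn : t.size + envSize e + envSize ps = n) :
    kamAux (.var x) E Ps t e ps * (t.mult * envMult e * envMult ps : ℕ) =
      stateValue (weightAux (.var x) t) E Ps (pt t) e ps := by
  rw [kamAux, weightAux, stateValue]
  by_cases ht : t = .var x
  swap
  · rw [dif_neg fun h => ht h.1, if_neg ht]; simp
  rw [if_pos ht, one_mul]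
  by_cases hx : x < e.length
  swap
  -- A variable beyond the list is bound to the empty closure by default: the machine has no term to
  -- fetch, and a variable in head position never yields the constant.
  · rw [dif_neg, ht, act_var_of_le _ (by rw [length_envBags]; omega), map_nsmul, obs_var]
    · simp
    · rintro ⟨-, -, s, hs⟩
      have : envAt e x = RClo.one := by
        rw [envAt, List.getD_eq_default]; omega
      rw [this, RClo.one, RClo.terms] at hs
      exact Multiset.singleton_ne_zero s hs.symm
  have hact := act_var 0 e hx
  rw [zero_add, shL_zero] at hact
  by_cases he : ∀ y, y ≠ x → (envAt e y).IsOne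
  swap
  · rw [dif_neg fun h => he h.2.1, ht, hact, if_neg he]; simp
  rw [ht, hact, if_pos he]
  by_cases hs : ∃ s, (envAt e x).terms = {s}
  swap
  · rw [dif_neg fun h => hs h.2.2]
    have : bagLin (envAt e x).toBags = 0 := by
      revert hs
      generalize envAt e x = c
      cases c with
      | mk T f =>
        intro hs
        rw [RClo.toBags, bagLin_actB, bagLin_bag_of_card_ne, map_zero]
        exact fun h => hs (Multiset.card_eq_one.1 h)
    rw [this]
    simp
  rw [dif_pos ⟨rfl, he, hs⟩]
  have hs' := hs.choose_spec
  have hsize := size_envAt_le e x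
  rw [ht, size_var] at hn
  rw [envMult_of_forall_ne he, mult_var]
  -- Only the equation with the singleton matters; forgetting that `s` was obtained by choice allows
  -- the closure to be generalized.
  revert hs'
  generalize hs.choose = s
  intro hs'
  split
  · next N E' hE =>
    rw [envWeight_of_getElem?_some he hE]
    revert hs' hsize
    generalize envAt e x = c
    cases c with
    | mk T f =>
      intro hsize hs'
      obtain rfl : T = {s} := hs'
      rw [RClo.size, Multiset.map_singleton, Multiset.sum_singleton] at hsize
      have h := ih N.out E' Ps s f ps (by omega)
      rw [stateValue] at h
      rw [RClo.env, RClo.mult, bagMult_singleton, RClo.toBags, bagLin_actB, bagLin_bag_singleton,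
        RClo.weight, Multiset.map_singleton, Multiset.prod_singleton, one_mul, h]
      congr 3
      conv_rhs => rw [← Quotient.out_eq N]
      rfl
  · next hE =>
    rw [envWeight_of_getElem?_none (fun h => ?_) hE]
    · simp
    · revert hs' h
      generalize envAt e x = c
      cases c with
      | mk T f =>
        intro hs' h
        rw [RClo.IsOne] at h
        rw [RClo.terms, h.1] at hs'
        exact Multiset.singleton_ne_zero s hs'.symm

theorem weightAux_lam (M : ATerm S) (u : RTerm) : weightAux (.lam M) (.lam u) = weightAux M u := by
  rw [weightAux, shape_lam]

theorem weightAux_app (M N : ATerm S) (u : RTerm) (T : Multiset RTerm) :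
    weightAux (.app M N) (.app u T) =
      weightAux M u * (T.map fun s => weight s (⟦N⟧ : AlgTerm S)).prod := by
  classical
  rw [weightAux, shape_app, Finset.prod_multiset_map_count]
  congr 1

/-- The closure passes from the stack to the environment, so its multiplicity and weight only change
place; on the observed side this is one head step (`obs_lamL_cons`). -/
theorem kamAux_lam {n : ℕ}
    (ih : ∀ (M : ATerm S) (E Ps : List (AClo S)) (t : RTerm) (e ps : List RClo),
      t.size + envSize e + envSize ps < n →
      kamAux M E Ps t e ps * (t.mult * envMult e * envMult ps : ℕ) =
        stateValue (weightAux M t) E Ps (pt t) e ps)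
    (M : ATerm S) (E Ps : List (AClo S)) (t : RTerm) (e ps : List RClo)
    (hn : t.size + envSize e + envSize ps = n) :
    kamAux (.lam M) E Ps t e ps * (t.mult * envMult e * envMult ps : ℕ) =
      stateValue (weightAux (.lam M) t) E Ps (pt t) e ps := by
  rw [kamAux]
  split
  · next u hu =>
    obtain rfl := eq_of_shape_lam hu
    rw [weightAux_lam, stateValue, mult_lam, ← lamL_pt, act_lamL]
    rw [size_lam] at hn
    cases ps with
    | nil =>
      rw [envBags, obs_lamL_nil]
      cases Ps <;> simp
    | cons c ps =>
      cases Ps with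
      | nil => simp [stackWeight]
      | cons G Ps =>
        simp only [envSize] at hn
        have h := ih M (G :: E) Ps u (c :: e) ps (by simp only [envSize]; omega)
        rw [stateValue, envWeight, envBags, act_cons, envMult] at h
        rw [envBags, obs_lamL_cons, stackWeight, envMult]
        refine Eq.trans ?_ (h.trans ?_)
        · congr 2; ring
        · congr 1; ring
  · next h =>
    have : weightAux (.lam M) t = (0 : S) := by
      rw [weightAux]
      split
      · next u hu => exact absurd hu (h u)
      · rfl
    rw [this, stateValue]
    simp

/-- The factor `envMult e` absorbs the difference between unlabelled and labelled splittings; each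
labelled splitting is then an instance of the induction hypothesis, with the argument bag moved to
the stack. -/
theorem kamAux_app {n : ℕ}
    (ih : ∀ (M : ATerm S) (E Ps : List (AClo S)) (t : RTerm) (e ps : List RClo),
      t.size + envSize e + envSize ps < n →
      kamAux M E Ps t e ps * (t.mult * envMult e * envMult ps : ℕ) =
        stateValue (weightAux M t) E Ps (pt t) e ps)
    (M N : ATerm S) (E Ps : List (AClo S)) (t : RTerm) (e ps : List RClo)
    (hn : t.size + envSize e + envSize ps = n) :
    kamAux (.app M N) E Ps t e ps * (t.mult * envMult e * envMult ps : ℕ) =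
      stateValue (weightAux (.app M N) t) E Ps (pt t) e ps := by
  rw [kamAux]
  split
  · next u T hu =>
    obtain rfl := eq_of_shape_app hu
    rw [Finset.sum_attach (envSplits e) fun p =>
      kamAux M E (.mk ⟦N⟧ E :: Ps) u p.1 (.mk T p.2 :: ps), mult_app, stateValue, weightAux_app,
      ← appL_pt_bag, act_appL, map_multiset_sum, Multiset.map_map]
    rw [size_app] at hn
    have hsum := sum_envLabSplits_mult (S := S) e fun e' e'' =>
      kamAux M E (.mk ⟦N⟧ E :: Ps) u e' (.mk T e'' :: ps)
    calc _ = ((envMult e : S) * ∑ p ∈ envSplits e,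
            kamAux M E (.mk ⟦N⟧ E :: Ps) u p.1 (.mk T p.2 :: ps)) *
          ((u.mult * bagMult T * envMult ps : ℕ) : S) := by push_cast; ring
      _ = _ := by
        rw [← hsum, ← Multiset.sum_map_mul_right, ← Nat.coe_castAddMonoidHom, map_multiset_sum,
          ← Multiset.sum_map_mul_left, Multiset.map_map]
        refine congrArg _ (Multiset.map_congr rfl fun p hp => ?_)
        have hsize := size_of_mem_envSplits e p (mem_envSplits_of_mem_envLabSplits e p hp)
        have h := ih M E (.mk ⟦N⟧ E :: Ps) u p.1 (.mk T p.2 :: ps) (by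
          simp only [envSize, RClo.size]; omega)
        rw [stateValue, stackWeight, RClo.weight, envBags, RClo.toBags, envMult, RClo.mult] at h
        rw [← envWeight_envLabSplits e E p hp]
        refine Eq.trans ?_ (h.trans ?_)
        · simp only [Nat.coe_castAddMonoidHom]; push_cast; ring
        · simp only [Function.comp_apply, Nat.coe_castAddMonoidHom, obs_appL]; ring
  · next h =>
    have : weightAux (.app M N) t = (0 : S) := by
      rw [weightAux]
      split
      · next u T hu => exact absurd hu (h u T)
      · rfl
    rw [this, stateValue]
    simp

/-- The coefficients of the machine, from arbitrary states. -/
theorem kamAux_mul_mult (M : ATerm S) (E Ps : List (AClo S)) (t : RTerm) (e ps : List RClo) :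
    kamAux M E Ps t e ps * (t.mult * envMult e * envMult ps : ℕ) =
      stateValue (weightAux M t) E Ps (pt t) e ps := by
  -- The algebraic term is generalized as well, because a variable transition continues with an
  -- unrelated term taken from the environment.
  induction hn : t.size + envSize e + envSize ps using Nat.strong_induction_on
    generalizing M E Ps t e ps with
  | _ n ih =>
    have ih' : ∀ (M : ATerm S) (E Ps : List (AClo S)) (t : RTerm) (e ps : List RClo),
        t.size + envSize e + envSize ps < n →
        kamAux M E Ps t e ps * (t.mult * envMult e * envMult ps : ℕ) =
          stateValue (weightAux M t) E Ps (pt t) e ps :=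
      fun M E Ps t e ps h => ih _ h M E Ps t e ps rfl
    induction M with
    | var x => exact kamAux_var ih' x E Ps t e ps hn
    | const => exact kamAux_const E Ps t e ps
    | lam M _ => exact kamAux_lam ih' M E Ps t e ps hn
    | app M N _ _ => exact kamAux_app ih' M N E Ps t e ps hn
    | smul a M hM => rw [kamAux, weightAux, mul_assoc, hM, stateValue, stateValue]; ring
    | add M N hM hN =>
      rw [kamAux, weightAux, add_mul, hM, hN, stateValue, stateValue, stateValue]; ring
    | zero => rw [kamAux, weightAux, stateValue]; ring

/-- The coefficient of the machine, multiplied by the multiplicity of the term. -/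
theorem kamHat_mul_mult (M : AlgTerm S) (t : RTerm) :
    kamHat M t * (t.mult : S) = weight t M * (head t [] : ℕ) := by
  induction M using Quotient.inductionOn with
  | _ M =>
    have h := kamAux_mul_mult M [] [] t [] []
    rw [stateValue, envWeight, stackWeight, envMult, mul_one, mul_one, mul_one, mul_one, envBags,
      obs, show act 0 [] (pt t) = pt t from rfl, headL_pt] at h
    exact h

end machine

theorem theorem1 {S : Type*} [Semifield S] (hS : ∀ n : ℕ, n ≠ 0 → (n : S) ≠ 0)
    (M : AlgTerm S) (t : RTerm) :
    kamHat M t = taylor M t * (RTerm.NF (Finsupp.single t 1) RTerm.const : S) := by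
  rw [taylor, NF_const, div_mul_eq_mul_div, ← kamHat_mul_mult,
    mul_div_cancel_right₀ _ (hS _ t.mult_ne_zero)]
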